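/- Let $q\in\mathbb{C}\setminus\{0\}$ with $q^2\neq-1$, fix a square root $q^{1/2}$, and put $\hat q=q-q^{-1}$, $[2]=q+q^{-1}$. Indices run over $\{1,2\}$ and repeated indices are summed. Let $$\hat R^{ij}_{kl}=\delta^i_l\delta^j_k\,q^{\delta^i_j-1/2}+q^{-1/2}\hat q\,\delta^i_1\delta^k_1\delta^j_2\delta^l_2,\qquad \check C^{ij}=q^{-1/2}\delta^i_1\delta^j_2-q^{1/2}\delta^i_2\delta^j_1,\qquad \hat C_{ij}=-\check C^{ij},$$ and let $\hat R^{-1}$ be the inverse of the matrix $\hat R$ (rows $(i,j)$, columns $(k,l)$). **Setting.** Let $\mathcal A=\mathcal O(SL_q(2))$ be the Hopf algebra over $\mathbb{C}$ generated by $u^i_j$ with relations $\hat R^{ij}_{kl}u^k_mu^l_n=u^i_ku^j_l\hat R^{kl}_{mn}$ and $u^1_1u^2_2-q\,u^1_2u^2_1=1$, with $\Delta(u^i_j)=u^i_k\otimes u^k_j$ and $\varepsilon(u^i_j)=\delta^i_j$. Fix a sign $\varepsilon_\pm\in\{1,-1\}$ and $c_1\in\mathbb{C}\setminus\{0\}$.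 Let $\Gamma$ be the bicovariant $\mathcal A$-bimodule of the $4D_\pm$-calculus: the free left $\mathcal A$-module on $\theta_{11},\theta_{12},\theta_{21},\theta_{22}$ with right action determined by $$\theta_{ij}u^k_l=u^k_m\,f^{ij}_{rt}(u^m_l)\,\theta_{rt},\qquad f^{ij}_{rt}(u^m_l)=\varepsilon_\pm\,\hat R^{mr}_{in}(\hat R^{-1})^{nt}_{jl},$$ where $a\mapsto (f^{ij}_{rt}(a))$ is extended to $\mathcal A$ as an algebra homomorphism into matrices, with left coaction $\Delta_L(\theta_{ij})=1\otimes\theta_{ij}$ and right coaction $\Delta_R(\theta_{ij})=\theta_{kl}\otimes u^k_iu^l_j$. Its canonical braiding $\sigma$ and the bicovariant $\sigma$-metric $g$ are the left $\mathcal A$-linear maps on $\Gamma\otimes_{\mathcal A}\Gamma$ given by $$\sigma(\theta_{mn}\otimes\theta_{rt})=f^{mn}_{kl}(u^i_ru^j_t)\,\theta_{ij}\otimes\theta_{kl},\qquad g(\theta_{ij}\otimes\theta_{kl})=-q^{1/2}c_1\,\hat C_{im}\hat C_{nl}(\hat R^{-1})^{mn}_{jk}.$$ The quantum Clifford algebra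 $\mathrm{Cl}(\Gamma,\sigma,g)$ is the quotient of the tensor algebra of the $\mathcal A$-bimodule $\Gamma$ by the two-sided ideal generated by $\{z-g(z) : z\in\Gamma\otimes_{\mathcal A}\Gamma,\ \sigma(z)=z\}$. The coproduct of $\mathcal A$ and the above coactions on $\theta_{ij}$ extend to algebra homomorphisms $\Delta_L:\mathrm{Cl}(\Gamma,\sigma,g)\to\mathcal A\otimes\mathrm{Cl}(\Gamma,\sigma,g)$ and $\Delta_R:\mathrm{Cl}(\Gamma,\sigma,g)\to\mathrm{Cl}(\Gamma,\sigma,g)\otimes\mathcal A$. Let $\mathcal S_0$ be the left ideal of $\mathrm{Cl}(\Gamma,\sigma,g)$ generated by $$\psi^+_1=\frac{q}{[2]c_1}\theta_{11}\theta_{12}\theta_{21}\theta_{22},\quad \psi^+_2=\theta_{21}\theta_{22},\quad \psi^-_1=\theta_{11}\theta_{21}\theta_{22},\quad \psi^-_2=q\,\theta_{12}\theta_{21}\theta_{22};$$ it is invariant under right multiplication by $\mathcal A$. Let $(\mathcal S_0)_{\mathrm{inv}}=\{\psi\in\mathcal S_0:\Delta_L(\psi)=1\otimes\psi\}$. Let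 $\chi$ act on $\mathcal A$ as the algebra automorphism $\chi\triangleright u^i_j=q^{j-i}u^i_j$, and let $\tilde{\mathcal A}=\mathcal A\rtimes\mathbb{C}[\chi,\chi^{-1}]$ be the crossed product algebra, $(a\chi^k)(b\chi^l)=a(\chi^k\triangleright b)\chi^{k+l}$, which is a Hopf algebra with $\mathcal A$ as a Hopf subalgebra, $\Delta(\chi)=\chi\otimes\chi$, $S(\chi)=\chi^{-1}$. A Doi–Hopf module in $\mathbf M(\mathcal A)^{\tilde{\mathcal A}}_{\mathcal A}$ is a right $\mathcal A$-module $M$ with a right $\tilde{\mathcal A}$-coaction $\rho$ such that $\rho(ma)=m_{(0)}a_{(1)}\otimes m_{(1)}a_{(2)}$ for $m\in M$, $a\in\mathcal A$; here $\mathcal A$ is a right $\mathcal A$-comodule algebra by $\Delta$, and $\tilde{\mathcal A}$ is a right $\mathcal A$-module coalgebra by right multiplication. **Theorem.** There is a unique linear map $\Delta_R':(\mathcal S_0)_{\mathrm{inv}}\to(\mathcal S_0)_{\mathrm{inv}}\otimes\tilde{\mathcal A}$ with $$\Delta_R'(\psi^+_i)=\psi^+_j\otimes u^j_i\chi,\qquad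 \Delta_R'(\psi^-_i)=\psi^-_j\otimes u^j_i\chi,\qquad i=1,2;$$ it is a right coaction of $\tilde{\mathcal A}$, and it extends to a linear map $\Delta_R:\mathcal S_0\to\mathcal S_0\otimes\tilde{\mathcal A}$ such that (i) $\mathcal S_0$, with right multiplication by $\mathcal A$ as right action and $\Delta_R$ as right coaction of $\tilde{\mathcal A}$, is a Doi–Hopf module in $\mathbf M(\mathcal A)^{\tilde{\mathcal A}}_{\mathcal A}$; (ii) $\Delta_R(u\psi)=\Delta_R(u)\,\Delta_R(\psi)$ for all $u\in\mathrm{Cl}(\Gamma,\sigma,g)$ and $\psi\in\mathcal S_0$, where $\Delta_R(u)\in\mathrm{Cl}(\Gamma,\sigma,g)\otimes\mathcal A$ acts on $\mathcal S_0\otimes\tilde{\mathcal A}$ by left multiplication. -/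

import Mathlib

open scoped TensorProduct
open MulOpposite (op)

noncomputable section

namespace QSpin

/-- The parameter `q`; the unit `s` is the chosen square root `q^{1/2}`. -/
def q (s : ℂˣ) : ℂ := (s : ℂ) ^ 2

/-- `q̂ = q - q⁻¹`. -/
def qhat (s : ℂˣ) : ℂ := q s - (q s)⁻¹

/-- `[2] = q + q⁻¹`. -/
def qtwo (s : ℂˣ) : ℂ := q s + (q s)⁻¹

/-- The matrix `R̂^{ij}_{kl} = δ^i_l δ^j_k q^{δ^i_j - 1/2} + q^{-1/2} q̂ δ^i_1 δ^k_1 δ^j_2 δ^l_2`;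
the indices `1, 2` are `0, 1 : Fin 2`, the row is `(i, j)` and the column is `(k, l)`. -/
def Rhat (s : ℂˣ) : Matrix (Fin 2 × Fin 2) (Fin 2 × Fin 2) ℂ :=
  Matrix.of fun a b =>
    (if a.1 = b.2 ∧ a.2 = b.1 then (if a.1 = a.2 then (s : ℂ) else (s : ℂ)⁻¹) else 0) +
    (if a.1 = 0 ∧ b.1 = 0 ∧ a.2 = 1 ∧ b.2 = 1 then (s : ℂ)⁻¹ * qhat s else 0)

/-- `Č^{ij} = q^{-1/2} δ^i_1 δ^j_2 - q^{1/2} δ^i_2 δ^j_1`. -/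
def Ccheck (s : ℂˣ) : Matrix (Fin 2) (Fin 2) ℂ := !![0, (s : ℂ)⁻¹; -(s : ℂ), 0]

/-- `Ĉ_{ij} = -Č^{ij}`. -/
def Chat (s : ℂˣ) : Matrix (Fin 2) (Fin 2) ℂ := -Ccheck s

/-- The inverse of the matrix `R̂`, see `Rhat_mul_RhatInv`. -/
def RhatInv (s : ℂˣ) : Matrix (Fin 2 × Fin 2) (Fin 2 × Fin 2) ℂ :=
  Matrix.of fun a b =>
    (if a = b then (s : ℂ)⁻¹ else 0) + (s : ℂ) * (Ccheck s a.1 a.2 * Chat s b.1 b.2)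

theorem Rhat_mul_RhatInv (s : ℂˣ) : Rhat s * RhatInv s = 1 := by
  have hs : (s : ℂ) ≠ 0 := s.ne_zero
  ext ⟨i, j⟩ ⟨k, l⟩
  fin_cases i <;> fin_cases j <;> fin_cases k <;> fin_cases l <;>
    simp [Matrix.mul_apply, Fintype.sum_prod_type, Rhat, RhatInv, Ccheck, Chat, qhat, q] <;> field_simp <;> ring

theorem RhatInv_mul_Rhat (s : ℂˣ) : RhatInv s * Rhat s = 1 :=
  mul_eq_one_comm.mp (Rhat_mul_RhatInv s)

section QuantumMatrix

variable {B : Type*} [Ring B] [Algebra ℂ B]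

/-- The defining relations of `O(SL_q(2))` for a `2 × 2`-matrix `T` over an algebra:
`R̂^{ij}_{kl} T^k_m T^l_n = T^i_k T^j_l R̂^{kl}_{mn}` and `T^1_1 T^2_2 - q T^1_2 T^2_1 = 1`. -/
structure IsQuantumMatrix (s : ℂˣ) (T : Matrix (Fin 2) (Fin 2) B) : Prop where
  rtt : ∀ i j m n, ∑ k, ∑ l, Rhat s (i, j) (k, l) • (T k m * T l n) =
    ∑ k, ∑ l, Rhat s (k, l) (m, n) • (T i k * T j l)
  det : T 0 0 * T 1 1 - q s • (T 0 1 * T 1 0) = 1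

theorem IsQuantumMatrix.of_rels {s : ℂˣ} {T : Matrix (Fin 2) (Fin 2) B}
    (hab : T 0 0 * T 0 1 = q s • (T 0 1 * T 0 0))
    (hac : T 0 0 * T 1 0 = q s • (T 1 0 * T 0 0))
    (hbd : T 0 1 * T 1 1 = q s • (T 1 1 * T 0 1))
    (hcd : T 1 0 * T 1 1 = q s • (T 1 1 * T 1 0))
    (hbc : T 1 0 * T 0 1 = T 0 1 * T 1 0)
    (had : T 0 0 * T 1 1 = 1 + q s • (T 0 1 * T 1 0))
    (hda : T 1 1 * T 0 0 = 1 + (q s)⁻¹ • (T 0 1 * T 1 0)) : IsQuantumMatrix s T := by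
  have hs : (s : ℂ) ≠ 0 := s.ne_zero
  refine ⟨fun i j m n => ?_, by rw [had]; abel⟩
  fin_cases i <;> fin_cases j <;> fin_cases m <;> fin_cases n <;>
    simp [Rhat, hab, hac, hbd, hcd, hbc, had, hda, smul_smul, ← add_smul] <;>
    simp only [qhat, q] <;> (try match_scalars) <;> field_simp <;> ring

theorem IsQuantumMatrix.ab {s : ℂˣ} {T : Matrix (Fin 2) (Fin 2) B} (h : IsQuantumMatrix s T) :
    T 0 0 * T 0 1 = q s • (T 0 1 * T 0 0) := by
  have hs : (s : ℂ) ≠ 0 := s.ne_zero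
  have h1 := h.rtt 0 0 0 1
  simp [Rhat] at h1
  have h2 := congrArg (fun x => ((s : ℂ) ^ 3) • (x - ((s : ℂ)⁻¹ * qhat s) • (T 0 0 * T 0 1))) h1
  simp only [qhat, q] at h2 ⊢
  refine Eq.trans ?_ (h2.trans ?_) <;> match_scalars <;> field_simp <;> ring

theorem IsQuantumMatrix.cd {s : ℂˣ} {T : Matrix (Fin 2) (Fin 2) B} (h : IsQuantumMatrix s T) :
    T 1 0 * T 1 1 = q s • (T 1 1 * T 1 0) := by
  have hs : (s : ℂ) ≠ 0 := s.ne_zero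
  have h1 := h.rtt 1 1 0 1
  simp [Rhat] at h1
  have h2 := congrArg (fun x => ((s : ℂ) ^ 3) • (x - ((s : ℂ)⁻¹ * qhat s) • (T 1 0 * T 1 1))) h1
  simp only [qhat, q] at h2 ⊢
  refine Eq.trans ?_ (h2.trans ?_) <;> match_scalars <;> field_simp <;> ring

theorem IsQuantumMatrix.ac {s : ℂˣ} {T : Matrix (Fin 2) (Fin 2) B} (h : IsQuantumMatrix s T) :
    T 0 0 * T 1 0 = q s • (T 1 0 * T 0 0) := by
  have hs : (s : ℂ) ≠ 0 := s.ne_zero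
  have h1 := h.rtt 0 1 0 0
  simp [Rhat] at h1
  have h2 := congrArg (fun x => ((s : ℂ) ^ 3) • (x - ((s : ℂ)⁻¹ * qhat s) • (T 0 0 * T 1 0))) h1
  simp only [qhat, q] at h2 ⊢
  refine Eq.trans ?_ (h2.symm.trans ?_) <;> match_scalars <;> field_simp <;> ring

theorem IsQuantumMatrix.bd {s : ℂˣ} {T : Matrix (Fin 2) (Fin 2) B} (h : IsQuantumMatrix s T) :
    T 0 1 * T 1 1 = q s • (T 1 1 * T 0 1) := by
  have hs : (s : ℂ) ≠ 0 := s.ne_zero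
  have h1 := h.rtt 0 1 1 1
  simp [Rhat] at h1
  have h2 := congrArg (fun x => ((s : ℂ) ^ 3) • (x - ((s : ℂ)⁻¹ * qhat s) • (T 0 1 * T 1 1))) h1
  simp only [qhat, q] at h2 ⊢
  refine Eq.trans ?_ (h2.symm.trans ?_) <;> match_scalars <;> field_simp <;> ring

theorem IsQuantumMatrix.bc {s : ℂˣ} {T : Matrix (Fin 2) (Fin 2) B} (h : IsQuantumMatrix s T) :
    T 1 0 * T 0 1 = T 0 1 * T 1 0 := by
  simpa [Rhat] using h.rtt 0 1 0 1

theorem IsQuantumMatrix.ad {s : ℂˣ} {T : Matrix (Fin 2) (Fin 2) B} (h : IsQuantumMatrix s T) :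
    T 0 0 * T 1 1 = 1 + q s • (T 0 1 * T 1 0) := by
  rw [← h.det]; abel

theorem IsQuantumMatrix.da {s : ℂˣ} {T : Matrix (Fin 2) (Fin 2) B} (h : IsQuantumMatrix s T) :
    T 1 1 * T 0 0 = 1 + (q s)⁻¹ • (T 0 1 * T 1 0) := by
  have hs : (s : ℂ) ≠ 0 := s.ne_zero
  have h1 := h.rtt 0 1 1 0
  simp [Rhat, h.ad] at h1
  have h2 := congrArg (fun x => (s : ℂ) • (x - ((s : ℂ)⁻¹ * qhat s) • (T 0 1 * T 1 0))) h1
  simp only [qhat, q] at h2 ⊢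
  refine Eq.trans ?_ (h2.trans ?_) <;> match_scalars <;> field_simp <;> ring

theorem IsQuantumMatrix.map {B' : Type*} [Ring B'] [Algebra ℂ B'] {s : ℂˣ}
    {T : Matrix (Fin 2) (Fin 2) B} (h : IsQuantumMatrix s T) (f : B →ₐ[ℂ] B') :
    IsQuantumMatrix s (T.map f) := by
  constructor
  · intro i j m n
    simpa only [map_sum, map_smul, map_mul, Matrix.map_apply] using congrArg f (h.rtt i j m n)
  · simpa only [map_sub, map_smul, map_mul, map_one, Matrix.map_apply] using congrArg f h.det

end QuantumMatrix

/-- The defining relations of `O(SL_q(2))` in the free algebra on the symbols `u^i_j`. -/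
inductive SLRel (s : ℂˣ) : FreeAlgebra ℂ (Fin 2 × Fin 2) → FreeAlgebra ℂ (Fin 2 × Fin 2) → Prop
  | rtt (i j m n : Fin 2) : SLRel s
      (∑ k, ∑ l, Rhat s (i, j) (k, l) • (FreeAlgebra.ι ℂ (k, m) * FreeAlgebra.ι ℂ (l, n)))
      (∑ k, ∑ l, Rhat s (k, l) (m, n) • (FreeAlgebra.ι ℂ (i, k) * FreeAlgebra.ι ℂ (j, l)))
  | det : SLRel s
      (FreeAlgebra.ι ℂ (0, 0) * FreeAlgebra.ι ℂ (1, 1) -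
        q s • (FreeAlgebra.ι ℂ (0, 1) * FreeAlgebra.ι ℂ (1, 0))) 1

/-- The algebra `A = O(SL_q(2))`. -/
def OSL (s : ℂˣ) : Type := RingQuot (SLRel s)

instance (s : ℂˣ) : Ring (OSL s) := inferInstanceAs (Ring (RingQuot (SLRel s)))
instance (s : ℂˣ) : Algebra ℂ (OSL s) := inferInstanceAs (Algebra ℂ (RingQuot (SLRel s)))

/-- The quotient map from the free algebra. -/
def OSL.mk (s : ℂˣ) : FreeAlgebra ℂ (Fin 2 × Fin 2) →ₐ[ℂ] OSL s := RingQuot.mkAlgHom ℂ (SLRel s)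

/-- The matrix of generators `u^i_j` (upper index: row, lower index: column). -/
def u (s : ℂˣ) : Matrix (Fin 2) (Fin 2) (OSL s) :=
  Matrix.of fun i j => OSL.mk s (FreeAlgebra.ι ℂ (i, j))

theorem OSL.mk_rel {s : ℂˣ} {x y : FreeAlgebra ℂ (Fin 2 × Fin 2)} (h : SLRel s x y) :
    OSL.mk s x = OSL.mk s y := RingQuot.mkAlgHom_rel ℂ h

theorem u_isQuantumMatrix (s : ℂˣ) : IsQuantumMatrix s (u s) := by
  constructor
  · intro i j m n
    simpa only [map_sum, map_smul, map_mul, u, Matrix.of_apply] using OSL.mk_rel (SLRel.rtt (s := s) i j m n)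
  · simpa only [map_sub, map_smul, map_mul, map_one, u, Matrix.of_apply] using OSL.mk_rel (SLRel.det (s := s))

namespace OSL

/-- Universal property of `O(SL_q(2))`. -/
def lift (s : ℂˣ) {B : Type*} [Ring B] [Algebra ℂ B] (T : Matrix (Fin 2) (Fin 2) B)
    (h : IsQuantumMatrix s T) : OSL s →ₐ[ℂ] B :=
  RingQuot.liftAlgHom ℂ ⟨FreeAlgebra.lift ℂ fun p : Fin 2 × Fin 2 => T p.1 p.2, by
    intro x y hxy
    cases hxy with
    | rtt i j m n => simpa using h.rtt i j m n
    | det => simpa using h.det⟩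

@[simp]
theorem lift_u (s : ℂˣ) {B : Type*} [Ring B] [Algebra ℂ B] (T : Matrix (Fin 2) (Fin 2) B)
    (h : IsQuantumMatrix s T) (i j : Fin 2) : lift s T h (u s i j) = T i j := by
  refine (RingQuot.liftAlgHom_mkAlgHom_apply ℂ _ _ _).trans ?_
  simp

theorem hom_ext {s : ℂˣ} {B : Type*} [Ring B] [Algebra ℂ B] {f g : OSL s →ₐ[ℂ] B}
    (h : ∀ i j, f (u s i j) = g (u s i j)) : f = g := by
  refine RingQuot.ringQuot_ext' ℂ f g ?_
  refine FreeAlgebra.hom_ext ?_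
  funext p
  exact h p.1 p.2

theorem adjoin_u (s : ℂˣ) : Algebra.adjoin ℂ {x | ∃ i j, x = u s i j} = ⊤ := by
  set S := Algebra.adjoin ℂ {x | ∃ i j, x = u s i j} with hS
  have hmem : ∀ i j, u s i j ∈ S := fun i j => Algebra.subset_adjoin ⟨i, j, rfl⟩
  have hq : IsQuantumMatrix s (Matrix.of fun i j => (⟨u s i j, hmem i j⟩ : S)) := by
    constructor
    · intro i j m n
      apply Subtype.ext
      simpa using (u_isQuantumMatrix s).rtt i j m n
    · apply Subtype.ext
      simpa using (u_isQuantumMatrix s).det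
  have hid : S.val.comp (lift s _ hq) = AlgHom.id ℂ (OSL s) := hom_ext fun i j => by simp
  rw [eq_top_iff]
  intro x _
  have := congrArg (fun f => f x) hid
  simp only [AlgHom.comp_apply, AlgHom.id_apply] at this
  rw [← this]
  exact Subtype.prop _

end OSL

section HopfOfGenerators

variable {H : Type*} [Ring H] [Bialgebra ℂ H]

/-- An anti-endomorphism of a bialgebra that satisfies the antipode identities on a set of
algebra generators is an antipode. -/
abbrev hopfOfGenerators (S : H →ₐ[ℂ] Hᵐᵒᵖ) (X : Set H) (hX : Algebra.adjoin ℂ X = ⊤)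
    (h1 : ∀ x ∈ X, LinearMap.mul' ℂ H (((MulOpposite.opLinearEquiv ℂ).symm.toLinearMap ∘ₗ
      S.toLinearMap).rTensor H (Coalgebra.comul (R := ℂ) x)) =
        algebraMap ℂ H (Coalgebra.counit (R := ℂ) x))
    (h2 : ∀ x ∈ X, LinearMap.mul' ℂ H (((MulOpposite.opLinearEquiv ℂ).symm.toLinearMap ∘ₗ
      S.toLinearMap).lTensor H (Coalgebra.comul (R := ℂ) x)) =
        algebraMap ℂ H (Coalgebra.counit (R := ℂ) x)) :
    HopfAlgebra ℂ H where
  antipode := (MulOpposite.opLinearEquiv ℂ).symm.toLinearMap ∘ₗ S.toLinearMap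
  mul_antipode_rTensor_comul := by
    ext a
    have ha : a ∈ Algebra.adjoin ℂ X := hX ▸ Algebra.mem_top
    simp only [LinearMap.comp_apply, Algebra.linearMap_apply]
    induction ha using Algebra.adjoin_induction with
    | mem x hx => exact h1 x hx
    | algebraMap r => simp [Algebra.TensorProduct.one_def, Algebra.algebraMap_eq_smul_one]
    | add x y _ _ hx hy => simp only [map_add, hx, hy]
    | mul x y _ _ hx hy =>
      obtain rx := Coalgebra.Repr.arbitrary ℂ x
      obtain ry := Coalgebra.Repr.arbitrary ℂ y
      rw [← rx.eq] at hx
      rw [← ry.eq] at hy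
      simp only [map_sum, LinearMap.rTensor_tmul, LinearMap.mul'_apply, LinearMap.comp_apply,
        AlgHom.toLinearMap_apply, LinearEquiv.coe_coe, MulOpposite.coe_opLinearEquiv_symm] at hx hy
      rw [Bialgebra.comul_mul, Bialgebra.counit_mul, ← rx.eq, ← ry.eq, Finset.sum_mul_sum]
      simp only [map_sum, LinearMap.rTensor_tmul, LinearMap.mul'_apply, LinearMap.comp_apply,
        AlgHom.toLinearMap_apply, LinearEquiv.coe_coe, MulOpposite.coe_opLinearEquiv_symm,
        Algebra.TensorProduct.tmul_mul_tmul, map_mul, MulOpposite.unop_mul]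
      rw [Finset.sum_comm, ← hy, Finset.mul_sum]
      refine Finset.sum_congr rfl fun j _ => ?_
      rw [← mul_assoc, (Algebra.commutes _ _), mul_assoc, ← hx]
      simp only [Finset.mul_sum, Finset.sum_mul, mul_assoc]
  mul_antipode_lTensor_comul := by
    ext a
    have ha : a ∈ Algebra.adjoin ℂ X := hX ▸ Algebra.mem_top
    simp only [LinearMap.comp_apply, Algebra.linearMap_apply]
    induction ha using Algebra.adjoin_induction with
    | mem x hx => exact h2 x hx
    | algebraMap r => simp [Algebra.TensorProduct.one_def, Algebra.algebraMap_eq_smul_one]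
    | add x y _ _ hx hy => simp only [map_add, hx, hy]
    | mul x y _ _ hx hy =>
      obtain rx := Coalgebra.Repr.arbitrary ℂ x
      obtain ry := Coalgebra.Repr.arbitrary ℂ y
      rw [← rx.eq] at hx
      rw [← ry.eq] at hy
      simp only [map_sum, LinearMap.lTensor_tmul, LinearMap.mul'_apply, LinearMap.comp_apply,
        AlgHom.toLinearMap_apply, LinearEquiv.coe_coe, MulOpposite.coe_opLinearEquiv_symm] at hx hy
      rw [Bialgebra.comul_mul, Bialgebra.counit_mul, ← rx.eq, ← ry.eq, Finset.sum_mul_sum]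
      simp only [map_sum, LinearMap.lTensor_tmul, LinearMap.mul'_apply, LinearMap.comp_apply,
        AlgHom.toLinearMap_apply, LinearEquiv.coe_coe, MulOpposite.coe_opLinearEquiv_symm,
        Algebra.TensorProduct.tmul_mul_tmul, map_mul, MulOpposite.unop_mul]
      rw [← hx, Finset.sum_mul]
      refine Finset.sum_congr rfl fun i _ => ?_
      rw [mul_assoc, ← Algebra.commutes, ← hy]
      simp only [Finset.mul_sum, Finset.sum_mul, mul_assoc]

end HopfOfGenerators

namespace OSL

theorem comul_isQuantumMatrix (s : ℂˣ) : IsQuantumMatrix s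
    (Matrix.of fun i j => ∑ k, u s i k ⊗ₜ[ℂ] u s k j) := by
  have hs : (s : ℂ) ≠ 0 := s.ne_zero
  have h := u_isQuantumMatrix s
  apply IsQuantumMatrix.of_rels <;>
  simp only [Matrix.of_apply, Fin.sum_univ_two, add_mul, mul_add,
      Algebra.TensorProduct.tmul_mul_tmul, h.ab, h.ac, h.bd, h.cd, h.bc, h.ad, h.da,
      TensorProduct.tmul_add, TensorProduct.add_tmul, ← TensorProduct.smul_tmul',
      TensorProduct.tmul_smul, Algebra.TensorProduct.one_def, smul_add, smul_smul, q] <;>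
    match_scalars <;> field_simp

theorem counit_isQuantumMatrix (s : ℂˣ) : IsQuantumMatrix s (1 : Matrix (Fin 2) (Fin 2) ℂ) := by
  apply IsQuantumMatrix.of_rels <;> simp

/-- `Δ(u^i_j) = u^i_k ⊗ u^k_j`. -/
def comulHom (s : ℂˣ) : OSL s →ₐ[ℂ] OSL s ⊗[ℂ] OSL s := lift s _ (comul_isQuantumMatrix s)

/-- `ε(u^i_j) = δ^i_j`. -/
def counitHom (s : ℂˣ) : OSL s →ₐ[ℂ] ℂ := lift s _ (counit_isQuantumMatrix s)

instance instBialgebra (s : ℂˣ) : Bialgebra ℂ (OSL s) :=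
  Bialgebra.ofAlgHom (comulHom s) (counitHom s)
    (hom_ext fun i j => by
      simp [comulHom, TensorProduct.tmul_add, TensorProduct.add_tmul]; abel)
    (hom_ext fun i j => by
      fin_cases i <;> fin_cases j <;> simp [comulHom, counitHom])
    (hom_ext fun i j => by
      fin_cases i <;> fin_cases j <;> simp [comulHom, counitHom])

@[simp]
theorem comul_u (s : ℂˣ) (i j : Fin 2) :
    Coalgebra.comul (R := ℂ) (u s i j) = ∑ k, u s i k ⊗ₜ[ℂ] u s k j :=
  lift_u s _ (comul_isQuantumMatrix s) i j

@[simp]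
theorem counit_u (s : ℂˣ) (i j : Fin 2) :
    Coalgebra.counit (R := ℂ) (u s i j) = if i = j then 1 else 0 :=
  (lift_u s _ (counit_isQuantumMatrix s) i j).trans (Matrix.one_apply)

theorem antipode_isQuantumMatrix (s : ℂˣ) : IsQuantumMatrix s
    (Matrix.of fun i j =>
      MulOpposite.op (∑ k, ∑ l, (Ccheck s i k * Chat s l j) • u s l k)) := by
  have hs : (s : ℂ) ≠ 0 := s.ne_zero
  have h := u_isQuantumMatrix s
  apply IsQuantumMatrix.of_rels <;> apply MulOpposite.unop_injective <;>
  simp [Ccheck, Chat, hs, h.ab, h.ac, h.bd, h.cd, h.bc, h.ad, h.da, smul_smul] <;>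
  (try simp only [q]) <;> (try match_scalars) <;> field_simp

/-- The antipode `S(u^i_j) = Č^{ik} Ĉ_{lj} u^l_k`, as a homomorphism to the opposite algebra. -/
def antipodeHom (s : ℂˣ) : OSL s →ₐ[ℂ] (OSL s)ᵐᵒᵖ := lift s _ (antipode_isQuantumMatrix s)

instance instHopfAlgebra (s : ℂˣ) : HopfAlgebra ℂ (OSL s) :=
  hopfOfGenerators (antipodeHom s) _ (adjoin_u s)
    (by
      have hs : (s : ℂ) ≠ 0 := s.ne_zero
      have h := u_isQuantumMatrix s
      rintro _ ⟨i, j, rfl⟩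
      fin_cases i <;> fin_cases j <;>
      simp [antipodeHom, Ccheck, Chat, hs, h.ab, h.ac, h.bd, h.cd, h.bc, h.ad, h.da, smul_smul] <;>
      simp only [q] <;> match_scalars <;> field_simp <;> ring)
    (by
      have hs : (s : ℂ) ≠ 0 := s.ne_zero
      have h := u_isQuantumMatrix s
      rintro _ ⟨i, j, rfl⟩
      fin_cases i <;> fin_cases j <;>
      simp [antipodeHom, Ccheck, Chat, hs, h.ab, h.ac, h.bd, h.cd, h.bc, h.ad, h.da, smul_smul] <;>
      simp only [q] <;> match_scalars <;> field_simp <;> ring)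

end OSL

theorem scale_isQuantumMatrix (s t : ℂˣ) : IsQuantumMatrix s
    (Matrix.of fun i j : Fin 2 => ((t : ℂ) ^ ((j : ℤ) - (i : ℤ))) • u s i j) := by
  have ht : (t : ℂ) ≠ 0 := t.ne_zero
  have h := u_isQuantumMatrix s
  apply IsQuantumMatrix.of_rels <;>
  simp [ht, h.ab, h.ac, h.bd, h.cd, h.bc, h.ad, h.da, smul_smul, mul_comm]

/-- The algebra endomorphism `u^i_j ↦ t^{j-i} u^i_j` of `O(SL_q(2))`. -/
def scaleHom (s t : ℂˣ) : OSL s →ₐ[ℂ] OSL s := OSL.lift s _ (scale_isQuantumMatrix s t)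

@[simp]
theorem scaleHom_u (s t : ℂˣ) (i j : Fin 2) :
    scaleHom s t (u s i j) = ((t : ℂ) ^ ((j : ℤ) - (i : ℤ))) • u s i j :=
  OSL.lift_u s _ (scale_isQuantumMatrix s t) i j

theorem scaleHom_comp (s t t' : ℂˣ) :
    (scaleHom s t).comp (scaleHom s t') = scaleHom s (t * t') :=
  OSL.hom_ext fun i j => by
    simp [smul_smul, mul_zpow, mul_comm]

theorem scaleHom_one (s : ℂˣ) : scaleHom s 1 = AlgHom.id ℂ (OSL s) :=
  OSL.hom_ext fun i j => by simp

/-- The algebra automorphism `χ` of `O(SL_q(2))`, `χ ▷ u^i_j = q^{j-i} u^i_j`. -/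
def chiAut (s : ℂˣ) : OSL s ≃ₐ[ℂ] OSL s :=
  AlgEquiv.ofAlgHom (scaleHom s (s ^ 2)) (scaleHom s (s ^ 2)⁻¹)
    (by rw [scaleHom_comp, mul_inv_cancel, scaleHom_one])
    (by rw [scaleHom_comp, inv_mul_cancel, scaleHom_one])

theorem chiAut_u (s : ℂˣ) (i j : Fin 2) :
    chiAut s (u s i j) = (q s ^ ((j : ℤ) - (i : ℤ))) • u s i j := by
  simp [chiAut, q]

/-- The infinite cyclic group generated by the symbol `χ` acts on `O(SL_q(2))` through the
powers of the automorphism `χ`. -/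
instance (s : ℂˣ) : MulSemiringAction (Multiplicative ℤ) (OSL s) :=
  MulSemiringAction.compHom (OSL s) (zpowersHom (OSL s ≃ₐ[ℂ] OSL s) (chiAut s))

theorem smul_eq_chiAut_zpow (s : ℂˣ) (n : Multiplicative ℤ) (a : OSL s) :
    n • a = (chiAut s ^ n.toAdd) a := rfl

instance (s : ℂˣ) : SMulCommClass (Multiplicative ℤ) ℂ (OSL s) :=
  ⟨fun n c a => by simp only [smul_eq_chiAut_zpow, map_smul]⟩

theorem chiAut_zpow (s : ℂˣ) (n : ℤ) (a : OSL s) :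
    (chiAut s ^ n) a = scaleHom s ((s ^ 2) ^ n) a := by
  induction n using Int.induction_on generalizing a with
  | zero => simp [scaleHom_one]
  | succ n ih =>
    rw [zpow_add_one, zpow_add_one, AlgEquiv.mul_apply, ih, ← scaleHom_comp]; rfl
  | pred n ih =>
    rw [zpow_sub_one, zpow_sub_one, AlgEquiv.mul_apply, ih, ← scaleHom_comp]; rfl

/-- The crossed product algebra `Ã = A ⋊ ℂ[χ, χ⁻¹]`: the elements are the finite sums
`∑ a_k χ^k`, with multiplication `(a χ^k) (b χ^l) = a (χ^k ▷ b) χ^{k+l}`. -/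
abbrev Atilde (s : ℂˣ) : Type := SkewMonoidAlgebra (OSL s) (Multiplicative ℤ)

namespace Atilde

/-- The embedding of `A` into `Ã`. -/
def incl (s : ℂˣ) : OSL s →ₐ[ℂ] Atilde s where
  __ := SkewMonoidAlgebra.singleOneRingHom
  commutes' _ := rfl

/-- The group homomorphism `k ↦ χ^k` to `Ã`. -/
def chiPow (s : ℂˣ) : Multiplicative ℤ →* Atilde s := SkewMonoidAlgebra.of (OSL s) _

/-- The element `χ` of `Ã`. -/
def chi (s : ℂˣ) : Atilde s := chiPow s (Multiplicative.ofAdd 1)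

theorem incl_mul_chiPow (s : ℂˣ) (a : OSL s) (n : Multiplicative ℤ) :
    incl s a * chiPow s n = SkewMonoidAlgebra.single n a := by
  simp [incl, chiPow, SkewMonoidAlgebra.singleOneRingHom, SkewMonoidAlgebra.single_mul_single]

theorem chiPow_mul_incl (s : ℂˣ) (n : Multiplicative ℤ) (a : OSL s) :
    chiPow s n * incl s a = incl s (n • a) * chiPow s n := by
  simp [incl, chiPow, SkewMonoidAlgebra.singleOneRingHom, SkewMonoidAlgebra.single_mul_single]

/-- The multiplication rule of the crossed product. -/
theorem crossed_mul (s : ℂˣ) (a b : OSL s) (k l : ℤ) :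
    (incl s a * chiPow s (.ofAdd k)) * (incl s b * chiPow s (.ofAdd l)) =
      incl s (a * (chiAut s ^ k) b) * chiPow s (.ofAdd (k + l)) := by
  rw [mul_assoc, ← mul_assoc (chiPow s _), chiPow_mul_incl, ofAdd_add, map_mul, map_mul]
  simp only [mul_assoc]
  rfl

/-- Homomorphisms out of the crossed product. -/
def lift (s : ℂˣ) {B : Type*} [Ring B] [Algebra ℂ B] (f : OSL s →ₐ[ℂ] B)
    (g : Multiplicative ℤ →* B) (h : ∀ x y, f (y • x) * g y = g y * f x) : Atilde s →ₐ[ℂ] B :=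
  SkewMonoidAlgebra.liftNCAlgHom f g (fun {x y} => h x y)

@[simp]
theorem lift_incl (s : ℂˣ) {B : Type*} [Ring B] [Algebra ℂ B] (f : OSL s →ₐ[ℂ] B)
    (g : Multiplicative ℤ →* B) (h : ∀ x y, f (y • x) * g y = g y * f x) (a : OSL s) :
    lift s f g h (incl s a) = f a := by
  change SkewMonoidAlgebra.liftNC _ _ (SkewMonoidAlgebra.single 1 a) = _
  simp

@[simp]
theorem lift_chiPow (s : ℂˣ) {B : Type*} [Ring B] [Algebra ℂ B] (f : OSL s →ₐ[ℂ] B)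
    (g : Multiplicative ℤ →* B) (h : ∀ x y, f (y • x) * g y = g y * f x)
    (n : Multiplicative ℤ) : lift s f g h (chiPow s n) = g n := by
  change SkewMonoidAlgebra.liftNC _ _ (SkewMonoidAlgebra.single n 1) = _
  simp

theorem hom_ext {s : ℂˣ} {B : Type*} [Ring B] [Algebra ℂ B] {f g : Atilde s →ₐ[ℂ] B}
    (h1 : ∀ i j, f (incl s (u s i j)) = g (incl s (u s i j)))
    (h2 : ∀ n, f (chiPow s n) = g (chiPow s n)) : f = g := by
  have h3 : f.comp (incl s) = g.comp (incl s) := OSL.hom_ext h1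
  apply AlgHom.toLinearMap_injective
  refine SkewMonoidAlgebra.lhom_ext fun n a => ?_
  rw [← incl_mul_chiPow]
  simp only [AlgHom.toLinearMap_apply, map_mul, h2]
  rw [show f (incl s a) = g (incl s a) from congrArg (fun k => k a) h3]

theorem comul_smul (s : ℂˣ) (n : Multiplicative ℤ) (a : OSL s) :
    Coalgebra.comul (R := ℂ) (n • a) =
      Algebra.TensorProduct.map (scaleHom s ((s ^ 2) ^ n.toAdd)) (scaleHom s ((s ^ 2) ^ n.toAdd))
        (Coalgebra.comul (R := ℂ) a) := by
  rw [smul_eq_chiAut_zpow, chiAut_zpow]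
  generalize (s ^ 2) ^ n.toAdd = t
  have ht : (t : ℂ) ≠ 0 := t.ne_zero
  have : (Bialgebra.comulAlgHom ℂ (OSL s)).comp (scaleHom s t) =
      (Algebra.TensorProduct.map (scaleHom s t) (scaleHom s t)).comp
        (Bialgebra.comulAlgHom ℂ (OSL s)) := OSL.hom_ext fun i j => by
    simp only [AlgHom.comp_apply, scaleHom_u, map_smul, Bialgebra.comulAlgHom_apply, OSL.comul_u,
      map_sum, Algebra.TensorProduct.map_tmul, Finset.smul_sum, TensorProduct.tmul_smul,
      ← TensorProduct.smul_tmul', smul_smul, ← zpow_add₀ ht]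
    simp
  exact congrArg (fun k => k a) this

theorem counit_smul (s : ℂˣ) (n : Multiplicative ℤ) (a : OSL s) :
    Coalgebra.counit (R := ℂ) (n • a) = Coalgebra.counit (R := ℂ) a := by
  rw [smul_eq_chiAut_zpow, chiAut_zpow]
  generalize (s ^ 2) ^ n.toAdd = t
  have : (Bialgebra.counitAlgHom ℂ (OSL s)).comp (scaleHom s t) =
      (Bialgebra.counitAlgHom ℂ (OSL s)) := OSL.hom_ext fun i j => by
    by_cases hij : i = j <;> simp [hij]
  exact congrArg (fun k => k a) this

/-- `k ↦ χ^k ⊗ χ^k`. -/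
def chiPowDiag (s : ℂˣ) : Multiplicative ℤ →* Atilde s ⊗[ℂ] Atilde s where
  toFun n := chiPow s n ⊗ₜ[ℂ] chiPow s n
  map_one' := by simp [Algebra.TensorProduct.one_def]
  map_mul' := by simp

theorem chiPowDiag_apply (s : ℂˣ) (n : Multiplicative ℤ) :
    chiPowDiag s n = chiPow s n ⊗ₜ[ℂ] chiPow s n := rfl

/-- The coproduct of `Ã`: it extends the coproduct of `A`, and `Δ(χ) = χ ⊗ χ`. -/
def comulHom (s : ℂˣ) : Atilde s →ₐ[ℂ] Atilde s ⊗[ℂ] Atilde s :=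
  lift s ((Algebra.TensorProduct.map (incl s) (incl s)).comp (Bialgebra.comulAlgHom ℂ (OSL s)))
    (chiPowDiag s) fun x n => by
      simp only [AlgHom.comp_apply, Bialgebra.comulAlgHom_apply, comul_smul]
      generalize Coalgebra.comul (R := ℂ) x = z
      induction z using TensorProduct.induction_on with
      | zero => simp
      | add a b ha hb => simp only [map_add, add_mul, mul_add, ha, hb]
      | tmul a b =>
        simp only [Algebra.TensorProduct.map_tmul, chiPowDiag_apply,
          Algebra.TensorProduct.tmul_mul_tmul, chiPow_mul_incl, smul_eq_chiAut_zpow, chiAut_zpow]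

/-- The counit of `Ã`: it extends the counit of `A`, and `ε(χ) = 1`. -/
def counitHom (s : ℂˣ) : Atilde s →ₐ[ℂ] ℂ :=
  lift s (Bialgebra.counitAlgHom ℂ (OSL s)) 1 fun x n => by simp [counit_smul]

@[simp]
theorem comulHom_chiPow (s : ℂˣ) (n : Multiplicative ℤ) :
    comulHom s (chiPow s n) = chiPow s n ⊗ₜ[ℂ] chiPow s n := lift_chiPow s _ _ _ n

@[simp]
theorem comulHom_incl (s : ℂˣ) (a : OSL s) :
    comulHom s (incl s a) =
      Algebra.TensorProduct.map (incl s) (incl s) (Coalgebra.comul (R := ℂ) a) :=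
  lift_incl s _ _ _ a

@[simp]
theorem counitHom_chiPow (s : ℂˣ) (n : Multiplicative ℤ) : counitHom s (chiPow s n) = 1 :=
  lift_chiPow s _ _ _ n

@[simp]
theorem counitHom_incl (s : ℂˣ) (a : OSL s) :
    counitHom s (incl s a) = Coalgebra.counit (R := ℂ) a :=
  lift_incl s _ _ _ a

instance instBialgebra (s : ℂˣ) : Bialgebra ℂ (Atilde s) :=
  Bialgebra.ofAlgHom (comulHom s) (counitHom s)
    (hom_ext (fun i j => by
      simp [TensorProduct.tmul_add, TensorProduct.add_tmul]; abel) fun n => by simp)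
    (hom_ext (fun i j => by
      fin_cases i <;> fin_cases j <;> simp) fun n => by simp)
    (hom_ext (fun i j => by
      fin_cases i <;> fin_cases j <;> simp) fun n => by simp)


theorem comul_incl (s : ℂˣ) (a : OSL s) :
    Coalgebra.comul (R := ℂ) (incl s a) =
      Algebra.TensorProduct.map (incl s) (incl s) (Coalgebra.comul (R := ℂ) a) :=
  comulHom_incl s a

theorem comul_chiPow (s : ℂˣ) (n : Multiplicative ℤ) :
    Coalgebra.comul (R := ℂ) (chiPow s n) = chiPow s n ⊗ₜ[ℂ] chiPow s n := comulHom_chiPow s n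

theorem counit_incl (s : ℂˣ) (a : OSL s) :
    Coalgebra.counit (R := ℂ) (incl s a) = Coalgebra.counit (R := ℂ) a := counitHom_incl s a

theorem counit_chiPow (s : ℂˣ) (n : Multiplicative ℤ) :
    Coalgebra.counit (R := ℂ) (chiPow s n) = 1 := counitHom_chiPow s n

theorem antipodeHom_smul (s : ℂˣ) (n : Multiplicative ℤ) (a : OSL s) :
    (OSL.antipodeHom s (n • a)).unop = n • (OSL.antipodeHom s a).unop := by
  simp only [smul_eq_chiAut_zpow, chiAut_zpow]
  generalize (s ^ 2) ^ n.toAdd = t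
  have : (OSL.antipodeHom s).comp (scaleHom s t) =
      (AlgHom.op (scaleHom s t)).comp (OSL.antipodeHom s) := OSL.hom_ext fun i j => by
    apply MulOpposite.unop_injective
    fin_cases i <;> fin_cases j <;>
      simp [OSL.antipodeHom, Ccheck, Chat, smul_smul, mul_comm, mul_left_comm]
  exact congrArg (fun k => (k a).unop) this

/-- The antipode of `Ã`, as a homomorphism to the opposite algebra: it extends the antipode of
`A`, and `S(χ) = χ⁻¹`. -/
def antipodeHom (s : ℂˣ) : Atilde s →ₐ[ℂ] (Atilde s)ᵐᵒᵖ :=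
  lift s ((AlgHom.op (incl s)).comp (OSL.antipodeHom s))
    ((MonoidHom.op (chiPow s)).comp (MulEquiv.inv' (Multiplicative ℤ)).toMonoidHom) fun x n => by
      apply MulOpposite.unop_injective
      simp [chiPow_mul_incl, antipodeHom_smul]

theorem adjoin_eq_top (s : ℂˣ) :
    Algebra.adjoin ℂ (Set.range (incl s) ∪ Set.range (chiPow s)) = ⊤ := by
  rw [eq_top_iff]
  intro x _
  induction x using SkewMonoidAlgebra.induction_on with
  | zero => exact zero_mem _
  | single n a =>
    rw [← incl_mul_chiPow]
    exact mul_mem (Algebra.subset_adjoin (Or.inl ⟨a, rfl⟩))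
      (Algebra.subset_adjoin (Or.inr ⟨n, rfl⟩))
  | add x y hx hy => exact add_mem (hx trivial) (hy trivial)

instance instHopfAlgebra (s : ℂˣ) : HopfAlgebra ℂ (Atilde s) :=
  hopfOfGenerators (antipodeHom s) _ (adjoin_eq_top s)
    (by
      rintro _ (⟨a, rfl⟩ | ⟨n, rfl⟩)
      · have h := HopfAlgebra.mul_antipode_rTensor_comul_apply (R := ℂ) a
        rw [comul_incl, counit_incl, ← AlgHom.commutes (incl s), ← h]
        generalize Coalgebra.comul (R := ℂ) a = z
        induction z using TensorProduct.induction_on with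
        | zero => simp
        | add x y hx hy => simp only [map_add, hx, hy]
        | tmul x y => simp [antipodeHom, HopfAlgebraStruct.antipode]
      · simp [comul_chiPow, counit_chiPow, antipodeHom, ← map_mul])
    (by
      rintro _ (⟨a, rfl⟩ | ⟨n, rfl⟩)
      · have h := HopfAlgebra.mul_antipode_lTensor_comul_apply (R := ℂ) a
        rw [comul_incl, counit_incl, ← AlgHom.commutes (incl s), ← h]
        generalize Coalgebra.comul (R := ℂ) a = z
        induction z using TensorProduct.induction_on with
        | zero => simp
        | add x y hx hy => simp only [map_add, hx, hy]
        | tmul x y => simp [antipodeHom, HopfAlgebraStruct.antipode]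
      · simp [comul_chiPow, counit_chiPow, antipodeHom, ← map_mul])

end Atilde

section Bimodule

variable (A Γ : Type) [Ring A] [Algebra ℂ A] [AddCommGroup Γ] [Module ℂ Γ] [Module A Γ]
  [Module Aᵐᵒᵖ Γ]

/-- The relations `x a ⊗ y = x ⊗ a y`. -/
def balanced : Submodule ℂ (Γ ⊗[ℂ] Γ) :=
  Submodule.span ℂ {z | ∃ (x y : Γ) (a : A), z = (op a • x) ⊗ₜ[ℂ] y - x ⊗ₜ[ℂ] (a • y)}

/-- The tensor product `Γ ⊗_A Γ` of an `A`-bimodule with itself; the right action of `a` is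
the action of `op a`. -/
abbrev BiTensor : Type := (Γ ⊗[ℂ] Γ) ⧸ balanced A Γ

/-- The defining relations of the tensor algebra `T_A(Γ)`. -/
inductive TensorRel : TensorAlgebra ℂ (A × Γ) → TensorAlgebra ℂ (A × Γ) → Prop
  | one : TensorRel (TensorAlgebra.ι ℂ (1, 0)) 1
  | mul (a b : A) : TensorRel (TensorAlgebra.ι ℂ (a * b, 0))
      (TensorAlgebra.ι ℂ (a, 0) * TensorAlgebra.ι ℂ (b, 0))
  | left (a : A) (x : Γ) : TensorRel (TensorAlgebra.ι ℂ (0, a • x))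
      (TensorAlgebra.ι ℂ (a, 0) * TensorAlgebra.ι ℂ (0, x))
  | right (a : A) (x : Γ) : TensorRel (TensorAlgebra.ι ℂ (0, op a • x))
      (TensorAlgebra.ι ℂ (0, x) * TensorAlgebra.ι ℂ (a, 0))

/-- The tensor algebra `T_A(Γ)` of the `A`-bimodule `Γ`: the algebra generated by `A` and `Γ`
such that `A` is a subalgebra and the products `a x`, `x a` are those of the bimodule. -/
def BiTensorAlgebra : Type := RingQuot (TensorRel A Γ)

instance : Ring (BiTensorAlgebra A Γ) := inferInstanceAs (Ring (RingQuot (TensorRel A Γ)))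
instance : Algebra ℂ (BiTensorAlgebra A Γ) :=
  inferInstanceAs (Algebra ℂ (RingQuot (TensorRel A Γ)))

namespace BiTensorAlgebra

/-- The quotient map. -/
def mk : TensorAlgebra ℂ (A × Γ) →ₐ[ℂ] BiTensorAlgebra A Γ := RingQuot.mkAlgHom ℂ (TensorRel A Γ)

variable {A Γ} in
theorem mk_rel {x y : TensorAlgebra ℂ (A × Γ)} (h : TensorRel A Γ x y) :
    mk A Γ x = mk A Γ y := RingQuot.mkAlgHom_rel ℂ h

/-- The canonical homomorphism `A → T_A(Γ)`. -/
def ofAlg : A →ₐ[ℂ] BiTensorAlgebra A Γ :=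
  AlgHom.ofLinearMap
    ((mk A Γ).toLinearMap ∘ₗ TensorAlgebra.ι ℂ ∘ₗ LinearMap.inl ℂ A Γ)
    (by simpa using mk_rel (TensorRel.one (A := A) (Γ := Γ)))
    (fun a b => by simpa using mk_rel (TensorRel.mul (Γ := Γ) a b))

/-- The canonical map `Γ → T_A(Γ)`. -/
def ofMod : Γ →ₗ[ℂ] BiTensorAlgebra A Γ :=
  (mk A Γ).toLinearMap ∘ₗ TensorAlgebra.ι ℂ ∘ₗ LinearMap.inr ℂ A Γ

theorem ofMod_left (a : A) (x : Γ) : ofMod A Γ (a • x) = ofAlg A Γ a * ofMod A Γ x := by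
  simpa [ofMod, ofAlg] using mk_rel (TensorRel.left a x)

theorem ofMod_right (a : A) (x : Γ) : ofMod A Γ (op a • x) = ofMod A Γ x * ofAlg A Γ a := by
  simpa [ofMod, ofAlg] using mk_rel (TensorRel.right a x)

/-- The canonical map `Γ ⊗_A Γ → T_A(Γ)`. -/
def ofTensor : BiTensor A Γ →ₗ[ℂ] BiTensorAlgebra A Γ :=
  (balanced A Γ).liftQ
    (TensorProduct.lift ((LinearMap.mul ℂ (BiTensorAlgebra A Γ)).compl₁₂ (ofMod A Γ) (ofMod A Γ)))
    (by
      refine Submodule.span_le.mpr ?_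
      rintro _ ⟨x, y, a, rfl⟩
      simp [ofMod_left, ofMod_right, mul_assoc])

theorem ofTensor_tmul (x y : Γ) :
    ofTensor A Γ ((balanced A Γ).mkQ (x ⊗ₜ y)) = ofMod A Γ x * ofMod A Γ y := rfl

end BiTensorAlgebra

variable {A Γ} (σ : BiTensor A Γ →ₗ[ℂ] BiTensor A Γ) (g : BiTensor A Γ →ₗ[ℂ] A)

/-- The relations `ρ₂ = g(ρ₂)` for `ρ₂ ∈ ker (id - σ)`. -/
inductive CliffordRel : BiTensorAlgebra A Γ → BiTensorAlgebra A Γ → Prop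
  | mk (ρ₂ : BiTensor A Γ) (h : ρ₂ ∈ LinearMap.ker (LinearMap.id - σ)) :
      CliffordRel (BiTensorAlgebra.ofTensor A Γ ρ₂) (BiTensorAlgebra.ofAlg A Γ (g ρ₂))

/-- The quantum Clifford algebra `Cl(Γ, σ, g)`: the quotient of `T_A(Γ)` by the two-sided ideal
generated by the elements `ρ₂ - g(ρ₂)`, `ρ₂ ∈ ker (id - σ)`. -/
def Clifford : Type := RingQuot (CliffordRel σ g)

instance : Ring (Clifford σ g) := inferInstanceAs (Ring (RingQuot (CliffordRel σ g)))
instance : Algebra ℂ (Clifford σ g) := inferInstanceAs (Algebra ℂ (RingQuot (CliffordRel σ g)))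

namespace Clifford

/-- The quotient map. -/
def mk : BiTensorAlgebra A Γ →ₐ[ℂ] Clifford σ g := RingQuot.mkAlgHom ℂ (CliffordRel σ g)

/-- The canonical homomorphism `A → Cl(Γ, σ, g)`. -/
def ofAlg : A →ₐ[ℂ] Clifford σ g := (mk σ g).comp (BiTensorAlgebra.ofAlg A Γ)

/-- The canonical map `Γ → Cl(Γ, σ, g)`. -/
def ofMod : Γ →ₗ[ℂ] Clifford σ g := (mk σ g).toLinearMap ∘ₗ BiTensorAlgebra.ofMod A Γ

theorem ofMod_left (a : A) (x : Γ) : ofMod σ g (a • x) = ofAlg σ g a * ofMod σ g x := by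
  simp [ofMod, ofAlg, BiTensorAlgebra.ofMod_left]

theorem ofMod_right (a : A) (x : Γ) : ofMod σ g (op a • x) = ofMod σ g x * ofAlg σ g a := by
  simp [ofMod, ofAlg, BiTensorAlgebra.ofMod_right]

theorem mk_ofTensor {z : BiTensor A Γ} (h : σ z = z) :
    mk σ g (BiTensorAlgebra.ofTensor A Γ z) = ofAlg σ g (g z) :=
  RingQuot.mkAlgHom_rel ℂ (CliffordRel.mk z (by simp [h]))

theorem mk_ofTensor_tmul (x y : Γ) :
    mk σ g (BiTensorAlgebra.ofTensor A Γ ((balanced A Γ).mkQ (x ⊗ₜ y))) =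
      ofMod σ g x * ofMod σ g y := by
  simp only [BiTensorAlgebra.ofTensor_tmul, map_mul]
  rfl

variable {σ g}

/-- Universal property of the quantum Clifford algebra. -/
def lift {B : Type} [Ring B] [Algebra ℂ B] (φ : A →ₐ[ℂ] B) (ψ : Γ →ₗ[ℂ] B)
    (hl : ∀ a x, ψ (a • x) = φ a * ψ x) (hr : ∀ a x, ψ (op a • x) = ψ x * φ a)
    (hc : ∀ z : Γ ⊗[ℂ] Γ, σ ((balanced A Γ).mkQ z) = (balanced A Γ).mkQ z →
      TensorProduct.lift ((LinearMap.mul ℂ B).compl₁₂ ψ ψ) z = φ (g ((balanced A Γ).mkQ z))) :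
    Clifford σ g →ₐ[ℂ] B :=
  let L : BiTensorAlgebra A Γ →ₐ[ℂ] B := RingQuot.liftAlgHom ℂ
    ⟨TensorAlgebra.lift ℂ (LinearMap.coprod φ.toLinearMap ψ), by
      intro x y h
      cases h with
      | one => simp
      | mul a b => simp
      | left a x => simp [hl]
      | right a x => simp [hr]⟩
  have hA : ∀ a, L (BiTensorAlgebra.ofAlg A Γ a) = φ a := fun a => by
    refine (RingQuot.liftAlgHom_mkAlgHom_apply ℂ _ _ _).trans ?_
    simp
  have hM : ∀ x, L (BiTensorAlgebra.ofMod A Γ x) = ψ x := fun x => by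
    refine (RingQuot.liftAlgHom_mkAlgHom_apply ℂ _ _ _).trans ?_
    simp
  RingQuot.liftAlgHom ℂ ⟨L, by
    intro x y h
    cases h with
    | mk z h =>
      obtain ⟨z, rfl⟩ := (balanced A Γ).mkQ_surjective z
      have hz : σ ((balanced A Γ).mkQ z) = (balanced A Γ).mkQ z := by
        have := LinearMap.mem_ker.mp h
        simp only [LinearMap.sub_apply, LinearMap.id_apply] at this
        exact (sub_eq_zero.mp this).symm
      rw [hA, ← hc z hz]
      have : L.toLinearMap ∘ₗ BiTensorAlgebra.ofTensor A Γ ∘ₗ (balanced A Γ).mkQ =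
          TensorProduct.lift ((LinearMap.mul ℂ B).compl₁₂ ψ ψ) := by
        ext x y
        change L (BiTensorAlgebra.ofTensor A Γ ((balanced A Γ).mkQ (x ⊗ₜ y))) = ψ x * ψ y
        rw [BiTensorAlgebra.ofTensor_tmul, map_mul, hM, hM]
      exact congrArg (fun f => f z) this⟩

theorem lift_ofAlg {B : Type} [Ring B] [Algebra ℂ B] (φ : A →ₐ[ℂ] B) (ψ : Γ →ₗ[ℂ] B)
    (hl hr) (hc : ∀ z : Γ ⊗[ℂ] Γ, σ ((balanced A Γ).mkQ z) = (balanced A Γ).mkQ z →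
      TensorProduct.lift ((LinearMap.mul ℂ B).compl₁₂ ψ ψ) z = φ (g ((balanced A Γ).mkQ z)))
    (a : A) : lift φ ψ hl hr hc (ofAlg σ g a) = φ a := by
  refine (RingQuot.liftAlgHom_mkAlgHom_apply ℂ _ _ _).trans ?_
  refine (RingQuot.liftAlgHom_mkAlgHom_apply ℂ _ _ _).trans ?_
  simp

theorem lift_ofMod {B : Type} [Ring B] [Algebra ℂ B] (φ : A →ₐ[ℂ] B) (ψ : Γ →ₗ[ℂ] B)
    (hl hr) (hc : ∀ z : Γ ⊗[ℂ] Γ, σ ((balanced A Γ).mkQ z) = (balanced A Γ).mkQ z →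
      TensorProduct.lift ((LinearMap.mul ℂ B).compl₁₂ ψ ψ) z = φ (g ((balanced A Γ).mkQ z)))
    (x : Γ) : lift φ ψ hl hr hc (ofMod σ g x) = ψ x := by
  refine (RingQuot.liftAlgHom_mkAlgHom_apply ℂ _ _ _).trans ?_
  refine (RingQuot.liftAlgHom_mkAlgHom_apply ℂ _ _ _).trans ?_
  simp

end Clifford

end Bimodule

/-- The values `f^{ij}_{rt}(u^m_l) = ε R̂^{mr}_{ik} (R̂⁻¹)^{kt}_{jl}` of the functionals `f^{ij}_{rt}`
on the generators; `ε = ±1` is the sign of the calculus. -/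
def fGen (s : ℂˣ) (ε : ℤˣ) (m l : Fin 2) : Matrix (Fin 2 × Fin 2) (Fin 2 × Fin 2) ℂ :=
  Matrix.of fun p p' => ((ε : ℤ) : ℂ) *
    ∑ k, Rhat s (m, p'.1) (p.1, k) * RhatInv s (k, p'.2) (p.2, l)

theorem fGen_isQuantumMatrix (s : ℂˣ) (ε : ℤˣ) :
    IsQuantumMatrix s (Matrix.of fun m l => fGen s ε m l) := by
  have hs : (s : ℂ) ≠ 0 := s.ne_zero
  have hε : ((ε : ℤ) : ℂ) * ((ε : ℤ) : ℂ) = 1 := by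
    rcases Int.units_eq_one_or ε with rfl | rfl <;> simp
  have hp : IsQuantumMatrix s (Matrix.of fun m k =>
      (Matrix.of fun i r => Rhat s (m, r) (i, k) : Matrix (Fin 2) (Fin 2) ℂ)) := by
    apply IsQuantumMatrix.of_rels <;> ext i k <;> fin_cases i <;> fin_cases k <;>
    simp [Rhat, Matrix.mul_apply, qhat, q] <;> field_simp <;> ring
  have hm : IsQuantumMatrix s (Matrix.of fun k l =>
      (Matrix.of fun j t => RhatInv s (k, t) (j, l) : Matrix (Fin 2) (Fin 2) ℂ)) := by
    apply IsQuantumMatrix.of_rels <;> ext i k <;> fin_cases i <;> fin_cases k <;>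
    simp [RhatInv, Ccheck, Chat, Matrix.mul_apply, q] <;> field_simp <;> ring
  have key : IsQuantumMatrix s (Matrix.of fun m l => fGen s 1 m l) := by
    have h := (u_isQuantumMatrix s).map
      ((Matrix.kroneckerAlgEquiv (Fin 2) (Fin 2) ℂ).toAlgHom.comp
        ((Algebra.TensorProduct.map (OSL.lift s _ hp) (OSL.lift s _ hm)).comp
          (Bialgebra.comulAlgHom ℂ (OSL s))))
    convert h using 1
    ext m l p p'
    simp [fGen, Matrix.kroneckerMap_apply]
  have h1 : ∀ m l, fGen s ε m l = ((ε : ℤ) : ℂ) • fGen s 1 m l := fun m l => by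
    ext; simp [fGen]
  constructor
  · intro i j m n
    simpa [h1, smul_smul, hε] using key.rtt i j m n
  · simpa [h1, smul_smul, hε] using key.det

/-- The functionals `f^{ij}_{kl}` on `A`, as an algebra homomorphism to matrices. -/
def fHom (s : ℂˣ) (ε : ℤˣ) : OSL s →ₐ[ℂ] Matrix (Fin 2 × Fin 2) (Fin 2 × Fin 2) ℂ :=
  OSL.lift s _ (fGen_isQuantumMatrix s ε)

/-- Index pairs `ij`. -/
abbrev Idx : Type := Fin 2 × Fin 2

@[simp]
theorem fHom_u (s : ℂˣ) (ε : ℤˣ) (m l : Fin 2) : fHom s ε (u s m l) = fGen s ε m l :=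
  OSL.lift_u s _ (fGen_isQuantumMatrix s ε) m l

/-- The matrix `a_(1) f^{ij}_{kl}(a_(2))` over `A`. -/
def rightMul (s : ℂˣ) (ε : ℤˣ) : OSL s →ₐ[ℂ] Matrix Idx Idx (OSL s) :=
  (matrixEquivTensor Idx ℂ (OSL s)).symm.toAlgHom.comp
    ((Algebra.TensorProduct.map (AlgHom.id ℂ (OSL s)) (fHom s ε)).comp
      (Bialgebra.comulAlgHom ℂ (OSL s)))

theorem rightMul_u (s : ℂˣ) (ε : ℤˣ) (k l : Fin 2) (i j : Idx) :
    rightMul s ε (u s k l) i j = ∑ m, fGen s ε m l i j • u s k m := by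
  simp [rightMul, Matrix.add_apply, Algebra.smul_def, Algebra.commutes]

/-- The bicovariant bimodule `Γ` of the `4D_±`-calculus, `± = ε`: the free left `A`-module with
basis `θ_{ij}`; a function `x` stands for `∑ x_{ij} θ_{ij}`. -/
def Gam (s : ℂˣ) (_ε : ℤˣ) : Type := Idx → OSL s

namespace Gam

variable (s : ℂˣ) (ε : ℤˣ)

instance : AddCommGroup (Gam s ε) := inferInstanceAs (AddCommGroup (Idx → OSL s))
instance : Module ℂ (Gam s ε) := inferInstanceAs (Module ℂ (Idx → OSL s))
instance : Module (OSL s) (Gam s ε) := inferInstanceAs (Module (OSL s) (Idx → OSL s))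
instance : IsScalarTower ℂ (OSL s) (Gam s ε) :=
  inferInstanceAs (IsScalarTower ℂ (OSL s) (Idx → OSL s))

variable {s ε} in
/-- The coefficients `x_{ij}` of `x = ∑ x_{ij} θ_{ij}`. -/
def coeff (x : Gam s ε) : Idx → OSL s := x

/-- The right action `(x_i θ_i) a = x_i a_(1) f^i_j(a_(2)) θ_j`. -/
instance : Module (OSL s)ᵐᵒᵖ (Gam s ε) where
  smul a x := Matrix.vecMul (coeff x) (rightMul s ε a.unop)
  one_smul x := (congrArg (Matrix.vecMul (coeff x)) (map_one (rightMul s ε))).trans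
    (Matrix.vecMul_one (coeff x))
  mul_smul a b x := (congrArg (Matrix.vecMul (coeff x))
    (map_mul (rightMul s ε) b.unop a.unop)).trans (Matrix.vecMul_vecMul (coeff x) _ _).symm
  smul_zero a := Matrix.zero_vecMul _
  smul_add a x y := Matrix.add_vecMul _ (coeff x) (coeff y)
  add_smul a b x := (congrArg (Matrix.vecMul (coeff x))
    (map_add (rightMul s ε) a.unop b.unop)).trans (Matrix.vecMul_add _ _ (coeff x))
  zero_smul x := (congrArg (Matrix.vecMul (coeff x)) (map_zero (rightMul s ε))).trans
    (Matrix.vecMul_zero (coeff x))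

/-- The left-invariant basis `θ_{ij}` of `Γ`. -/
def theta (i : Idx) : Gam s ε := (Pi.single i 1 : Idx → OSL s)

variable {s ε}

@[ext]
theorem ext {x y : Gam s ε} (h : ∀ i, coeff x i = coeff y i) : x = y := funext h

@[simp]
theorem coeff_op_smul (a : OSL s) (x : Gam s ε) (j : Idx) :
    coeff (op a • x) j = ∑ i, coeff x i * rightMul s ε a i j := rfl

@[simp]
theorem coeff_smul (a : OSL s) (x : Gam s ε) (j : Idx) : coeff (a • x) j = a * coeff x j := rfl

@[simp]
theorem coeff_csmul (a : ℂ) (x : Gam s ε) (j : Idx) : coeff (a • x) j = a • coeff x j := rfl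

@[simp]
theorem coeff_add (x y : Gam s ε) (j : Idx) : coeff (x + y) j = coeff x j + coeff y j := rfl

@[simp]
theorem coeff_zero (j : Idx) : coeff (0 : Gam s ε) j = 0 := rfl

@[simp]
theorem coeff_theta (i j : Idx) : coeff (theta s ε i) j = if j = i then 1 else 0 :=
  Pi.single_apply i 1 j

/-- The coefficients as a linear map. -/
def coeffₗ (i : Idx) : Gam s ε →ₗ[ℂ] OSL s where
  toFun x := coeff x i
  map_add' _ _ := rfl
  map_smul' _ _ := rfl

@[simp]
theorem coeffₗ_apply (i : Idx) (x : Gam s ε) : coeffₗ i x = coeff x i := rfl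

@[simp]
theorem coeff_sum {ι : Type*} (t : Finset ι) (x : ι → Gam s ε) (j : Idx) :
    coeff (∑ i ∈ t, x i) j = ∑ i ∈ t, coeff (x i) j := map_sum (coeffₗ j) x t

theorem sum_smul_theta (x : Gam s ε) : ∑ i, coeff x i • theta s ε i = x := by
  ext j
  simp

/-- The relations `θ_{ij} u^k_l = ε u^k_m R̂^{mr}_{in} (R̂⁻¹)^{nt}_{jl} θ_{rt}`. -/
theorem theta_mul_u (i : Idx) (k l : Fin 2) :
    op (u s k l) • theta s ε i = ∑ m, ∑ j, (fGen s ε m l i j • u s k m) • theta s ε j := by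
  ext j
  simp [rightMul_u]

end Gam

section Braiding

variable (s : ℂˣ) (ε : ℤˣ)

/-- The map `Γ ⊗_A Γ → A^{I × I}` that reads off the coefficients with respect to the left
`A`-basis `θ_k ⊗ θ_j`, see `tensorCoeff_ofCoeff` and `tensorOfCoeff_coeff`. It sends
`x ⊗ ∑ y_j θ_j` to the coefficients of `∑ (x y_j) ⊗ θ_j`. -/
def tensorCoeff : BiTensor (OSL s) (Gam s ε) →ₗ[ℂ] (Idx × Idx → OSL s) :=
  (balanced (OSL s) (Gam s ε)).liftQ
    (TensorProduct.lift (LinearMap.mk₂ ℂ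
      (fun x y p => ((op (y.coeff p.2) • x : Gam s ε)).coeff p.1)
      (fun x x' y => by funext p; simp)
      (fun a x y => by funext p; simp [Finset.smul_sum])
      (fun x y y' => by funext p; simp [-MulOpposite.op_add, mul_add, Finset.sum_add_distrib])
      (fun a x y => by funext p; simp [-MulOpposite.op_smul, Finset.smul_sum])))
    (by
      refine Submodule.span_le.mpr ?_
      rintro _ ⟨x, y, a, rfl⟩
      simp only [SetLike.mem_coe, LinearMap.mem_ker, map_sub, TensorProduct.lift.tmul,
        LinearMap.mk₂_apply, sub_eq_zero]
      funext p
      rw [smul_smul, ← MulOpposite.op_mul, Gam.coeff_smul])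

/-- The element `∑ c_{kj} θ_k ⊗ θ_j` of `Γ ⊗_A Γ`. -/
def tensorOfCoeff : (Idx × Idx → OSL s) →ₗ[ℂ] BiTensor (OSL s) (Gam s ε) where
  toFun c := ∑ p, (balanced (OSL s) (Gam s ε)).mkQ
    ((c p • Gam.theta s ε p.1) ⊗ₜ[ℂ] Gam.theta s ε p.2)
  map_add' c d := by
    simp only [Pi.add_apply, add_smul, TensorProduct.add_tmul, map_add, Finset.sum_add_distrib]
  map_smul' a c := by
    simp only [Pi.smul_apply, smul_assoc, ← TensorProduct.smul_tmul', map_smul, Finset.smul_sum,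
      RingHom.id_apply]

theorem tensorCoeff_ofCoeff (c : Idx × Idx → OSL s) :
    tensorCoeff s ε (tensorOfCoeff s ε c) = c := by
  have h : ∀ x y : Gam s ε, tensorCoeff s ε ((balanced (OSL s) (Gam s ε)).mkQ (x ⊗ₜ y)) =
    fun p => ((op (y.coeff p.2) • x : Gam s ε)).coeff p.1 := fun _ _ => rfl
  funext p
  change tensorCoeff s ε (∑ p : Idx × Idx, _) p = c p
  rw [map_sum, Finset.sum_apply]
  simp only [h]
  rw [Finset.sum_eq_single p]
  · simp [MulOpposite.op_one]
  · rintro r - hr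
    by_cases h2 : p.2 = r.2
    · have h1 : p.1 ≠ r.1 := fun h1 => hr (Prod.ext h1 h2).symm
      simp [h2, h1, MulOpposite.op_one]
    · simp [h2]
  · simp

theorem tensorOfCoeff_coeff (z : BiTensor (OSL s) (Gam s ε)) :
    tensorOfCoeff s ε (tensorCoeff s ε z) = z := by
  obtain ⟨z, rfl⟩ := (balanced (OSL s) (Gam s ε)).mkQ_surjective z
  induction z using TensorProduct.induction_on with
  | zero => simp only [map_zero]
  | add x y hx hy => simp only [map_add, hx, hy]
  | tmul x y =>
    have hb : ∀ a y', (balanced (OSL s) (Gam s ε)).mkQ ((op a • x) ⊗ₜ[ℂ] y') =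
        (balanced (OSL s) (Gam s ε)).mkQ (x ⊗ₜ[ℂ] (a • y')) := fun a y' =>
      (Submodule.Quotient.eq _).mpr (Submodule.subset_span ⟨x, y', a, rfl⟩)
    change ∑ p : Idx × Idx, (balanced (OSL s) (Gam s ε)).mkQ
      (((op (y.coeff p.2) • x : Gam s ε).coeff p.1 • Gam.theta s ε p.1) ⊗ₜ[ℂ]
        Gam.theta s ε p.2) = _
    rw [Fintype.sum_prod_type_right]
    simp only [← map_sum, ← TensorProduct.sum_tmul, Gam.sum_smul_theta]
    simp only [map_sum, hb]
    simp only [← map_sum, ← TensorProduct.tmul_sum, Gam.sum_smul_theta]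

/-- The matrix of the braiding,
`σ^{ij,kl}_{mn,rt} = f^{mn}_{kl}(u^i_r u^j_t)`; the row is `(ij, kl)`, the column `(mn, rt)`. -/
def braidMatrix : Matrix (Idx × Idx) (Idx × Idx) ℂ := Matrix.of fun p r =>
  fHom s ε (u s p.1.1 r.2.1 * u s p.1.2 r.2.2) r.1 p.2

/-- The canonical braiding `σ` of the bicovariant bimodule `Γ`: the left `A`-linear map with
`σ(θ_{mn} ⊗ θ_{rt}) = σ^{ij,kl}_{mn,rt} θ_{ij} ⊗ θ_{kl}`. -/
def braiding : BiTensor (OSL s) (Gam s ε) →ₗ[ℂ] BiTensor (OSL s) (Gam s ε) :=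
  tensorOfCoeff s ε ∘ₗ
    LinearMap.pi (fun p => ∑ r, braidMatrix s ε p r • LinearMap.proj r) ∘ₗ tensorCoeff s ε

/-- `g_{ij,kl} = -q^{1/2} c Ĉ_{im} Ĉ_{nl} (R̂⁻¹)^{mn}_{jk}`. -/
def metricMatrix (c : ℂˣ) (p : Idx × Idx) : ℂ :=
  -(s : ℂ) * c * ∑ m, ∑ n, Chat s p.1.1 m * Chat s n p.2.2 * RhatInv s (m, n) (p.1.2, p.2.1)

/-- The bicovariant `σ`-metric `g : Γ ⊗_A Γ → A`: the left `A`-linear map with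
`g(θ_{ij} ⊗ θ_{kl}) = g_{ij,kl}`. -/
def metric (c : ℂˣ) : BiTensor (OSL s) (Gam s ε) →ₗ[ℂ] OSL s :=
  (∑ p, metricMatrix s c p • LinearMap.proj p) ∘ₗ tensorCoeff s ε

/-- The quantum Clifford algebra `Cl(Γ, σ, g)` of the `4D_±`-calculus. -/
abbrev Cl (c : ℂˣ) : Type := Clifford (braiding s ε) (metric s ε c)

end Braiding

theorem sum_pairing_eq_zero {n : Type*} [Fintype n] [DecidableEq n] (M : Matrix n n ℂ)
    {V W N : Type*} [AddCommGroup V] [Module ℂ V] [AddCommGroup W] [Module ℂ W]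
    [AddCommGroup N] [Module ℂ N] (β : V →ₗ[ℂ] W →ₗ[ℂ] N) (c : n → V) (t : n → W)
    (hc : ∀ i, ∑ j, M i j • c j = 0)
    (ht : ∀ l : n → ℂ, M.mulVec l = 0 → ∑ j, l j • t j = 0) : ∑ j, β (c j) (t j) = 0 := by
  set τ : (n → ℂ) →ₗ[ℂ] W := Fintype.linearCombination ℂ t with hτ
  set m : (n → ℂ) →ₗ[ℂ] (n → ℂ) := M.mulVecLin with hm
  have hker : LinearMap.ker m ≤ LinearMap.ker τ := fun l hl => by
    simpa [hτ, Fintype.linearCombination_apply] using ht l (by simpa [hm] using hl)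
  obtain ⟨τ', hτ'⟩ := LinearMap.exists_extend
    ((LinearMap.ker m).liftQ τ hker ∘ₗ m.quotKerEquivRange.symm.toLinearMap)
  have hfac : ∀ l, τ' (m l) = τ l := fun l => by
    have := congrArg (fun f => f (m.quotKerEquivRange (Submodule.Quotient.mk l))) hτ'
    simpa using this
  have htj : ∀ j, t j = ∑ i, M i j • τ' (Pi.single i 1) := fun j => by
    have h1 : τ (Pi.single j 1) = t j := by simp [hτ]
    rw [← h1, ← hfac, hm, Matrix.mulVecLin_apply, Matrix.mulVec_single_one]
    have h2 : M.col j = ∑ i, M i j • (Pi.single i 1 : n → ℂ) := by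
      ext k
      simp [Finset.sum_apply, Pi.single_apply]
    rw [h2, map_sum]
    simp only [map_smul]
  calc ∑ j, β (c j) (t j) = ∑ j, ∑ i, β (M i j • c j) (τ' (Pi.single i 1)) := by
        refine Finset.sum_congr rfl fun j _ => ?_
        rw [htj j, map_sum]
        simp
    _ = ∑ i, β (∑ j, M i j • c j) (τ' (Pi.single i 1)) := by
        rw [Finset.sum_comm]
        simp
    _ = 0 := by simp [hc]

namespace Cl

variable (s : ℂˣ) (ε : ℤˣ) (c : ℂˣ)

/-- The canonical homomorphism `A → Cl(Γ, σ, g)`. -/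
def ofAlg : OSL s →ₐ[ℂ] Cl s ε c := Clifford.ofAlg _ _

/-- The generators `θ_{ij}` of `Cl(Γ, σ, g)`. -/
def theta (i : Idx) : Cl s ε c := Clifford.ofMod _ _ (Gam.theta s ε i)

theorem theta_mul_ofAlg (i : Idx) (a : OSL s) :
    theta s ε c i * ofAlg s ε c a =
      ∑ j, ofAlg s ε c (rightMul s ε a i j) * theta s ε c j := by
  unfold theta ofAlg
  rw [← Clifford.ofMod_right, ← Gam.sum_smul_theta (op a • Gam.theta s ε i), map_sum]
  simp [Clifford.ofMod_left]

theorem braiding_ofCoeff (l : Idx × Idx → OSL s) :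
    braiding s ε (tensorOfCoeff s ε l) =
      tensorOfCoeff s ε (fun p => ∑ r, braidMatrix s ε p r • l r) := by
  simp only [braiding, LinearMap.comp_apply, tensorCoeff_ofCoeff]
  refine congrArg (tensorOfCoeff s ε) (funext fun p => ?_)
  simp [LinearMap.sum_apply]

/-- The Clifford relations between the generators. -/
theorem theta_rel (l : Idx × Idx → ℂ) (hl : (braidMatrix s ε).mulVec l = l) :
    ∑ p, l p • (theta s ε c p.1 * theta s ε c p.2) =
      algebraMap ℂ _ (∑ p, l p * metricMatrix s c p) := by
  have h := Clifford.mk_ofTensor (braiding s ε) (metric s ε c)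
    (z := tensorOfCoeff s ε (fun p => algebraMap ℂ _ (l p))) (by
      rw [braiding_ofCoeff]
      congr 1
      funext p
      conv_rhs => rw [← hl]
      simp [Matrix.mulVec, dotProduct, Algebra.smul_def])
  have h2 : metric s ε c (tensorOfCoeff s ε (fun p => algebraMap ℂ _ (l p))) =
      algebraMap ℂ _ (∑ p, l p * metricMatrix s c p) := by
    simp only [metric, tensorCoeff_ofCoeff, LinearMap.comp_apply, LinearMap.sum_apply,
      LinearMap.smul_apply, LinearMap.proj_apply, map_sum, map_mul, Algebra.smul_def]
    exact Finset.sum_congr rfl fun p _ => Algebra.commutes _ _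
  rw [h2, AlgHom.commutes] at h
  rw [← h]
  change _ = Clifford.mk _ _ (BiTensorAlgebra.ofTensor _ _ (∑ p : Idx × Idx, _))
  rw [map_sum, map_sum]
  refine Finset.sum_congr rfl fun p _ => ?_
  rw [Clifford.mk_ofTensor_tmul, Clifford.ofMod_left, AlgHom.commutes, Algebra.smul_def, mul_assoc]
  rfl

section Lift

variable {s ε c} {B : Type} [Ring B] [Algebra ℂ B] (φ : OSL s →ₐ[ℂ] B) (T : Idx → B)

theorem comm_of_u (hT : ∀ i k l, T i * φ (u s k l) = ∑ j, φ (rightMul s ε (u s k l) i j) * T j)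
    (i : Idx) (a : OSL s) : T i * φ a = ∑ j, φ (rightMul s ε a i j) * T j := by
  have ha : a ∈ Algebra.adjoin ℂ {x | ∃ i j, x = u s i j} := OSL.adjoin_u s ▸ Algebra.mem_top
  induction ha using Algebra.adjoin_induction generalizing i with
  | mem x hx => obtain ⟨k, l, rfl⟩ := hx; exact hT i k l
  | algebraMap r =>
    simp [Matrix.algebraMap_matrix_apply, Algebra.commutes, apply_ite φ]
  | add x y _ _ hx hy => simp only [map_add, mul_add, hx, hy, Matrix.add_apply, add_mul,
      Finset.sum_add_distrib]
  | mul x y _ _ hx hy =>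
    rw [map_mul, ← mul_assoc, hx, Finset.sum_mul]
    simp only [mul_assoc, hy, map_mul, Matrix.mul_apply, map_sum, Finset.sum_mul, Finset.mul_sum]
    rw [Finset.sum_comm]

/-- The left `A`-linear extension of `θ_i ↦ T_i` to `Γ`. -/
def liftMod : Gam s ε →ₗ[ℂ] B :=
  ∑ i, LinearMap.mulRight ℂ (T i) ∘ₗ φ.toLinearMap ∘ₗ Gam.coeffₗ i

theorem liftMod_apply (x : Gam s ε) : liftMod φ T x = ∑ i, φ (x.coeff i) * T i := by
  simp [liftMod]

theorem liftMod_left (a : OSL s) (x : Gam s ε) :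
    liftMod φ T (a • x) = φ a * liftMod φ T x := by
  simp [liftMod_apply, Finset.mul_sum, mul_assoc]

theorem liftMod_right
    (hT : ∀ i k l, T i * φ (u s k l) = ∑ j, φ (rightMul s ε (u s k l) i j) * T j)
    (a : OSL s) (x : Gam s ε) : liftMod φ T (op a • x) = liftMod φ T x * φ a := by
  simp only [liftMod_apply, Gam.coeff_op_smul, map_sum, map_mul, Finset.sum_mul, mul_assoc]
  rw [Finset.sum_comm]
  refine Finset.sum_congr rfl fun i _ => ?_
  rw [comm_of_u φ T hT, Finset.mul_sum]

theorem liftMod_rel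
    (hT : ∀ i k l, T i * φ (u s k l) = ∑ j, φ (rightMul s ε (u s k l) i j) * T j)
    (hC : ∀ l : Idx × Idx → ℂ, (braidMatrix s ε).mulVec l = l →
      ∑ p, l p • (T p.1 * T p.2) = algebraMap ℂ B (∑ p, l p * metricMatrix s c p))
    (z : Gam s ε ⊗[ℂ] Gam s ε)
    (hz : braiding s ε ((balanced (OSL s) (Gam s ε)).mkQ z) =
      (balanced (OSL s) (Gam s ε)).mkQ z) :
    TensorProduct.lift ((LinearMap.mul ℂ B).compl₁₂ (liftMod φ T) (liftMod φ T)) z =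
      φ (metric s ε c ((balanced (OSL s) (Gam s ε)).mkQ z)) := by
  have h1 : ∀ z : Gam s ε ⊗[ℂ] Gam s ε,
      TensorProduct.lift ((LinearMap.mul ℂ B).compl₁₂ (liftMod φ T) (liftMod φ T)) z =
      ∑ p : Idx × Idx, φ (tensorCoeff s ε ((balanced _ _).mkQ z) p) * (T p.1 * T p.2) := by
    intro z
    induction z using TensorProduct.induction_on with
    | zero => simp
    | add x y hx hy => simp only [map_add, hx, hy, Pi.add_apply, add_mul,
        Finset.sum_add_distrib]
    | tmul x y =>
      change liftMod φ T x * liftMod φ T y = ∑ p : Idx × Idx,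
        φ ((op (y.coeff p.2) • x : Gam s ε).coeff p.1) * (T p.1 * T p.2)
      rw [Fintype.sum_prod_type_right, liftMod_apply φ T y, Finset.mul_sum]
      refine Finset.sum_congr rfl fun j _ => ?_
      rw [← mul_assoc, ← liftMod_right φ T hT, liftMod_apply, Finset.sum_mul]
      simp only [mul_assoc]
  have h2 : φ (metric s ε c ((balanced _ _).mkQ z)) =
      ∑ p : Idx × Idx, φ (tensorCoeff s ε ((balanced _ _).mkQ z) p) *
        algebraMap ℂ B (metricMatrix s c p) := by
    simp [metric, LinearMap.sum_apply, Algebra.smul_def, Algebra.commutes]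
  rw [h1, h2, ← sub_eq_zero, ← Finset.sum_sub_distrib]
  simp only [← mul_sub]
  refine sum_pairing_eq_zero (braidMatrix s ε - 1)
    ((LinearMap.mul ℂ B).comp φ.toLinearMap) _
    (fun p : Idx × Idx => T p.1 * T p.2 - algebraMap ℂ B (metricMatrix s c p)) ?_ ?_
  · intro p
    have h3 := congrArg (fun w => tensorCoeff s ε w p) hz
    simp only [braiding, LinearMap.comp_apply, tensorCoeff_ofCoeff] at h3
    simp only [Matrix.sub_apply, sub_smul, Finset.sum_sub_distrib, Matrix.one_apply]
    simpa [LinearMap.sum_apply, sub_eq_zero] using h3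
  · intro l hl
    rw [Matrix.sub_mulVec, Matrix.one_mulVec, sub_eq_zero] at hl
    have h4 := hC l hl
    simp only [smul_sub, Finset.sum_sub_distrib, h4, map_sum, map_mul]
    simp only [Algebra.smul_def, sub_self]

/-- Universal property of `Cl(Γ, σ, g)` in terms of the generators `θ_{ij}`. -/
def lift (hT : ∀ i k l, T i * φ (u s k l) = ∑ j, φ (rightMul s ε (u s k l) i j) * T j)
    (hC : ∀ l : Idx × Idx → ℂ, (braidMatrix s ε).mulVec l = l →
      ∑ p, l p • (T p.1 * T p.2) = algebraMap ℂ B (∑ p, l p * metricMatrix s c p)) :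
    Cl s ε c →ₐ[ℂ] B :=
  Clifford.lift φ (liftMod φ T) (liftMod_left φ T) (liftMod_right φ T hT)
    (liftMod_rel φ T hT hC)

theorem lift_ofAlg (hT) (hC : ∀ l : Idx × Idx → ℂ, (braidMatrix s ε).mulVec l = l →
      ∑ p, l p • (T p.1 * T p.2) = algebraMap ℂ B (∑ p, l p * metricMatrix s c p))
    (a : OSL s) : lift φ T hT hC (ofAlg s ε c a) = φ a :=
  Clifford.lift_ofAlg φ (liftMod φ T) (liftMod_left φ T) (liftMod_right φ T hT)
    (liftMod_rel φ T hT hC) a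

theorem lift_theta (hT) (hC : ∀ l : Idx × Idx → ℂ, (braidMatrix s ε).mulVec l = l →
      ∑ p, l p • (T p.1 * T p.2) = algebraMap ℂ B (∑ p, l p * metricMatrix s c p))
    (i : Idx) : lift φ T hT hC (theta s ε c i) = T i := by
  refine (Clifford.lift_ofMod φ (liftMod φ T) (liftMod_left φ T) (liftMod_right φ T hT)
    (liftMod_rel φ T hT hC) _).trans ?_
  simp [liftMod_apply, apply_ite φ]

end Lift

/-- The left coaction `Δ_L` of `A` on `Cl(Γ, σ, g)`: the algebra homomorphism that extends the
coproduct of `A`, with `Δ_L(θ_{ij}) = 1 ⊗ θ_{ij}`. -/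
def leftCoaction : Cl s ε c →ₐ[ℂ] OSL s ⊗[ℂ] Cl s ε c :=
  lift ((Algebra.TensorProduct.map (AlgHom.id ℂ (OSL s)) (ofAlg s ε c)).comp
      (Bialgebra.comulAlgHom ℂ (OSL s)))
    (fun i => 1 ⊗ₜ[ℂ] theta s ε c i)
    (fun i k l => by
      simp only [AlgHom.comp_apply, Bialgebra.comulAlgHom_apply, OSL.comul_u, map_sum,
        rightMul_u, map_smul, Algebra.TensorProduct.map_tmul, AlgHom.id_apply, Finset.mul_sum,
        Finset.sum_mul, Algebra.TensorProduct.tmul_mul_tmul, one_mul, mul_one, theta_mul_ofAlg,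
        TensorProduct.tmul_sum, smul_mul_assoc, Finset.smul_sum, TensorProduct.tmul_smul]
      rw [Finset.sum_comm]
      exact Finset.sum_congr rfl fun j _ => Finset.sum_comm)
    (fun l hl => by
      have h := theta_rel s ε c l hl
      have h2 := congrArg (fun x => (1 : OSL s) ⊗ₜ[ℂ] x) h
      simp only [TensorProduct.tmul_sum, TensorProduct.tmul_smul] at h2
      simp only [Algebra.TensorProduct.tmul_mul_tmul, one_mul, h2]
      rw [Algebra.algebraMap_eq_smul_one, Algebra.algebraMap_eq_smul_one, TensorProduct.tmul_smul,
        Algebra.TensorProduct.one_def])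

end Cl

theorem sum_swap4 {α β γ δ M : Type*} [Fintype α] [Fintype β] [Fintype γ] [Fintype δ]
    [AddCommMonoid M] (F : α → β → γ → δ → M) :
    ∑ a, ∑ b, ∑ c, ∑ d, F a b c d = ∑ c, ∑ d, ∑ a, ∑ b, F a b c d := by
  calc ∑ a, ∑ b, ∑ c, ∑ d, F a b c d = ∑ a, ∑ c, ∑ b, ∑ d, F a b c d :=
        Finset.sum_congr rfl fun a _ => Finset.sum_comm
    _ = ∑ c, ∑ a, ∑ b, ∑ d, F a b c d := Finset.sum_comm
    _ = ∑ c, ∑ a, ∑ d, ∑ b, F a b c d :=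
        Finset.sum_congr rfl fun c _ => Finset.sum_congr rfl fun a _ => Finset.sum_comm
    _ = _ := Finset.sum_congr rfl fun c _ => Finset.sum_comm

/-- `R̂⁻¹ u u = u u R̂⁻¹`. -/
theorem rtt_inv (s : ℂˣ) (i j m n : Fin 2) :
    ∑ k, ∑ l, RhatInv s (i, j) (k, l) • (u s k m * u s l n) =
      ∑ k, ∑ l, RhatInv s (k, l) (m, n) • (u s i k * u s j l) := by
  set U : Matrix Idx Idx (OSL s) := Matrix.of fun a b => u s a.1 b.1 * u s a.2 b.2 with hU
  set R : Matrix Idx Idx (OSL s) := (Rhat s).map (algebraMap ℂ (OSL s)) with hR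
  set R' : Matrix Idx Idx (OSL s) := (RhatInv s).map (algebraMap ℂ (OSL s)) with hR'
  have h1 : R * U = U * R := by
    ext a b
    have := (u_isQuantumMatrix s).rtt a.1 a.2 b.1 b.2
    simp only [hU, hR, Matrix.mul_apply, Fintype.sum_prod_type, Matrix.map_apply, Matrix.of_apply]
    simp only [← Algebra.commutes, ← Algebra.smul_def]
    exact this
  have h2 : R * R' = 1 := by
    rw [hR, hR', ← Matrix.map_mul, Rhat_mul_RhatInv]
    exact Matrix.map_one _ (map_zero _) (map_one _)
  have h3 : R' * R = 1 := by
    rw [hR, hR', ← Matrix.map_mul, RhatInv_mul_Rhat]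
    exact Matrix.map_one _ (map_zero _) (map_one _)
  have h4 : R' * U = U * R' := by
    calc R' * U = R' * (U * R) * R' := by rw [mul_assoc, mul_assoc, h2, mul_one]
      _ = U * R' := by rw [← h1, ← mul_assoc, h3, one_mul]
  have h5 := congrFun (congrFun h4 (i, j)) (m, n)
  simp only [hU, hR', Matrix.mul_apply, Fintype.sum_prod_type, Matrix.map_apply,
    Matrix.of_apply] at h5
  simp only [← Algebra.commutes, ← Algebra.smul_def] at h5
  exact h5

/-- `Ĉ_{ij} u^i_k u^j_l = Ĉ_{kl}`. -/
theorem chat_u (s : ℂˣ) (k l : Fin 2) :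
    ∑ i, ∑ j, Chat s i j • (u s i k * u s j l) = Chat s k l • 1 := by
  have hs : (s : ℂ) ≠ 0 := s.ne_zero
  have h := u_isQuantumMatrix s
  fin_cases k <;> fin_cases l <;>
    simp [Chat, Ccheck, h.ab, h.ac, h.bd, h.cd, h.bc, h.ad, h.da, smul_smul] <;>
    simp only [q] <;> match_scalars <;> field_simp <;> ring

/-- The corepresentation `v^{kl}_{ij} = u^k_i u^l_j` of `A` on the left-invariant one-forms. -/
def vv (s : ℂˣ) : Matrix Idx Idx (OSL s) := Matrix.of fun k i => u s k.1 i.1 * u s k.2 i.2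

theorem fGen_vv (s : ℂˣ) (ε : ℤˣ) (p l : Fin 2) (i j : Idx) :
    ∑ m : Idx, ∑ n, fGen s ε p n m j • (vv s m i * u s n l) =
      ∑ m : Idx, ∑ n, fGen s ε n l i m • (u s p n * vv s j m) := by
  calc ∑ m : Idx, ∑ n, fGen s ε p n m j • (vv s m i * u s n l)
      = ((ε : ℤ) : ℂ) • ∑ m, ∑ k, Rhat s (p, j.1) (m, k) • (u s m i.1 *
          ∑ m', ∑ n, RhatInv s (k, j.2) (m', n) • (u s m' i.2 * u s n l)) := by
        simp only [fGen, vv, Matrix.of_apply, Fin.sum_univ_two, Fintype.sum_prod_type, mul_add,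
          smul_add, mul_smul_comm, smul_smul, mul_assoc, add_smul]
        module
    _ = ((ε : ℤ) : ℂ) • ∑ m, ∑ k, Rhat s (p, j.1) (m, k) • (u s m i.1 *
          ∑ a, ∑ b, RhatInv s (a, b) (i.2, l) • (u s k a * u s j.2 b)) := by
        simp only [rtt_inv]
    _ = ((ε : ℤ) : ℂ) • ∑ a, ∑ b, RhatInv s (a, b) (i.2, l) •
          ((∑ m, ∑ k, Rhat s (p, j.1) (m, k) • (u s m i.1 * u s k a)) * u s j.2 b) := by
        simp only [Fin.sum_univ_two, mul_add, add_mul,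
          smul_add, mul_smul_comm, smul_mul_assoc, smul_smul, mul_assoc]
        module
    _ = ((ε : ℤ) : ℂ) • ∑ a, ∑ b, RhatInv s (a, b) (i.2, l) •
          ((∑ m, ∑ k, Rhat s (m, k) (i.1, a) • (u s p m * u s j.1 k)) * u s j.2 b) := by
        simp only [(u_isQuantumMatrix s).rtt]
    _ = _ := by
        simp only [fGen, vv, Matrix.of_apply, Fin.sum_univ_two, Fintype.sum_prod_type, mul_add,
          add_mul, smul_mul_assoc, smul_add, mul_smul_comm, smul_smul, mul_assoc, add_smul]
        module

/-- The corepresentation of `A` on the left-invariant elements of `Γ ⊗_A Γ`. -/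
def ww (s : ℂˣ) : Matrix (Idx × Idx) (Idx × Idx) (OSL s) :=
  Matrix.of fun k i => vv s k.1 i.1 * vv s k.2 i.2

theorem braidMatrix_apply (s : ℂˣ) (ε : ℤˣ) (p r : Idx × Idx) :
    braidMatrix s ε p r =
      ∑ a, fGen s ε p.1.1 r.2.1 r.1 a * fGen s ε p.1.2 r.2.2 a p.2 := by
  simp only [braidMatrix, Matrix.of_apply, map_mul, fHom_u, Matrix.mul_apply]

theorem braidMatrix_ww (s : ℂˣ) (ε : ℤˣ) (k p : Idx × Idx) :
    ∑ r, braidMatrix s ε k r • ww s r p = ∑ r, braidMatrix s ε r p • ww s k r := by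
  calc ∑ r, braidMatrix s ε k r • ww s r p
      = ∑ a, ∑ n, fGen s ε k.1.2 n a k.2 •
          ((∑ r : Idx, ∑ m, fGen s ε k.1.1 m r a • (vv s r p.1 * u s m p.2.1)) * u s n p.2.2) := by
        simp only [braidMatrix_apply, ww, vv, Matrix.of_apply, Fintype.sum_prod_type,
          Fin.sum_univ_two, add_mul, smul_mul_assoc, smul_add, smul_smul, mul_assoc, add_smul]
        module
    _ = ∑ a, ∑ n, fGen s ε k.1.2 n a k.2 •
          ((∑ r : Idx, ∑ m, fGen s ε m p.2.1 p.1 r • (u s k.1.1 m * vv s a r)) * u s n p.2.2) := by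
        simp only [fGen_vv]
    _ = ∑ r : Idx, ∑ m, fGen s ε m p.2.1 p.1 r • (u s k.1.1 m *
          ∑ a : Idx, ∑ n, fGen s ε k.1.2 n a k.2 • (vv s a r * u s n p.2.2)) := by
        simp only [Finset.mul_sum, Finset.sum_mul, Finset.smul_sum, smul_mul_assoc, mul_smul_comm,
          smul_smul, mul_assoc]
        rw [sum_swap4]
        simp only [mul_comm]
    _ = ∑ r : Idx, ∑ m, fGen s ε m p.2.1 p.1 r • (u s k.1.1 m *
          ∑ a : Idx, ∑ n, fGen s ε n p.2.2 r a • (u s k.1.2 n * vv s k.2 a)) := by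
        simp only [fGen_vv]
    _ = _ := by
        simp only [braidMatrix_apply, ww, vv, Matrix.of_apply, Fintype.sum_prod_type,
          Fin.sum_univ_two, mul_add, mul_smul_comm, smul_add, smul_smul, mul_assoc, add_smul]
        module

theorem metricMatrix_ww (s : ℂˣ) (c : ℂˣ) (p : Idx × Idx) :
    ∑ r, metricMatrix s c r • ww s r p = metricMatrix s c p • 1 := by
  calc ∑ r, metricMatrix s c r • ww s r p
      = (-(s : ℂ) * c) • ∑ i, ∑ l, ∑ m, ∑ n, (Chat s i m * Chat s n l) • (u s i p.1.1 *
          ((∑ j, ∑ k, RhatInv s (m, n) (j, k) • (u s j p.1.2 * u s k p.2.1)) * u s l p.2.2)) := by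
        simp only [metricMatrix, ww, vv, Matrix.of_apply, Fintype.sum_prod_type,
          Fin.sum_univ_two, mul_add, add_mul, mul_smul_comm, smul_mul_assoc, smul_add, smul_smul,
          mul_assoc, add_smul]
        module
    _ = (-(s : ℂ) * c) • ∑ i, ∑ l, ∑ m, ∑ n, (Chat s i m * Chat s n l) • (u s i p.1.1 *
          ((∑ a, ∑ b, RhatInv s (a, b) (p.1.2, p.2.1) • (u s m a * u s n b)) * u s l p.2.2)) := by
        simp only [rtt_inv]
    _ = (-(s : ℂ) * c) • ∑ a, ∑ b, RhatInv s (a, b) (p.1.2, p.2.1) •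
          ((∑ i, ∑ m, Chat s i m • (u s i p.1.1 * u s m a)) *
            (∑ n, ∑ l, Chat s n l • (u s n b * u s l p.2.2))) := by
        simp only [Fin.sum_univ_two, mul_add, add_mul, mul_smul_comm, smul_mul_assoc, smul_add,
          smul_smul, mul_assoc]
        module
    _ = _ := by
        simp only [chat_u, metricMatrix, smul_mul_assoc, mul_smul_comm, one_mul, smul_smul,
          ← Finset.sum_smul]
        congr 1
        simp only [Finset.mul_sum]
        refine Finset.sum_congr rfl fun a _ => Finset.sum_congr rfl fun b _ => ?_
        ring

namespace Cl

variable (s : ℂˣ) (ε : ℤˣ) (c : ℂˣ)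

theorem theta_mul_u (i : Idx) (k l : Fin 2) :
    theta s ε c i * ofAlg s ε c (u s k l) =
      ∑ j, ∑ m, fGen s ε m l i j • (ofAlg s ε c (u s k m) * theta s ε c j) := by
  simp only [theta_mul_ofAlg, rightMul_u, map_sum, map_smul, Finset.sum_mul, smul_mul_assoc]

/-- The right coaction `Δ_R` of `A` on `Cl(Γ, σ, g)`: the algebra homomorphism that extends the
coproduct of `A`, with `Δ_R(θ_{ij}) = θ_{kl} ⊗ u^k_i u^l_j`. -/
def rightCoaction : Cl s ε c →ₐ[ℂ] Cl s ε c ⊗[ℂ] OSL s :=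
  lift ((Algebra.TensorProduct.map (ofAlg s ε c) (AlgHom.id ℂ (OSL s))).comp
      (Bialgebra.comulAlgHom ℂ (OSL s)))
    (fun i => ∑ k, theta s ε c k ⊗ₜ[ℂ] vv s k i)
    (fun i k l => by
      calc (∑ m, theta s ε c m ⊗ₜ[ℂ] vv s m i) * _
          = ∑ p, ∑ j, (ofAlg s ε c (u s k p) * theta s ε c j) ⊗ₜ[ℂ]
              (∑ m : Idx, ∑ n, fGen s ε p n m j • (vv s m i * u s n l)) := by
            simp only [AlgHom.comp_apply, Bialgebra.comulAlgHom_apply, OSL.comul_u, map_sum,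
              Algebra.TensorProduct.map_tmul, AlgHom.id_apply, Finset.sum_mul_sum,
              Algebra.TensorProduct.tmul_mul_tmul, theta_mul_u, TensorProduct.tmul_sum,
              TensorProduct.sum_tmul, TensorProduct.tmul_smul, ← TensorProduct.smul_tmul']
            rw [sum_swap4]
            exact Finset.sum_comm
        _ = ∑ p, ∑ j, (ofAlg s ε c (u s k p) * theta s ε c j) ⊗ₜ[ℂ]
              (∑ m : Idx, ∑ n, fGen s ε n l i m • (u s p n * vv s j m)) := by
            simp only [fGen_vv]
        _ = _ := by
            simp only [AlgHom.comp_apply, Bialgebra.comulAlgHom_apply, OSL.comul_u, map_sum,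
              rightMul_u, map_smul, Algebra.TensorProduct.map_tmul, AlgHom.id_apply,
              Finset.sum_mul, Finset.mul_sum, Finset.smul_sum,
              Algebra.TensorProduct.tmul_mul_tmul, TensorProduct.tmul_sum,
              TensorProduct.tmul_smul, smul_mul_assoc]
            rw [sum_swap4]
            refine Finset.sum_congr rfl fun m _ => ?_
            exact (Finset.sum_congr rfl fun n _ => Finset.sum_comm).trans Finset.sum_comm)
    (fun l hl => by
      have h0 : ∑ p : Idx × Idx, l p • ((∑ k, theta s ε c k ⊗ₜ[ℂ] vv s k p.1) *
          (∑ k, theta s ε c k ⊗ₜ[ℂ] vv s k p.2)) =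
          ∑ r : Idx × Idx, (theta s ε c r.1 * theta s ε c r.2) ⊗ₜ[ℂ] (∑ p, l p • ww s r p) := by
        simp only [Finset.sum_mul_sum, Algebra.TensorProduct.tmul_mul_tmul, Finset.smul_sum,
          ← TensorProduct.tmul_smul, TensorProduct.tmul_sum]
        rw [Fintype.sum_prod_type, sum_swap4]
        refine Eq.trans ?_ (Fintype.sum_prod_type _).symm
        refine Finset.sum_congr rfl fun k _ => ?_
        refine Finset.sum_congr rfl fun m _ => ?_
        simp only [Fintype.sum_prod_type, ww, Matrix.of_apply]
      have h1 := sum_pairing_eq_zero (braidMatrix s ε - 1)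
        (TensorProduct.mk ℂ (Cl s ε c) (OSL s)).flip
        (fun r => ∑ p, l p • ww s r p)
        (fun r => theta s ε c r.1 * theta s ε c r.2 - algebraMap ℂ _ (metricMatrix s c r))
        (fun k => by
          simp only [Matrix.sub_apply, sub_smul, Finset.sum_sub_distrib, Matrix.one_apply,
            ite_smul, one_smul, zero_smul, Finset.sum_ite_eq, Finset.mem_univ, if_true,
            sub_eq_zero]
          simp only [Finset.smul_sum]
          rw [Finset.sum_comm]
          simp only [smul_comm (braidMatrix s ε k _) (l _), ← Finset.smul_sum, braidMatrix_ww]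
          conv_rhs => rw [← hl]
          simp only [Matrix.mulVec, dotProduct, Finset.sum_smul, Finset.smul_sum, smul_smul]
          rw [Finset.sum_comm]
          simp only [mul_comm])
        (fun l' hl' => by
          rw [Matrix.sub_mulVec, Matrix.one_mulVec, sub_eq_zero] at hl'
          have h4 := theta_rel s ε c l' hl'
          simp only [smul_sub, Finset.sum_sub_distrib, h4, map_sum, map_mul]
          simp only [Algebra.smul_def, sub_self])
      simp only [LinearMap.flip_apply, TensorProduct.mk_apply, TensorProduct.sub_tmul,
        Finset.sum_sub_distrib, sub_eq_zero] at h1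
      rw [h0, h1]
      simp only [Algebra.algebraMap_eq_smul_one, TensorProduct.smul_tmul, ← TensorProduct.tmul_sum,
        Finset.smul_sum]
      rw [Finset.sum_comm]
      simp only [smul_comm (metricMatrix s c _) (l _), ← Finset.smul_sum, metricMatrix_ww]
      simp only [smul_smul, ← Finset.sum_smul, TensorProduct.tmul_smul, Algebra.TensorProduct.one_def])

@[simp]
theorem leftCoaction_ofAlg (a : OSL s) : leftCoaction s ε c (ofAlg s ε c a) =
    Algebra.TensorProduct.map (AlgHom.id ℂ (OSL s)) (ofAlg s ε c) (Coalgebra.comul (R := ℂ) a) :=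
  lift_ofAlg _ _ _ _ _

@[simp]
theorem leftCoaction_theta (i : Idx) :
    leftCoaction s ε c (theta s ε c i) = 1 ⊗ₜ[ℂ] theta s ε c i :=
  lift_theta _ _ _ _ _

@[simp]
theorem rightCoaction_ofAlg (a : OSL s) : rightCoaction s ε c (ofAlg s ε c a) =
    Algebra.TensorProduct.map (ofAlg s ε c) (AlgHom.id ℂ (OSL s)) (Coalgebra.comul (R := ℂ) a) :=
  lift_ofAlg _ _ _ _ _

@[simp]
theorem rightCoaction_theta (i j : Fin 2) : rightCoaction s ε c (theta s ε c (i, j)) =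
    ∑ p : Idx, theta s ε c p ⊗ₜ[ℂ] (u s p.1 i * u s p.2 j) :=
  lift_theta _ _ _ _ _

end Cl

section Spinors

variable (s : ℂˣ) (ε : ℤˣ) (c : ℂˣ)

/-- `ψ⁺_1 = q / ([2] c) θ_11 θ_12 θ_21 θ_22` and `ψ⁺_2 = θ_21 θ_22`. -/
def psiPlus : Fin 2 → Cl s ε c :=
  ![(q s / (qtwo s * c)) • (Cl.theta s ε c (0, 0) * Cl.theta s ε c (0, 1) *
      Cl.theta s ε c (1, 0) * Cl.theta s ε c (1, 1)),
    Cl.theta s ε c (1, 0) * Cl.theta s ε c (1, 1)]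

/-- `ψ⁻_1 = θ_11 θ_21 θ_22` and `ψ⁻_2 = q θ_12 θ_21 θ_22`. -/
def psiMinus : Fin 2 → Cl s ε c :=
  ![Cl.theta s ε c (0, 0) * Cl.theta s ε c (1, 0) * Cl.theta s ε c (1, 1),
    q s • (Cl.theta s ε c (0, 1) * Cl.theta s ε c (1, 0) * Cl.theta s ε c (1, 1))]

/-- The left ideal `S_0` of `Cl(Γ, σ, g)` generated by the `ψ^±_i`. -/
def S0 : Submodule (Cl s ε c) (Cl s ε c) :=
  Submodule.span _ (Set.range (psiPlus s ε c) ∪ Set.range (psiMinus s ε c))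

theorem psiPlus_mem (i : Fin 2) : psiPlus s ε c i ∈ S0 s ε c :=
  Submodule.subset_span (Or.inl ⟨i, rfl⟩)

theorem psiMinus_mem (i : Fin 2) : psiMinus s ε c i ∈ S0 s ε c :=
  Submodule.subset_span (Or.inr ⟨i, rfl⟩)

theorem S0_eq_span : S0 s ε c = Submodule.span _ {psiPlus s ε c 1} := by
  refine le_antisymm (Submodule.span_le.mpr ?_)
    (Submodule.span_le.mpr (Set.singleton_subset_iff.mpr (psiPlus_mem s ε c 1)))
  rintro _ (⟨i, rfl⟩ | ⟨i, rfl⟩) <;> refine Submodule.mem_span_singleton.mpr ?_ <;> fin_cases i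
  · exact ⟨(q s / (qtwo s * c)) • (Cl.theta s ε c (0, 0) * Cl.theta s ε c (0, 1)), by
      simp [psiPlus, mul_assoc]⟩
  · exact ⟨1, by simp⟩
  · exact ⟨Cl.theta s ε c (0, 0), by simp [psiPlus, psiMinus, mul_assoc]⟩
  · exact ⟨q s • Cl.theta s ε c (0, 1), by simp [psiPlus, psiMinus, mul_assoc]⟩

theorem fGen_21 (m l r t : Fin 2) : fGen s ε m l (1, 0) (r, t) =
    if m = l ∧ r = 1 ∧ t = 0 then
      ((ε : ℤ) : ℂ) * (if l = 0 then ((s : ℂ) ^ 2)⁻¹ else (s : ℂ) ^ 2) else 0 := by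
  have hs : (s : ℂ) ≠ 0 := s.ne_zero
  fin_cases m <;> fin_cases l <;> fin_cases r <;> fin_cases t <;>
    simp [fGen, Rhat, RhatInv, Ccheck, Chat] <;> field_simp

theorem theta_sq : Cl.theta s ε c (1, 0) * Cl.theta s ε c (1, 0) = 0 := by
  have hs : (s : ℂ) ≠ 0 := s.ne_zero
  have hε : ((ε : ℤ) : ℂ) * ((ε : ℤ) : ℂ) = 1 := by
    rcases Int.units_eq_one_or ε with rfl | rfl <;> simp
  have h := Cl.theta_rel s ε c (Pi.single ((1, 0), (1, 0)) 1) (by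
    rw [Matrix.mulVec_single_one]
    funext ⟨⟨i, j⟩, ⟨k, l⟩⟩
    rw [Matrix.col_apply, braidMatrix_apply, Finset.sum_eq_single (1, 0)]
    · rw [fGen_21, fGen_21, Pi.single_apply]
      fin_cases i <;> fin_cases j <;> fin_cases k <;> fin_cases l <;> simp
      rw [mul_mul_mul_comm, hε, one_mul, mul_inv_cancel₀ (pow_ne_zero 2 hs)]
    · rintro ⟨a, b⟩ - hab
      rw [fGen_21, if_neg, zero_mul]
      rintro ⟨-, rfl, rfl⟩
      exact hab rfl
    · simp)
  simpa [Pi.single_apply, metricMatrix, RhatInv, Ccheck, Chat] using h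

theorem psi_mul_u (k l : Fin 2) :
    psiPlus s ε c 1 * Cl.ofAlg s ε c (u s k l) ∈ S0 s ε c := by
  have h1 : ∀ l, Cl.theta s ε c (1, 0) * Cl.ofAlg s ε c (u s k l) =
      (fGen s ε l l (1, 0) (1, 0) • Cl.ofAlg s ε c (u s k l)) * Cl.theta s ε c (1, 0) := by
    intro l
    rw [Cl.theta_mul_u]
    simp only [Fintype.sum_prod_type, fGen_21]
    fin_cases l <;> simp
  have h2 : Cl.theta s ε c (1, 1) * Cl.ofAlg s ε c (u s k l) =
      ∑ m, (fGen s ε m l (1, 1) (1, 0) • (Cl.ofAlg s ε c (u s k m) * Cl.theta s ε c (1, 0)) +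
      fGen s ε m l (1, 1) (1, 1) • (Cl.ofAlg s ε c (u s k m) * Cl.theta s ε c (1, 1))) := by
    rw [Cl.theta_mul_u]
    fin_cases l <;>
    simp [fGen, Rhat, RhatInv, Ccheck, Chat, Fintype.sum_prod_type]
    exact add_comm _ _
  have h3 : psiPlus s ε c 1 * Cl.ofAlg s ε c (u s k l) =
      (∑ m, (fGen s ε m l (1, 1) (1, 1) * fGen s ε m m (1, 0) (1, 0)) •
        Cl.ofAlg s ε c (u s k m)) * psiPlus s ε c 1 := by
    change Cl.theta s ε c (1, 0) * Cl.theta s ε c (1, 1) * _ =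
      _ * (Cl.theta s ε c (1, 0) * Cl.theta s ε c (1, 1))
    rw [mul_assoc, h2, Finset.mul_sum, Finset.sum_mul]
    refine Finset.sum_congr rfl fun m _ => ?_
    rw [mul_add, mul_smul_comm, mul_smul_comm, ← mul_assoc, ← mul_assoc, h1, mul_assoc, theta_sq,
      mul_zero, smul_zero, zero_add, mul_assoc, smul_mul_assoc, smul_smul, smul_mul_assoc]
  rw [h3]
  exact (S0 s ε c).smul_mem _ (psiPlus_mem s ε c 1)

/-- `S_0` is invariant under right multiplication by `A`. -/
theorem S0_mul_mem {x : Cl s ε c} (hx : x ∈ S0 s ε c) (a : OSL s) :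
    x * Cl.ofAlg s ε c a ∈ S0 s ε c := by
  have ha : a ∈ Algebra.adjoin ℂ {x | ∃ i j, x = u s i j} := OSL.adjoin_u s ▸ Algebra.mem_top
  induction ha using Algebra.adjoin_induction generalizing x with
  | mem y hy =>
    obtain ⟨k, l, rfl⟩ := hy
    rw [S0_eq_span] at hx
    obtain ⟨v, rfl⟩ := Submodule.mem_span_singleton.mp hx
    rw [smul_eq_mul, mul_assoc]
    exact (S0 s ε c).smul_mem v (psi_mul_u s ε c k l)
  | algebraMap r =>
    rw [AlgHom.commutes, ← Algebra.commutes]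
    exact (S0 s ε c).smul_mem _ hx
  | add y z _ _ hy hz =>
    rw [map_add, mul_add]
    exact (S0 s ε c).add_mem (hy hx) (hz hx)
  | mul y z _ _ hy hz =>
    rw [map_mul, ← mul_assoc]
    exact hz (hy hx)

namespace S0

/-- Left multiplication of `Cl(Γ, σ, g)` on `S_0`. -/
def leftAct : Cl s ε c →ₗ[ℂ] S0 s ε c →ₗ[ℂ] S0 s ε c :=
  LinearMap.mk₂ ℂ (fun v x => v • x) (fun _ _ _ => add_smul _ _ _) (fun _ _ _ => smul_assoc _ _ _)
    (fun _ _ _ => smul_add _ _ _) (fun a v x => smul_comm v a x)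

/-- Right multiplication of `A` on `S_0`. -/
def rightAct : S0 s ε c →ₗ[ℂ] OSL s →ₗ[ℂ] S0 s ε c :=
  LinearMap.mk₂ ℂ (fun x a => ⟨x * Cl.ofAlg s ε c a, S0_mul_mem s ε c x.2 a⟩)
    (fun _ _ _ => Subtype.ext (by simp [add_mul])) (fun _ _ _ => Subtype.ext (by simp))
    (fun _ _ _ => Subtype.ext (by simp [mul_add])) (fun _ _ _ => Subtype.ext (by simp))

/-- The left-invariant elements of `S_0`. -/
def inv : Submodule ℂ (S0 s ε c) :=
  LinearMap.ker (((Cl.leftCoaction s ε c).toLinearMap -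
    TensorProduct.mk ℂ (OSL s) (Cl s ε c) 1) ∘ₗ (S0 s ε c).subtype.restrictScalars ℂ)

theorem mem_inv (x : S0 s ε c) : x ∈ inv s ε c ↔
    Cl.leftCoaction s ε c x = 1 ⊗ₜ[ℂ] (x : Cl s ε c) :=
  sub_eq_zero

/-- `ψ⁺_i` as a left-invariant element of `S_0`. -/
def psiPlus (i : Fin 2) : inv s ε c :=
  ⟨⟨QSpin.psiPlus s ε c i, psiPlus_mem s ε c i⟩, (mem_inv s ε c _).mpr (by
    fin_cases i <;> simp [QSpin.psiPlus])⟩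

/-- `ψ⁻_i` as a left-invariant element of `S_0`. -/
def psiMinus (i : Fin 2) : inv s ε c :=
  ⟨⟨QSpin.psiMinus s ε c i, psiMinus_mem s ε c i⟩, (mem_inv s ε c _).mpr (by
    fin_cases i <;> simp [QSpin.psiMinus])⟩

end S0

end Spinors

section DoiHopf

variable {M A H C : Type*} [AddCommGroup M] [Module ℂ M]

/-- `ρ : M → M ⊗ C` is a right coaction of the coalgebra `C` on `M`. -/
structure IsRightCoaction [AddCommGroup C] [Module ℂ C] [Coalgebra ℂ C]
    (ρ : M →ₗ[ℂ] M ⊗[ℂ] C) : Prop where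
  /-- `(ρ ⊗ id) ρ = (id ⊗ Δ) ρ`. -/
  coassoc : ∀ m, TensorProduct.assoc ℂ M C C (ρ.rTensor C (ρ m)) =
    (Coalgebra.comul (R := ℂ) (A := C)).lTensor M (ρ m)
  /-- `(id ⊗ ε) ρ = id`. -/
  counit : ∀ m, TensorProduct.rid ℂ M ((Coalgebra.counit (R := ℂ) (A := C)).lTensor M (ρ m)) = m

/-- `act` is a right action of the algebra `A` on `M`. -/
structure IsRightAction [Ring A] [Algebra ℂ A] (act : M →ₗ[ℂ] A →ₗ[ℂ] M) : Prop where
  act_one : ∀ m, act m 1 = m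
  act_mul : ∀ m a b, act m (a * b) = act (act m a) b

/-- `(H, A, C)` is a right-right Doi–Hopf datum: `A` is a right `H`-comodule algebra with coaction
`ρ` and `C` is a right `H`-module coalgebra with action `act`. -/
structure IsDoiHopfDatum [Ring H] [HopfAlgebra ℂ H] [Ring A] [Algebra ℂ A]
    [AddCommGroup C] [Module ℂ C] [Coalgebra ℂ C]
    (ρ : A →ₐ[ℂ] A ⊗[ℂ] H) (act : C →ₗ[ℂ] H →ₗ[ℂ] C) : Prop where
  coaction : IsRightCoaction ρ.toLinearMap
  action : IsRightAction act
  /-- `Δ(c h) = c_(1) h_(1) ⊗ c_(2) h_(2)`. -/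
  comul_act : ∀ x h, Coalgebra.comul (R := ℂ) (act x h) =
    TensorProduct.map₂ act act (Coalgebra.comul (R := ℂ) x) (Coalgebra.comul (R := ℂ) h)
  /-- `ε(c h) = ε(c) ε(h)`. -/
  counit_act : ∀ x h, Coalgebra.counit (R := ℂ) (act x h) =
    Coalgebra.counit (R := ℂ) x * Coalgebra.counit (R := ℂ) h

/-- `M` with the right action `actM` of `A` and the right coaction `ρM` of `C` is a Doi–Hopf module
in `M(H)^C_A`, where `(H, A, C)` is the Doi–Hopf datum given by `ρ` and `act`. -/
structure IsDoiHopfModule [Ring H] [HopfAlgebra ℂ H] [Ring A] [Algebra ℂ A]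
    [AddCommGroup C] [Module ℂ C] [Coalgebra ℂ C]
    (ρ : A →ₐ[ℂ] A ⊗[ℂ] H) (act : C →ₗ[ℂ] H →ₗ[ℂ] C)
    (actM : M →ₗ[ℂ] A →ₗ[ℂ] M) (ρM : M →ₗ[ℂ] M ⊗[ℂ] C) : Prop where
  datum : IsDoiHopfDatum ρ act
  action : IsRightAction actM
  coaction : IsRightCoaction ρM
  /-- `ρM(m a) = m_(0) a_(0) ⊗ m_(1) a_(1)`. -/
  compat : ∀ m a, ρM (actM m a) = TensorProduct.map₂ actM act (ρM m) (ρ a)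

end DoiHopf

/-- Right multiplication of `A` on `Ã`. -/
def Atilde.rightAct (s : ℂˣ) : Atilde s →ₗ[ℂ] OSL s →ₗ[ℂ] Atilde s :=
  (LinearMap.mul ℂ (Atilde s)).compl₂ (Atilde.incl s).toLinearMap

/-- Left multiplication of `A` on `Ã`. -/
def Atilde.leftAct (s : ℂˣ) : OSL s →ₗ[ℂ] Atilde s →ₗ[ℂ] Atilde s :=
  (LinearMap.mul ℂ (Atilde s)).comp (Atilde.incl s).toLinearMap

/-- `D(ψ^±_i) = ψ^±_j ⊗ u^j_i χ` for a linear map `D : (S_0)_inv → (S_0)_inv ⊗ Ã`. -/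
structure IsSpinorCoaction {s : ℂˣ} {ε : ℤˣ} {c : ℂˣ}
    (D : S0.inv s ε c →ₗ[ℂ] S0.inv s ε c ⊗[ℂ] Atilde s) : Prop where
  plus : ∀ i, D (S0.psiPlus s ε c i) =
    ∑ j, S0.psiPlus s ε c j ⊗ₜ[ℂ] (Atilde.incl s (u s j i) * Atilde.chi s)
  minus : ∀ i, D (S0.psiMinus s ε c i) =
    ∑ j, S0.psiMinus s ε c j ⊗ₜ[ℂ] (Atilde.incl s (u s j i) * Atilde.chi s)

end QSpin

end

noncomputable section

namespace QSpin

section CliffordRelations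

variable (s : ℂˣ) (ε : ℤˣ) (c : ℂˣ)

/-- The entries of the matrices `f^{ij}_{rt}(u^m_l)` up to the sign of the calculus. -/
def fEntry (m l : Fin 2) (p p' : Idx) : ℂ :=
  ![![![![![![1, 0], ![0, 0]], ![![0, q s], ![-qhat s ^ 2, 0]]],
        ![![![0, 0], ![(q s)⁻¹, 0]], ![![0, 0], ![0, 1]]]],
      ![![![![0, 0], ![qhat s, 0]], ![![0, 0], ![0, (q s)⁻¹ * qhat s]]],
        ![![![0, 0], ![0, 0]], ![![0, 0], ![0, 0]]]]],
    ![![![![![0, 0], ![0, 0]], ![![-qhat s, 0], ![0, 0]]],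
        ![![![0, 0], ![0, 0]], ![![0, 0], ![-q s * qhat s, 0]]]],
      ![![![![1, 0], ![0, 0]], ![![0, (q s)⁻¹], ![0, 0]]],
        ![![![0, 0], ![q s, 0]], ![![0, 0], ![0, 1]]]]]] m l p.1 p.2 p'.1 p'.2

theorem fGen_eq (m l : Fin 2) (p p' : Idx) :
    fGen s ε m l p p' = ((ε : ℤ) : ℂ) * fEntry s m l p p' := by
  have hs : (s : ℂ) ≠ 0 := s.ne_zero
  obtain ⟨i, j⟩ := p
  obtain ⟨r, t⟩ := p'
  rw [fGen, Matrix.of_apply]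
  congr 1
  fin_cases m <;> fin_cases l <;> fin_cases i <;> fin_cases j <;> fin_cases r <;> fin_cases t <;>
    simp [fEntry, Rhat, RhatInv, Ccheck, Chat] <;> simp [qhat, q] <;> field_simp <;> ring

theorem sign_mul_sign : ((ε : ℤ) : ℂ) * ((ε : ℤ) : ℂ) = 1 := by
  rcases Int.units_eq_one_or ε with rfl | rfl <;> simp

theorem braidMatrix_eq (p r : Idx × Idx) :
    braidMatrix s ε p r =
      ∑ a, fEntry s p.1.1 r.2.1 r.1 a * fEntry s p.1.2 r.2.2 a p.2 := by
  simp only [braidMatrix_apply, fGen_eq, mul_mul_mul_comm, sign_mul_sign, one_mul]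

theorem metricMatrix_eq (p : Idx × Idx) : metricMatrix s c p =
    c * ![![![![0, 0], ![0, -1]], ![![0, qhat s], ![1, 0]]],
      ![![![0, 1], ![0, 0]], ![![-q s ^ 2, 0], ![0, 0]]]] p.1.1 p.1.2 p.2.1 p.2.2 := by
  have hs : (s : ℂ) ≠ 0 := s.ne_zero
  obtain ⟨⟨i, j⟩, ⟨k, l⟩⟩ := p
  fin_cases i <;> fin_cases j <;> fin_cases k <;> fin_cases l <;>
    simp [metricMatrix, RhatInv, Ccheck, Chat] <;> (try simp only [qhat, q]) <;> field_simp <;> ring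

theorem theta_rel_of_entries (l : Fin 2 → Fin 2 → Fin 2 → Fin 2 → ℂ)
    (hl : ∀ i j k m, ∑ i', ∑ j', ∑ k', ∑ m', (∑ a, ∑ b, fEntry s i k' (i', j') (a, b) *
      fEntry s j m' (a, b) (k, m)) * l i' j' k' m' = l i j k m) :
    ∑ i, ∑ j, ∑ k, ∑ m, l i j k m • (Cl.theta s ε c (i, j) * Cl.theta s ε c (k, m)) =
      algebraMap ℂ _ (∑ i, ∑ j, ∑ k, ∑ m, l i j k m * metricMatrix s c ((i, j), (k, m))) := by
  have h := Cl.theta_rel s ε c (fun p => l p.1.1 p.1.2 p.2.1 p.2.2) (by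
    funext ⟨⟨i, j⟩, ⟨k, m⟩⟩
    simp only [Matrix.mulVec, dotProduct, Fintype.sum_prod_type, braidMatrix_eq]
    exact hl i j k m)
  simpa only [Fintype.sum_prod_type] using h

theorem theta_00_00 : Cl.theta s ε c (0, 0) * Cl.theta s ε c (0, 0) =
    0 := by
  have h := theta_rel_of_entries s ε c
    ![![![![1, 0], ![0, 0]], ![![0, 0], ![0, 0]]],
      ![![![0, 0], ![0, 0]], ![![0, 0], ![0, 0]]]] (by
    intro i j k m
    simp [Fin.sum_univ_two]
    fin_cases i <;> fin_cases j <;> fin_cases k <;> fin_cases m <;> simp [fEntry])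
  simp [metricMatrix_eq, Algebra.algebraMap_eq_smul_one] at h
  linear_combination (norm := module) h

theorem theta_01_00 : Cl.theta s ε c (0, 1) * Cl.theta s ε c (0, 0) =
    -(q s ^ 2 • (Cl.theta s ε c (0, 0) * Cl.theta s ε c (0, 1))) - qhat s • (Cl.theta s ε c (0, 0) * Cl.theta s ε c (1, 0)) := by
  have hs : (s : ℂ) ≠ 0 := s.ne_zero
  have h := theta_rel_of_entries s ε c
    ![![![![0, q s ^ 2], ![qhat s, 0]], ![![1, 0], ![0, 0]]],
      ![![![0, 0], ![0, 0]], ![![0, 0], ![0, 0]]]] (by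
    intro i j k m
    simp [Fin.sum_univ_two]
    fin_cases i <;> fin_cases j <;> fin_cases k <;> fin_cases m <;> simp [fEntry] <;>
      (try simp only [q, qhat]) <;> field_simp <;> ring)
  simp [metricMatrix_eq, Algebra.algebraMap_eq_smul_one] at h
  linear_combination (norm := module) h

theorem theta_01_01 : Cl.theta s ε c (0, 1) * Cl.theta s ε c (0, 1) =
    -(qhat s • (Cl.theta s ε c (0, 0) * Cl.theta s ε c (1, 1))) := by
  have hs : (s : ℂ) ≠ 0 := s.ne_zero
  have h := theta_rel_of_entries s ε c
    ![![![![0, 0], ![0, qhat s]], ![![0, 1], ![0, 0]]],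
      ![![![0, 0], ![0, 0]], ![![0, 0], ![0, 0]]]] (by
    intro i j k m
    simp [Fin.sum_univ_two]
    fin_cases i <;> fin_cases j <;> fin_cases k <;> fin_cases m <;> simp [fEntry] <;>
      (try simp only [q, qhat]) <;> field_simp <;> ring)
  simp [metricMatrix_eq, Algebra.algebraMap_eq_smul_one] at h
  linear_combination (norm := module) h

theorem theta_10_00 : Cl.theta s ε c (1, 0) * Cl.theta s ε c (0, 0) =
    -(Cl.theta s ε c (0, 0) * Cl.theta s ε c (1, 0)) := by
  have hs : (s : ℂ) ≠ 0 := s.ne_zero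
  have h := theta_rel_of_entries s ε c
    ![![![![0, 0], ![1, 0]], ![![0, 0], ![0, 0]]],
      ![![![1, 0], ![0, 0]], ![![0, 0], ![0, 0]]]] (by
    intro i j k m
    simp [Fin.sum_univ_two]
    fin_cases i <;> fin_cases j <;> fin_cases k <;> fin_cases m <;> simp [fEntry] <;>
      (try simp only [q, qhat]) <;> field_simp <;> ring)
  simp [metricMatrix_eq, Algebra.algebraMap_eq_smul_one] at h
  linear_combination (norm := module) h

theorem theta_10_01 : Cl.theta s ε c (1, 0) * Cl.theta s ε c (0, 1) =
    ((c : ℂ) * (1 + (q s)⁻¹ ^ 2)) • 1 - (1 - (q s)⁻¹ ^ 2) • (Cl.theta s ε c (0, 0) * Cl.theta s ε c (1, 1)) - Cl.theta s ε c (0, 1) * Cl.theta s ε c (1, 0) := by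
  have hs : (s : ℂ) ≠ 0 := s.ne_zero
  have h := theta_rel_of_entries s ε c
    ![![![![0, 0], ![0, 1 - (q s)⁻¹ ^ 2]], ![![0, 0], ![1, 0]]],
      ![![![0, 1], ![0, 0]], ![![0, 0], ![0, 0]]]] (by
    intro i j k m
    simp [Fin.sum_univ_two]
    fin_cases i <;> fin_cases j <;> fin_cases k <;> fin_cases m <;> simp [fEntry] <;>
      (try simp only [q, qhat]) <;> field_simp <;> ring)
  simp [metricMatrix_eq, Algebra.algebraMap_eq_smul_one] at h
  linear_combination (norm := module) h

theorem theta_11_00 : Cl.theta s ε c (1, 1) * Cl.theta s ε c (0, 0) =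
    -((c : ℂ) * (1 + q s ^ 2)) • 1 - Cl.theta s ε c (0, 0) * Cl.theta s ε c (1, 1) := by
  have hs : (s : ℂ) ≠ 0 := s.ne_zero
  have h := theta_rel_of_entries s ε c
    ![![![![0, 0], ![0, 1]], ![![0, 0], ![0, 0]]],
      ![![![0, 0], ![0, 0]], ![![1, 0], ![0, 0]]]] (by
    intro i j k m
    simp [Fin.sum_univ_two]
    fin_cases i <;> fin_cases j <;> fin_cases k <;> fin_cases m <;> simp [fEntry] <;>
      (try simp only [q, qhat]) <;> field_simp <;> ring)
  simp [metricMatrix_eq, Algebra.algebraMap_eq_smul_one] at h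
  linear_combination (norm := module) h

theorem theta_11_01 : Cl.theta s ε c (1, 1) * Cl.theta s ε c (0, 1) =
    -(q s ^ 2 • (Cl.theta s ε c (0, 1) * Cl.theta s ε c (1, 1))) - qhat s • (Cl.theta s ε c (1, 0) * Cl.theta s ε c (1, 1)) := by
  have hs : (s : ℂ) ≠ 0 := s.ne_zero
  have h := theta_rel_of_entries s ε c
    ![![![![0, 0], ![0, 0]], ![![0, 0], ![0, q s ^ 2]]],
      ![![![0, 0], ![0, qhat s]], ![![0, 1], ![0, 0]]]] (by
    intro i j k m
    simp [Fin.sum_univ_two]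
    fin_cases i <;> fin_cases j <;> fin_cases k <;> fin_cases m <;> simp [fEntry] <;>
      (try simp only [q, qhat]) <;> field_simp <;> ring)
  simp [metricMatrix_eq, Algebra.algebraMap_eq_smul_one] at h
  linear_combination (norm := module) h

theorem theta_11_10 : Cl.theta s ε c (1, 1) * Cl.theta s ε c (1, 0) =
    -(Cl.theta s ε c (1, 0) * Cl.theta s ε c (1, 1)) := by
  have hs : (s : ℂ) ≠ 0 := s.ne_zero
  have h := theta_rel_of_entries s ε c
    ![![![![0, 0], ![0, 0]], ![![0, 0], ![0, 0]]],
      ![![![0, 0], ![0, 1]], ![![0, 0], ![1, 0]]]] (by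
    intro i j k m
    simp [Fin.sum_univ_two]
    fin_cases i <;> fin_cases j <;> fin_cases k <;> fin_cases m <;> simp [fEntry] <;>
      (try simp only [q, qhat]) <;> field_simp <;> ring)
  simp [metricMatrix_eq, Algebra.algebraMap_eq_smul_one] at h
  linear_combination (norm := module) h

theorem theta_11_11 : Cl.theta s ε c (1, 1) * Cl.theta s ε c (1, 1) =
    0 := by
  have h := theta_rel_of_entries s ε c
    ![![![![0, 0], ![0, 0]], ![![0, 0], ![0, 0]]],
      ![![![0, 0], ![0, 0]], ![![0, 0], ![0, 1]]]] (by
    intro i j k m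
    simp [Fin.sum_univ_two]
    fin_cases i <;> fin_cases j <;> fin_cases k <;> fin_cases m <;> simp [fEntry])
  simp [metricMatrix_eq, Algebra.algebraMap_eq_smul_one] at h
  linear_combination (norm := module) h

end CliffordRelations

section SpinorAction

variable (s : ℂˣ) (ε : ℤˣ) (c : ℂˣ)

theorem q_ne_zero : q s ≠ 0 := pow_ne_zero 2 s.ne_zero

theorem one_add_q_sq_ne_zero {s : ℂˣ} (hq : q s ^ 2 ≠ -1) : 1 + q s ^ 2 ≠ 0 := fun h =>
  hq (by linear_combination h)

/-- The element `ψ⁺_2 = θ_21 θ_22`, which generates the left ideal `S_0`. -/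
abbrev vac : Cl s ε c := Cl.theta s ε c (1, 0) * Cl.theta s ε c (1, 1)

theorem theta_10_vac : Cl.theta s ε c (1, 0) * vac s ε c = 0 := by
  rw [← mul_assoc, theta_sq, zero_mul]

theorem theta_11_vac : Cl.theta s ε c (1, 1) * vac s ε c = 0 := by
  rw [← mul_assoc, theta_11_10, neg_mul, mul_assoc, theta_11_11, mul_zero, neg_zero]

theorem theta_00_00_vac :
    Cl.theta s ε c (0, 0) * (Cl.theta s ε c (0, 0) * vac s ε c) = 0 := by
  rw [← mul_assoc, theta_00_00, zero_mul]

theorem theta_01_00_vac : Cl.theta s ε c (0, 1) * (Cl.theta s ε c (0, 0) * vac s ε c) =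
    -(q s ^ 2) • (Cl.theta s ε c (0, 0) * (Cl.theta s ε c (0, 1) * vac s ε c)) := by
  rw [← mul_assoc, theta_01_00, sub_mul, neg_mul, smul_mul_assoc, smul_mul_assoc, mul_assoc,
    mul_assoc, theta_10_vac, mul_zero, smul_zero, sub_zero, neg_smul]

theorem theta_01_01_vac :
    Cl.theta s ε c (0, 1) * (Cl.theta s ε c (0, 1) * vac s ε c) = 0 := by
  rw [← mul_assoc, theta_01_01, neg_mul, smul_mul_assoc, mul_assoc, theta_11_vac, mul_zero,
    smul_zero, neg_zero]

theorem theta_10_00_vac :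
    Cl.theta s ε c (1, 0) * (Cl.theta s ε c (0, 0) * vac s ε c) = 0 := by
  rw [← mul_assoc, theta_10_00, neg_mul, mul_assoc, theta_10_vac, mul_zero, neg_zero]

theorem theta_10_01_vac : Cl.theta s ε c (1, 0) * (Cl.theta s ε c (0, 1) * vac s ε c) =
    ((c : ℂ) * (1 + (q s)⁻¹ ^ 2)) • vac s ε c := by
  rw [← mul_assoc, theta_10_01, sub_mul, sub_mul, smul_mul_assoc, smul_mul_assoc, one_mul,
    mul_assoc (Cl.theta s ε c (0, 0)), mul_assoc (Cl.theta s ε c (0, 1)), theta_10_vac,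
    theta_11_vac, mul_zero, mul_zero, smul_zero, sub_zero, sub_zero]

theorem theta_11_00_vac : Cl.theta s ε c (1, 1) * (Cl.theta s ε c (0, 0) * vac s ε c) =
    -((c : ℂ) * (1 + q s ^ 2)) • vac s ε c := by
  rw [← mul_assoc, theta_11_00, sub_mul, smul_mul_assoc, one_mul,
    mul_assoc (Cl.theta s ε c (0, 0)), theta_11_vac, mul_zero, sub_zero]

theorem theta_11_01_vac :
    Cl.theta s ε c (1, 1) * (Cl.theta s ε c (0, 1) * vac s ε c) = 0 := by
  rw [← mul_assoc, theta_11_01, sub_mul, neg_mul, smul_mul_assoc, smul_mul_assoc,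
    mul_assoc (Cl.theta s ε c (0, 1)), mul_assoc (Cl.theta s ε c (1, 0)), theta_11_vac, mul_zero,
    mul_zero, smul_zero, smul_zero, neg_zero, sub_zero]

theorem theta_00_00_01_vac : Cl.theta s ε c (0, 0) *
    (Cl.theta s ε c (0, 0) * (Cl.theta s ε c (0, 1) * vac s ε c)) = 0 := by
  rw [← mul_assoc, theta_00_00, zero_mul]

theorem theta_01_00_01_vac : Cl.theta s ε c (0, 1) *
    (Cl.theta s ε c (0, 0) * (Cl.theta s ε c (0, 1) * vac s ε c)) =
      -((c : ℂ) * (1 + (q s)⁻¹ ^ 2) * qhat s) • (Cl.theta s ε c (0, 0) * vac s ε c) := by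
  rw [← mul_assoc, theta_01_00, sub_mul, neg_mul, smul_mul_assoc, smul_mul_assoc,
    mul_assoc (Cl.theta s ε c (0, 0)), mul_assoc (Cl.theta s ε c (0, 0)), theta_01_01_vac,
    theta_10_01_vac, mul_zero, smul_zero, mul_smul_comm, smul_smul]
  module

theorem theta_10_00_01_vac : Cl.theta s ε c (1, 0) *
    (Cl.theta s ε c (0, 0) * (Cl.theta s ε c (0, 1) * vac s ε c)) =
      -((c : ℂ) * (1 + (q s)⁻¹ ^ 2)) • (Cl.theta s ε c (0, 0) * vac s ε c) := by
  rw [← mul_assoc, theta_10_00, neg_mul, mul_assoc, theta_10_01_vac, mul_smul_comm, neg_smul]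

theorem theta_11_00_01_vac : Cl.theta s ε c (1, 1) *
    (Cl.theta s ε c (0, 0) * (Cl.theta s ε c (0, 1) * vac s ε c)) =
      -((c : ℂ) * (1 + q s ^ 2)) • (Cl.theta s ε c (0, 1) * vac s ε c) := by
  rw [← mul_assoc, theta_11_00, sub_mul, smul_mul_assoc, one_mul,
    mul_assoc (Cl.theta s ε c (0, 0)), theta_11_01_vac, mul_zero, sub_zero]

theorem psiPlus_zero : psiPlus s ε c 0 = (q s ^ 2 / ((1 + q s ^ 2) * c)) •
    (Cl.theta s ε c (0, 0) * (Cl.theta s ε c (0, 1) * vac s ε c)) := by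
  have hq := q_ne_zero s
  have h : q s / (qtwo s * c) = q s ^ 2 / ((1 + q s ^ 2) * c) := by
    rw [show 1 + q s ^ 2 = q s * qtwo s by simp only [qtwo]; field_simp; ring]
    field_simp
  rw [← h]
  simp [psiPlus, mul_assoc]

theorem psiPlus_one : psiPlus s ε c 1 = vac s ε c := rfl

theorem psiMinus_zero : psiMinus s ε c 0 = Cl.theta s ε c (0, 0) * vac s ε c := by
  simp [psiMinus, mul_assoc]

theorem psiMinus_one : psiMinus s ε c 1 = q s • (Cl.theta s ε c (0, 1) * vac s ε c) := by
  simp [psiMinus, mul_assoc]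

/-- The coefficients of `θ_{ab} ψ⁺_i = ∑ spinPlus a b i k ψ⁻_k`. -/
def spinPlus (a b i k : Fin 2) : ℂ := -∑ m, Rhat s (k, m) (a, b) * Chat s m i

/-- The coefficients of `θ_{ab} ψ⁻_i = ∑ spinMinus a b i k ψ⁺_k`. -/
def spinMinus (a b i k : Fin 2) : ℂ :=
  if k = a then -((c : ℂ) * (1 + (q s)⁻¹ ^ 2) * (s : ℂ) ^ 3 * Chat s b i) else 0

variable {s}

theorem theta_mul_psiPlus (hq : q s ^ 2 ≠ -1) (a b i : Fin 2) :
    Cl.theta s ε c (a, b) * psiPlus s ε c i = ∑ k, spinPlus s a b i k • psiMinus s ε c k := by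
  have hs : (s : ℂ) ≠ 0 := s.ne_zero
  have hc : (c : ℂ) ≠ 0 := c.ne_zero
  have h1 : 1 + (s : ℂ) ^ 4 ≠ 0 := by
    simpa only [q, ← pow_mul] using one_add_q_sq_ne_zero hq
  rw [Fin.sum_univ_two, psiMinus_zero, psiMinus_one]
  fin_cases i
  · simp only [Fin.zero_eta, psiPlus_zero, mul_smul_comm]
    fin_cases a <;> fin_cases b <;>
      simp [theta_00_00_01_vac, theta_01_00_01_vac, theta_10_00_01_vac, theta_11_00_01_vac,
        spinPlus, Rhat, Chat, Ccheck, smul_smul, -neg_smul] <;>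
      (match_scalars <;> simp only [q, qhat, ← pow_mul, Nat.reduceMul] <;> field_simp <;> try ring)
  · simp only [Fin.mk_one, psiPlus_one]
    fin_cases a <;> fin_cases b <;>
      simp [theta_10_vac, theta_11_vac, spinPlus, Rhat, Chat, Ccheck, smul_smul] <;>
      (match_scalars <;> simp only [q, qhat, ← pow_mul, Nat.reduceMul] <;> field_simp <;> try ring)

theorem theta_mul_psiMinus (hq : q s ^ 2 ≠ -1) (a b i : Fin 2) :
    Cl.theta s ε c (a, b) * psiMinus s ε c i = ∑ k, spinMinus s c a b i k • psiPlus s ε c k := by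
  have hs : (s : ℂ) ≠ 0 := s.ne_zero
  have hc : (c : ℂ) ≠ 0 := c.ne_zero
  have h1 : 1 + (s : ℂ) ^ 4 ≠ 0 := by
    simpa only [q, ← pow_mul] using one_add_q_sq_ne_zero hq
  rw [Fin.sum_univ_two, psiPlus_zero, psiPlus_one]
  fin_cases i
  · simp only [Fin.zero_eta, psiMinus_zero]
    fin_cases a <;> fin_cases b <;>
      simp [theta_00_00_vac, theta_01_00_vac, theta_10_00_vac, theta_11_00_vac,
        spinMinus, Chat, Ccheck, smul_smul, -neg_smul] <;>
      (match_scalars <;> simp only [q, qhat, ← pow_mul, Nat.reduceMul] <;> field_simp <;> try ring)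
  · simp only [Fin.mk_one, psiMinus_one, mul_smul_comm]
    fin_cases a <;> fin_cases b <;>
      simp [theta_01_01_vac, theta_10_01_vac, theta_11_01_vac,
        spinMinus, Chat, Ccheck, smul_smul, -neg_smul] <;>
      (match_scalars <;> simp only [q, qhat, ← pow_mul, Nat.reduceMul] <;> field_simp <;> try ring)

end SpinorAction

section Intertwiners

variable (s : ℂˣ) (c : ℂˣ)

theorem spinMinus_intertwines (a b i k : Fin 2) :
    ∑ a', ∑ b', ∑ j, spinMinus s c a' b' j k • (u s a' a * (u s b' b * u s j i)) =
      ∑ k', spinMinus s c a b i k' • u s k k' := by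
  calc ∑ a', ∑ b', ∑ j, spinMinus s c a' b' j k • (u s a' a * (u s b' b * u s j i))
      = -((c : ℂ) * (1 + (q s)⁻¹ ^ 2) * (s : ℂ) ^ 3) •
          (u s k a * ∑ b', ∑ j, Chat s b' j • (u s b' b * u s j i)) := by
        simp only [spinMinus, ite_smul, zero_smul]
        rw [Finset.sum_eq_single k (fun a' _ h => by simp [h.symm]) (by simp)]
        simp only [if_true, Finset.mul_sum, Finset.smul_sum, mul_smul_comm, smul_smul, neg_mul]
    _ = _ := by
        rw [chat_u]
        simp [spinMinus, smul_smul]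

theorem spinPlus_intertwines (a b i k : Fin 2) :
    ∑ a', ∑ b', ∑ j, spinPlus s a' b' j k • (u s a' a * (u s b' b * u s j i)) =
      ∑ k', spinPlus s a b i k' • u s k k' := by
  calc ∑ a', ∑ b', ∑ j, spinPlus s a' b' j k • (u s a' a * (u s b' b * u s j i))
      = -∑ m, ∑ j, Chat s m j •
          ((∑ a', ∑ b', Rhat s (k, m) (a', b') • (u s a' a * u s b' b)) * u s j i) := by
        simp only [spinPlus, Fin.sum_univ_two, add_mul, smul_mul_assoc, mul_assoc]
        module
    _ = -∑ x, ∑ y, Rhat s (x, y) (a, b) •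
          (u s k x * ∑ m, ∑ j, Chat s m j • (u s m y * u s j i)) := by
        simp only [(u_isQuantumMatrix s).rtt]
        simp only [Fin.sum_univ_two, add_mul, mul_add, smul_mul_assoc, mul_smul_comm, mul_assoc]
        module
    _ = _ := by
        simp only [chat_u, mul_smul_comm, mul_one]
        simp only [spinPlus, Fin.sum_univ_two]
        module

end Intertwiners

section SpinorOperators

/-- In a representation of the `θ_{ab}` on spinors `P_i`, `Q_i`, the product `θ_21 θ_22` maps
`P_1` to a multiple of `P_2`. -/
theorem spinor_ops {N : Type*} [AddCommGroup N] [Module ℂ N] {s : ℂˣ} (hq : q s ^ 2 ≠ -1) (c : ℂˣ)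
    (t : Fin 2 → Fin 2 → N →ₗ[ℂ] N) (P Q : Fin 2 → N)
    (hP : ∀ a b i, t a b (P i) = ∑ k, spinPlus s a b i k • Q k)
    (hQ : ∀ a b i, t a b (Q i) = ∑ k, spinMinus s c a b i k • P k) :
    t 1 0 (t 1 1 (P 0)) = -((c : ℂ) * (1 + q s ^ 2)) • P 1 ∧
    t 0 0 (P 1) = Q 0 ∧ q s • t 0 1 (P 1) = Q 1 ∧
    (q s ^ 2 / ((1 + q s ^ 2) * c)) • t 0 0 (t 0 1 (P 1)) = P 0 := by
  have hs : (s : ℂ) ≠ 0 := s.ne_zero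
  have hc : (c : ℂ) ≠ 0 := c.ne_zero
  have h1 : 1 + (s : ℂ) ^ 4 ≠ 0 := by
    simpa only [q, ← pow_mul] using one_add_q_sq_ne_zero hq
  refine ⟨?_, ?_, ?_, ?_⟩ <;>
    simp [hP, hQ, spinPlus, spinMinus, Rhat, Chat, Ccheck, smul_smul, -neg_smul] <;>
    match_scalars <;> simp only [q, ← pow_mul, Nat.reduceMul] <;> field_simp <;> try ring

end SpinorOperators

section TensorAction

variable (s : ℂˣ) (ε : ℤˣ) (c : ℂˣ)

/-- The left action of `Cl(Γ, σ, g) ⊗ A` on `S_0 ⊗ Ã`. -/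
abbrev tensorAct : Cl s ε c ⊗[ℂ] OSL s →ₗ[ℂ]
    S0 s ε c ⊗[ℂ] Atilde s →ₗ[ℂ] S0 s ε c ⊗[ℂ] Atilde s :=
  TensorProduct.map₂ (S0.leftAct s ε c) (Atilde.leftAct s)

theorem tensorAct_tmul (v : Cl s ε c) (a : OSL s) (x : S0 s ε c) (w : Atilde s) :
    tensorAct s ε c (v ⊗ₜ a) (x ⊗ₜ w) = (v • x) ⊗ₜ (Atilde.incl s a * w) := rfl

theorem tensorAct_mul (y z : Cl s ε c ⊗[ℂ] OSL s) (m : S0 s ε c ⊗[ℂ] Atilde s) :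
    tensorAct s ε c (y * z) m = tensorAct s ε c y (tensorAct s ε c z m) := by
  induction m using TensorProduct.induction_on with
  | zero => simp
  | add m m' h h' => simp only [map_add, h, h']
  | tmul x w =>
    induction z using TensorProduct.induction_on with
    | zero => simp
    | add z z' h h' => simp only [mul_add, map_add, LinearMap.add_apply, h, h']
    | tmul v' a' =>
      induction y using TensorProduct.induction_on with
      | zero => simp
      | add z z' h h' => simp only [add_mul, map_add, LinearMap.add_apply, h, h']
      | tmul v a =>
        rw [Algebra.TensorProduct.tmul_mul_tmul, tensorAct_tmul, tensorAct_tmul, tensorAct_tmul,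
          mul_smul, map_mul, mul_assoc]

/-- The elements `Ψ_i = ψ_j ⊗ u^j_i χ`. -/
def spinorTensor {M : Type*} [AddCommGroup M] [Module ℂ M] (e : Fin 2 → M) (i : Fin 2) :
    M ⊗[ℂ] Atilde s :=
  ∑ j, e j ⊗ₜ[ℂ] (Atilde.incl s (u s j i) * Atilde.chi s)

theorem tensorAct_theta_spinorTensor (e e' : Fin 2 → S0 s ε c)
    (G : Fin 2 → Fin 2 → Fin 2 → Fin 2 → ℂ)
    (hG : ∀ a b i, Cl.theta s ε c (a, b) • e i = ∑ k, G a b i k • e' k)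
    (hu : ∀ a b i k, ∑ a', ∑ b', ∑ j, G a' b' j k • (u s a' a * (u s b' b * u s j i)) =
      ∑ k', G a b i k' • u s k k') (a b i : Fin 2) :
    tensorAct s ε c (Cl.rightCoaction s ε c (Cl.theta s ε c (a, b))) (spinorTensor s e i) =
      ∑ k, G a b i k • spinorTensor s e' k := by
  calc _ = ∑ a', ∑ b', ∑ j, ∑ k, e' k ⊗ₜ[ℂ] (Atilde.incl s
            (G a' b' j k • (u s a' a * (u s b' b * u s j i))) * Atilde.chi s) := by
        simp only [Cl.rightCoaction_theta, spinorTensor, map_sum, LinearMap.sum_apply,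
          tensorAct_tmul, Fintype.sum_prod_type, hG, TensorProduct.sum_tmul, map_smul, map_mul,
          smul_mul_assoc, TensorProduct.tmul_smul, TensorProduct.smul_tmul', mul_assoc]
        exact Finset.sum_comm_cycle.symm
    _ = ∑ k, e' k ⊗ₜ[ℂ] (Atilde.incl s (∑ a', ∑ b', ∑ j,
            G a' b' j k • (u s a' a * (u s b' b * u s j i))) * Atilde.chi s) := by
        simp only [map_sum, Finset.sum_mul, TensorProduct.tmul_sum]
        exact (Finset.sum_congr rfl fun x _ => Finset.sum_congr rfl fun y _ =>
          Finset.sum_comm).trans Finset.sum_comm_cycle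
    _ = _ := by
        simp only [hu, map_sum, Finset.sum_mul, TensorProduct.tmul_sum, spinorTensor,
          Finset.smul_sum, map_smul, smul_mul_assoc, TensorProduct.tmul_smul]
        exact Finset.sum_comm

end TensorAction

section Spanning

variable {s : ℂˣ} (ε : ℤˣ) (c : ℂˣ)

/-- `ψ^±_i` as elements of `S_0`. -/
def spinor (s : ℂˣ) (ε : ℤˣ) (c : ℂˣ) (r : Bool) (i : Fin 2) : S0.inv s ε c :=
  bif r then S0.psiPlus s ε c i else S0.psiMinus s ε c i

/-- The coefficients of `θ_{ab} ψ^±_i = ∑ spinCoeff a b i k ψ^∓_k`. -/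
def spinCoeff (s : ℂˣ) (c : ℂˣ) (r : Bool) (a b i k : Fin 2) : ℂ :=
  bif r then spinPlus s a b i k else spinMinus s c a b i k

theorem theta_smul_spinor (hq : q s ^ 2 ≠ -1) (r : Bool) (a b i : Fin 2) :
    Cl.theta s ε c (a, b) • (spinor s ε c r i : S0 s ε c) =
      ∑ k, spinCoeff s c r a b i k • (spinor s ε c (!r) k : S0 s ε c) := by
  apply Subtype.ext
  cases r
  · simpa [spinor, spinCoeff, S0.psiPlus, S0.psiMinus] using theta_mul_psiMinus ε c hq a b i
  · simpa [spinor, spinCoeff, S0.psiPlus, S0.psiMinus] using theta_mul_psiPlus ε c hq a b i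

theorem Cl.adjoin_eq_top (s : ℂˣ) (ε : ℤˣ) (c : ℂˣ) :
    Algebra.adjoin ℂ (Set.range (Cl.ofAlg s ε c) ∪ Set.range (Cl.theta s ε c)) = ⊤ := by
  set S := Algebra.adjoin ℂ (Set.range (Cl.ofAlg s ε c) ∪ Set.range (Cl.theta s ε c))
  rw [eq_top_iff]
  intro x _
  set π := (Clifford.mk (braiding s ε) (metric s ε c)).comp
    (BiTensorAlgebra.mk (OSL s) (Gam s ε)) with hπ
  obtain ⟨z, rfl⟩ : ∃ z, π z = x := by
    obtain ⟨y, hy⟩ := RingQuot.mkAlgHom_surjective ℂ (CliffordRel (braiding s ε) (metric s ε c)) x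
    obtain ⟨z, hz⟩ := RingQuot.mkAlgHom_surjective ℂ (TensorRel (OSL s) (Gam s ε)) y
    exact ⟨z, (congrArg (Clifford.mk (braiding s ε) (metric s ε c)) hz).trans hy⟩
  induction z using TensorAlgebra.induction with
  | algebraMap r =>
    rw [AlgHom.commutes]
    exact S.algebraMap_mem r
  | mul y z hy hz =>
    rw [map_mul]
    exact S.mul_mem (hy trivial) (hz trivial)
  | add y z hy hz =>
    rw [map_add]
    exact S.add_mem (hy trivial) (hz trivial)
  | ι x =>
    have h : x = (x.1, 0) + (0, x.2) := by simp
    rw [h, map_add, map_add]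
    refine S.add_mem (Algebra.subset_adjoin (Or.inl ⟨x.1, rfl⟩)) ?_
    change Clifford.ofMod (braiding s ε) (metric s ε c) x.2 ∈ S
    rw [← Gam.sum_smul_theta x.2, map_sum]
    refine sum_mem fun i _ => ?_
    rw [Clifford.ofMod_left]
    exact S.mul_mem (Algebra.subset_adjoin (Or.inl ⟨_, rfl⟩))
      (Algebra.subset_adjoin (Or.inr ⟨i, rfl⟩))

/-- `S_0` is the left `A`-span of the `ψ^±_i`. -/
theorem span_smul_spinor (hq : q s ^ 2 ≠ -1) :
    Submodule.span ℂ (Set.range fun p : OSL s × Bool × Fin 2 =>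
      Cl.ofAlg s ε c p.1 • (spinor s ε c p.2.1 p.2.2 : S0 s ε c)) = ⊤ := by
  set W := Submodule.span ℂ (Set.range fun p : OSL s × Bool × Fin 2 =>
    Cl.ofAlg s ε c p.1 • (spinor s ε c p.2.1 p.2.2 : S0 s ε c)) with hW
  have hgen : ∀ a r i, Cl.ofAlg s ε c a • (spinor s ε c r i : S0 s ε c) ∈ W := fun a r i =>
    Submodule.subset_span ⟨(a, r, i), rfl⟩
  have hmul : ∀ v : Cl s ε c, (∀ a r i,
      v • Cl.ofAlg s ε c a • (spinor s ε c r i : S0 s ε c) ∈ W) → ∀ x ∈ W, v • x ∈ W := by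
    intro v hv x hx
    have : W ≤ W.comap (S0.leftAct s ε c v) := by
      conv_lhs => rw [hW]
      refine Submodule.span_le.mpr ?_
      rintro _ ⟨⟨a, r, i⟩, rfl⟩
      exact hv a r i
    exact this hx
  have hact : ∀ v : Cl s ε c, ∀ x ∈ W, v • x ∈ W := by
    intro v
    have hv : v ∈ Algebra.adjoin ℂ (Set.range (Cl.ofAlg s ε c) ∪ Set.range (Cl.theta s ε c)) :=
      Cl.adjoin_eq_top s ε c ▸ Algebra.mem_top
    induction hv using Algebra.adjoin_induction with
    | mem v hv =>
      rcases hv with ⟨b, rfl⟩ | ⟨⟨k, l⟩, rfl⟩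
      · refine hmul _ fun a r i => ?_
        rw [smul_smul, ← map_mul]
        exact hgen _ r i
      · refine hmul _ fun a r i => ?_
        rw [smul_smul, Cl.theta_mul_ofAlg, Finset.sum_smul]
        refine sum_mem fun j _ => ?_
        rw [mul_smul, theta_smul_spinor ε c hq, Finset.smul_sum]
        refine sum_mem fun m _ => ?_
        rw [smul_comm]
        exact W.smul_mem _ (hgen _ _ _)
    | algebraMap z =>
      intro x hx
      rw [algebraMap_smul]
      exact W.smul_mem z hx
    | add v v' _ _ h h' =>
      intro x hx
      rw [add_smul]
      exact W.add_mem (h x hx) (h' x hx)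
    | mul v v' _ _ h h' =>
      intro x hx
      rw [mul_smul]
      exact h _ (h' x hx)
  rw [eq_top_iff]
  rintro ⟨x, hx⟩ -
  have hx' := hx
  rw [S0_eq_span] at hx'
  obtain ⟨v, rfl⟩ := Submodule.mem_span_singleton.mp hx'
  have h1 := hact v _ (hgen 1 true 1)
  rw [map_one, one_smul] at h1
  exact h1

/-- The left-invariant elements of `S_0` are the linear combinations of the `ψ^±_i`. -/
theorem span_spinor (hq : q s ^ 2 ≠ -1) :
    Submodule.span ℂ (Set.range fun p : Bool × Fin 2 => spinor s ε c p.1 p.2) = ⊤ := by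
  set V := Submodule.span ℂ (Set.range fun p : Bool × Fin 2 => (spinor s ε c p.1 p.2 : Cl s ε c))
    with hV
  set Φ : OSL s ⊗[ℂ] Cl s ε c →ₗ[ℂ] Cl s ε c := TensorProduct.lift
    ((LinearMap.mul ℂ (Cl s ε c)) ∘ₗ (Cl.ofAlg s ε c).toLinearMap ∘ₗ
      HopfAlgebra.antipode ℂ (A := OSL s)) with hΦ
  have hΦ1 : ∀ a, Φ (Algebra.TensorProduct.map (AlgHom.id ℂ (OSL s)) (Cl.ofAlg s ε c)
      (Coalgebra.comul (R := ℂ) a)) = algebraMap ℂ _ (Coalgebra.counit (R := ℂ) a) := by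
    intro a
    have h := congrArg (Cl.ofAlg s ε c) (HopfAlgebra.mul_antipode_rTensor_comul_apply (R := ℂ) a)
    rw [AlgHom.commutes] at h
    rw [← h]
    generalize Coalgebra.comul (R := ℂ) a = z
    induction z using TensorProduct.induction_on with
    | zero => simp
    | add x y hx hy => simp only [map_add, hx, hy]
    | tmul x y => simp [hΦ]
  have hΦ2 : ∀ (z : OSL s ⊗[ℂ] Cl s ε c) (x : Cl s ε c), Φ (z * 1 ⊗ₜ x) = Φ z * x := by
    intro z x
    induction z using TensorProduct.induction_on with
    | zero => simp
    | add y z hy hz => simp only [add_mul, map_add, hy, hz]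
    | tmul y z => simp [hΦ, mul_assoc]
  have hmem : ∀ x : S0 s ε c, Φ (Cl.leftCoaction s ε c x) ∈ V := by
    have : (⊤ : Submodule ℂ (S0 s ε c)) ≤ V.comap (Φ ∘ₗ (Cl.leftCoaction s ε c).toLinearMap ∘ₗ
        (S0 s ε c).subtype.restrictScalars ℂ) := by
      rw [← span_smul_spinor ε c hq]
      refine Submodule.span_le.mpr ?_
      rintro _ ⟨⟨a, r, i⟩, rfl⟩
      change Φ (Cl.leftCoaction s ε c (Cl.ofAlg s ε c a * (spinor s ε c r i : S0 s ε c))) ∈ V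
      rw [map_mul, (S0.mem_inv s ε c _).mp (spinor s ε c r i).2, hΦ2, Cl.leftCoaction_ofAlg, hΦ1,
        ← Algebra.smul_def]
      exact V.smul_mem _ (Submodule.subset_span ⟨(r, i), rfl⟩)
    exact fun x => this (x := x) trivial
  rw [eq_top_iff]
  rintro x -
  have hx := hmem x
  rw [(S0.mem_inv s ε c _).mp x.2] at hx
  have h1 : Φ (1 ⊗ₜ ((x : S0 s ε c) : Cl s ε c)) = ((x : S0 s ε c) : Cl s ε c) := by
    simp [hΦ]
  rw [h1] at hx
  set j : S0.inv s ε c →ₗ[ℂ] Cl s ε c :=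
    (S0 s ε c).subtype.restrictScalars ℂ ∘ₗ (S0.inv s ε c).subtype with hj
  have hinj : Function.Injective j := Subtype.val_injective.comp Subtype.val_injective
  have hmap : V = (Submodule.span ℂ (Set.range fun p : Bool × Fin 2 =>
      spinor s ε c p.1 p.2)).map j := by
    rw [Submodule.map_span, ← Set.range_comp]
    rfl
  rw [hmap] at hx
  obtain ⟨y, hy, hyx⟩ := hx
  exact hinj hyx ▸ hy

end Spanning

section SpinorCoaction

variable {s : ℂˣ}

theorem spinorTensor_coassoc {M : Type*} [AddCommGroup M] [Module ℂ M] (e : Fin 2 → M)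
    (D : M →ₗ[ℂ] M ⊗[ℂ] Atilde s) (hD : ∀ i, D (e i) = spinorTensor s e i) (i : Fin 2) :
    TensorProduct.assoc ℂ M (Atilde s) (Atilde s) (D.rTensor (Atilde s) (D (e i))) =
      (Coalgebra.comul (R := ℂ) (A := Atilde s)).lTensor M (D (e i)) := by
  simp only [hD, spinorTensor, map_sum, LinearMap.rTensor_tmul, LinearMap.lTensor_tmul,
    Bialgebra.comul_mul, Atilde.comul_incl, OSL.comul_u, Atilde.chi, Atilde.comul_chiPow,
    Algebra.TensorProduct.map_tmul, Finset.sum_mul, Algebra.TensorProduct.tmul_mul_tmul,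
    TensorProduct.sum_tmul, TensorProduct.tmul_sum, TensorProduct.assoc_tmul]
  exact Finset.sum_comm

theorem spinorTensor_counit {M : Type*} [AddCommGroup M] [Module ℂ M] (e : Fin 2 → M)
    (i : Fin 2) : TensorProduct.rid ℂ M
      ((Coalgebra.counit (R := ℂ) (A := Atilde s)).lTensor M (spinorTensor s e i)) = e i := by
  fin_cases i <;> simp [spinorTensor, Atilde.counit_incl, Atilde.chi, Atilde.counit_chiPow]

theorem comul_incl_u (k l : Fin 2) : Coalgebra.comul (R := ℂ) (Atilde.incl s (u s k l)) =
    ∑ m, Atilde.incl s (u s k m) ⊗ₜ[ℂ] Atilde.incl s (u s m l) := by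
  simp [Atilde.comul_incl]

section LeftCovariant

variable {M : Type*} [AddCommGroup M] [Module ℂ M] (D : M →ₗ[ℂ] M ⊗[ℂ] Atilde s)
  (L : Fin 2 → Fin 2 → M →ₗ[ℂ] M)

/-- Left multiplication by `u^k_l` preserves the coassociativity of a coaction. -/
theorem coassoc_left_u (hD : ∀ k l x, D (L k l x) =
      ∑ m, TensorProduct.map (L k m) (Atilde.leftAct s (u s m l)) (D x))
    (k l : Fin 2) (x : M)
    (h : TensorProduct.assoc ℂ _ _ _ (D.rTensor (Atilde s) (D x)) =
      (Coalgebra.comul (R := ℂ) (A := Atilde s)).lTensor _ (D x)) :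
    TensorProduct.assoc ℂ _ _ _ (D.rTensor (Atilde s) (D (L k l x))) =
      (Coalgebra.comul (R := ℂ) (A := Atilde s)).lTensor _ (D (L k l x)) := by
  set A₃ : Fin 2 → Fin 2 → M ⊗[ℂ] (Atilde s ⊗[ℂ] Atilde s) →ₗ[ℂ]
      M ⊗[ℂ] (Atilde s ⊗[ℂ] Atilde s) := fun n m =>
    TensorProduct.map (L k n)
      (TensorProduct.map (Atilde.leftAct s (u s n m)) (Atilde.leftAct s (u s m l))) with hA₃
  have h1 : ∀ z : M ⊗[ℂ] Atilde s, TensorProduct.assoc ℂ _ _ _ (D.rTensor (Atilde s)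
      (∑ m, TensorProduct.map (L k m) (Atilde.leftAct s (u s m l)) z)) =
      ∑ m, ∑ n, A₃ n m (TensorProduct.assoc ℂ _ _ _ (D.rTensor (Atilde s) z)) := by
    intro z
    induction z using TensorProduct.induction_on with
    | zero => simp
    | add z z' hz hz' => simp only [map_add, Finset.sum_add_distrib, hz, hz']
    | tmul y w =>
      simp only [map_sum, TensorProduct.map_tmul, LinearMap.rTensor_tmul]
      refine Finset.sum_congr rfl fun m _ => ?_
      rw [hD]
      generalize D y = t
      induction t using TensorProduct.induction_on with
      | zero => simp
      | add t t' ht ht' =>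
        simp only [map_add, TensorProduct.add_tmul, Finset.sum_add_distrib] at ht ht' ⊢
        rw [ht, ht']
      | tmul x' w' => simp [TensorProduct.add_tmul, hA₃]
  have h2 : ∀ z : M ⊗[ℂ] Atilde s, (Coalgebra.comul (R := ℂ) (A := Atilde s)).lTensor _
      (∑ m, TensorProduct.map (L k m) (Atilde.leftAct s (u s m l)) z) =
      ∑ m, ∑ n, A₃ n m ((Coalgebra.comul (R := ℂ) (A := Atilde s)).lTensor _ z) := by
    intro z
    induction z using TensorProduct.induction_on with
    | zero => simp
    | add z z' hz hz' => simp only [map_add, Finset.sum_add_distrib, hz, hz']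
    | tmul y w =>
      rw [Finset.sum_comm]
      simp only [map_sum, TensorProduct.map_tmul, LinearMap.lTensor_tmul]
      refine Finset.sum_congr rfl fun m _ => ?_
      change _ ⊗ₜ Coalgebra.comul (R := ℂ) (Atilde.incl s (u s m l) * w) = _
      rw [Bialgebra.comul_mul, comul_incl_u]
      generalize Coalgebra.comul (R := ℂ) w = t
      induction t using TensorProduct.induction_on with
      | zero => simp
      | add t t' ht ht' =>
        simp only [map_add, mul_add, TensorProduct.tmul_add, Finset.sum_add_distrib] at ht ht' ⊢
        rw [ht, ht']
      | tmul x' w' =>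
        simp only [Finset.sum_mul, Algebra.TensorProduct.tmul_mul_tmul, TensorProduct.tmul_sum,
          hA₃, TensorProduct.map_tmul]
        rfl
  rw [hD, h1, h2, h]

/-- Left multiplication by `u^k_l` preserves the counitality of a coaction. -/
theorem counit_left_u (hD : ∀ k l x, D (L k l x) =
      ∑ m, TensorProduct.map (L k m) (Atilde.leftAct s (u s m l)) (D x))
    (k l : Fin 2) (x : M)
    (h : TensorProduct.rid ℂ _ ((Coalgebra.counit (R := ℂ) (A := Atilde s)).lTensor _ (D x)) = x) :
    TensorProduct.rid ℂ _ ((Coalgebra.counit (R := ℂ) (A := Atilde s)).lTensor _ (D (L k l x))) =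
      L k l x := by
  conv_rhs => rw [← h]
  rw [hD]
  generalize D x = z
  induction z using TensorProduct.induction_on with
  | zero => simp
  | add z z' hz hz' => simp only [map_add, Finset.sum_add_distrib, hz, hz']
  | tmul y w =>
    have h3 : ∀ m l, Coalgebra.counit (R := ℂ) (Atilde.leftAct s (u s m l) w) =
        (if m = l then 1 else 0) * Coalgebra.counit (R := ℂ) w := fun m l => by
      change Coalgebra.counit (R := ℂ) (Atilde.incl s (u s m l) * w) = _
      rw [Bialgebra.counit_mul, Atilde.counit_incl, OSL.counit_u]
    fin_cases l <;> simp [h3]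

theorem isRightCoaction_of_left (D : M →ₗ[ℂ] M ⊗[ℂ] Atilde s) (L : OSL s →ₐ[ℂ] Module.End ℂ M)
    (hD : ∀ k l x, D (L (u s k l) x) =
      ∑ m, TensorProduct.map (L (u s k m)) (Atilde.leftAct s (u s m l)) (D x))
    {ι : Type*} (e : ι → M)
    (he : Submodule.span ℂ (Set.range fun p : OSL s × ι => L p.1 (e p.2)) = ⊤)
    (hcoassoc : ∀ i, TensorProduct.assoc ℂ _ _ _ (D.rTensor (Atilde s) (D (e i))) =
      (Coalgebra.comul (R := ℂ) (A := Atilde s)).lTensor _ (D (e i)))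
    (hcounit : ∀ i, TensorProduct.rid ℂ _
      ((Coalgebra.counit (R := ℂ) (A := Atilde s)).lTensor _ (D (e i))) = e i) :
    IsRightCoaction D := by
  have key : ∀ W : Submodule ℂ M, (∀ i, e i ∈ W) → (∀ k l, ∀ x ∈ W, L (u s k l) x ∈ W) →
      ∀ x, x ∈ W := by
    intro W h1 h2 x
    have h5 : ∀ a, ∀ x ∈ W, L a x ∈ W := by
      intro a
      have ha : a ∈ Algebra.adjoin ℂ {x | ∃ i j, x = u s i j} := OSL.adjoin_u s ▸ Algebra.mem_top
      induction ha using Algebra.adjoin_induction with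
      | mem y hy => obtain ⟨k, l, rfl⟩ := hy; exact h2 k l
      | algebraMap z =>
        intro x hx
        rw [AlgHom.commutes]
        exact W.smul_mem z hx
      | add y z _ _ hy hz =>
        intro x hx
        rw [map_add]
        exact W.add_mem (hy x hx) (hz x hx)
      | mul y z _ _ hy hz =>
        intro x hx
        rw [map_mul]
        exact hy _ (hz x hx)
    have h6 : (⊤ : Submodule ℂ M) ≤ W := by
      rw [← he]
      refine Submodule.span_le.mpr ?_
      rintro _ ⟨⟨a, i⟩, rfl⟩
      exact h5 a _ (h1 i)
    exact h6 trivial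
  constructor
  · exact key (LinearMap.eqLocus
      ((TensorProduct.assoc ℂ M (Atilde s) (Atilde s)).toLinearMap ∘ₗ D.rTensor (Atilde s) ∘ₗ D)
      ((Coalgebra.comul (R := ℂ) (A := Atilde s)).lTensor M ∘ₗ D)) hcoassoc
      (coassoc_left_u D (fun k l => L (u s k l)) hD)
  · exact key (LinearMap.eqLocus ((TensorProduct.rid ℂ M).toLinearMap ∘ₗ
      (Coalgebra.counit (R := ℂ) (A := Atilde s)).lTensor M ∘ₗ D) LinearMap.id) hcounit
      (counit_left_u D (fun k l => L (u s k l)) hD)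

end LeftCovariant

variable (s) (ε : ℤˣ) (c : ℂˣ)

/-- The right coaction of `Ã` on `S_0`, as the action on `ψ⁺_j ⊗ u^j_1 χ` by the right coaction of
`A` on `Cl(Γ, σ, g)`. -/
def spinorCoaction : S0 s ε c →ₗ[ℂ] S0 s ε c ⊗[ℂ] Atilde s :=
  (-((c : ℂ) * (1 + q s ^ 2)))⁻¹ •
    ((tensorAct s ε c).flip (spinorTensor s (fun i => (spinor s ε c true i : S0 s ε c)) 0) ∘ₗ
      (Cl.rightCoaction s ε c).toLinearMap ∘ₗ (S0 s ε c).subtype.restrictScalars ℂ)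

theorem spinorCoaction_apply (x : S0 s ε c) : spinorCoaction s ε c x =
    (-((c : ℂ) * (1 + q s ^ 2)))⁻¹ • tensorAct s ε c (Cl.rightCoaction s ε c x)
      (spinorTensor s (fun i => (spinor s ε c true i : S0 s ε c)) 0) := rfl

theorem spinorCoaction_smul (v : Cl s ε c) (x : S0 s ε c) : spinorCoaction s ε c (v • x) =
    tensorAct s ε c (Cl.rightCoaction s ε c v) (spinorCoaction s ε c x) := by
  rw [spinorCoaction_apply, spinorCoaction_apply, Submodule.coe_smul, smul_eq_mul, map_mul,
    tensorAct_mul, map_smul]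

variable {s}

theorem tensorAct_theta_spinor (hq : q s ^ 2 ≠ -1) (r : Bool) (a b i : Fin 2) :
    tensorAct s ε c (Cl.rightCoaction s ε c (Cl.theta s ε c (a, b)))
      (spinorTensor s (fun j => (spinor s ε c r j : S0 s ε c)) i) =
    ∑ k, spinCoeff s c r a b i k •
      spinorTensor s (fun j => (spinor s ε c (!r) j : S0 s ε c)) k := by
  refine tensorAct_theta_spinorTensor s ε c _ _ (spinCoeff s c r)
    (theta_smul_spinor ε c hq r) (fun a b i k => ?_) a b i
  cases r
  · exact spinMinus_intertwines s c a b i k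
  · exact spinPlus_intertwines s a b i k

theorem spinorCoaction_spinor (hq : q s ^ 2 ≠ -1) (r : Bool) (i : Fin 2) :
    spinorCoaction s ε c (spinor s ε c r i) =
      spinorTensor s (fun j => (spinor s ε c r j : S0 s ε c)) i := by
  obtain ⟨h1, h2, h3, h4⟩ := spinor_ops hq c
    (fun a b => tensorAct s ε c (Cl.rightCoaction s ε c (Cl.theta s ε c (a, b))))
    (spinorTensor s (fun j => (spinor s ε c true j : S0 s ε c)))
    (spinorTensor s (fun j => (spinor s ε c false j : S0 s ε c)))
    (tensorAct_theta_spinor ε c hq true) (tensorAct_theta_spinor ε c hq false)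
  have hne : -((c : ℂ) * (1 + q s ^ 2)) ≠ 0 :=
    neg_ne_zero.mpr (mul_ne_zero c.ne_zero (one_add_q_sq_ne_zero hq))
  have hvac : spinorCoaction s ε c (spinor s ε c true 1) =
      spinorTensor s (fun j => (spinor s ε c true j : S0 s ε c)) 1 := by
    rw [spinorCoaction_apply, inv_smul_eq_iff₀ hne, ← h1]
    change tensorAct s ε c (Cl.rightCoaction s ε c
      (Cl.theta s ε c (1, 0) * Cl.theta s ε c (1, 1))) _ = _
    rw [map_mul, tensorAct_mul]
  have hP : (spinor s ε c true 0 : S0 s ε c) = (q s ^ 2 / ((1 + q s ^ 2) * c)) •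
      Cl.theta s ε c (0, 0) • Cl.theta s ε c (0, 1) • (spinor s ε c true 1 : S0 s ε c) :=
    Subtype.ext (psiPlus_zero s ε c)
  have hQ0 : (spinor s ε c false 0 : S0 s ε c) =
      Cl.theta s ε c (0, 0) • (spinor s ε c true 1 : S0 s ε c) :=
    Subtype.ext (psiMinus_zero s ε c)
  have hQ1 : (spinor s ε c false 1 : S0 s ε c) =
      q s • Cl.theta s ε c (0, 1) • (spinor s ε c true 1 : S0 s ε c) :=
    Subtype.ext (psiMinus_one s ε c)
  cases r <;> fin_cases i
  · change spinorCoaction s ε c (spinor s ε c false 0) = _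
    rw [hQ0, spinorCoaction_smul, hvac]
    exact h2
  · change spinorCoaction s ε c (spinor s ε c false 1) = _
    rw [hQ1, map_smul, spinorCoaction_smul, hvac]
    exact h3
  · change spinorCoaction s ε c (spinor s ε c true 0) = _
    rw [hP, map_smul, spinorCoaction_smul, spinorCoaction_smul, hvac]
    exact h4
  · exact hvac

/-- Left multiplication of `A` on `S_0`, as a homomorphism. -/
def S0.leftHom (s : ℂˣ) (ε : ℤˣ) (c : ℂˣ) : OSL s →ₐ[ℂ] Module.End ℂ (S0 s ε c) :=
  (Algebra.lsmul ℂ ℂ (S0 s ε c)).comp (Cl.ofAlg s ε c)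

theorem spinorCoaction_isRightCoaction (hq : q s ^ 2 ≠ -1) :
    IsRightCoaction (spinorCoaction s ε c) := by
  refine isRightCoaction_of_left (spinorCoaction s ε c) (S0.leftHom s ε c) (fun k l x => ?_)
    (fun p : Bool × Fin 2 => (spinor s ε c p.1 p.2 : S0 s ε c)) (span_smul_spinor ε c hq)
    (fun p => ?_) fun p => ?_
  · refine (spinorCoaction_smul s ε c (Cl.ofAlg s ε c (u s k l)) x).trans ?_
    simp only [Cl.rightCoaction_ofAlg, OSL.comul_u, map_sum, LinearMap.sum_apply,
      Algebra.TensorProduct.map_tmul, AlgHom.id_apply]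
    rfl
  · exact spinorTensor_coassoc (fun j => (spinor s ε c p.1 j : S0 s ε c)) _
      (spinorCoaction_spinor ε c hq p.1) p.2
  · rw [spinorCoaction_spinor ε c hq]
    exact spinorTensor_counit _ p.2

end SpinorCoaction

section RightAction

variable (s : ℂˣ) (ε : ℤˣ) (c : ℂˣ)

theorem theta_mul_u_mul (i : Idx) (k l : Fin 2) (y : Cl s ε c) :
    Cl.theta s ε c i * (Cl.ofAlg s ε c (u s k l) * y) = ((ε : ℤ) : ℂ) •
      ∑ j, ∑ m, fEntry s m l i j • (Cl.ofAlg s ε c (u s k m) * (Cl.theta s ε c j * y)) := by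
  rw [← mul_assoc, Cl.theta_mul_u]
  simp only [Finset.sum_mul, Finset.smul_sum, fGen_eq, smul_smul, smul_mul_assoc, mul_assoc]

theorem sign_mul_sign_mul (z : ℂ) : ((ε : ℤ) : ℂ) * (((ε : ℤ) : ℂ) * z) = z := by
  rw [← mul_assoc, sign_mul_sign, one_mul]

theorem sign_sq : ((ε : ℤ) : ℂ) ^ 2 = 1 := by rw [sq, sign_mul_sign]

theorem psiPlus_one_mul_u (k l : Fin 2) : psiPlus s ε c 1 * Cl.ofAlg s ε c (u s k l) =
    (if l = 0 then (q s)⁻¹ else q s) • (Cl.ofAlg s ε c (u s k l) * psiPlus s ε c 1) := by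
  have h1 := theta_mul_u_mul s ε c (1, 1) k l 1
  rw [mul_one] at h1
  have h2 : psiPlus s ε c 1 * Cl.ofAlg s ε c (u s k l) =
      Cl.theta s ε c (1, 0) * (Cl.theta s ε c (1, 1) * Cl.ofAlg s ε c (u s k l)) :=
    mul_assoc _ _ _
  rw [h2, h1, psiPlus_one]
  fin_cases l <;>
    simp [Fintype.sum_prod_type, fEntry, theta_mul_u_mul, smul_smul, sign_mul_sign_mul, theta_sq, mul_add]

variable {s}

theorem psiPlus_zero_mul_u (hq : q s ^ 2 ≠ -1) (k l : Fin 2) :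
    psiPlus s ε c 0 * Cl.ofAlg s ε c (u s k l) =
      Cl.ofAlg s ε c (u s k l) * psiPlus s ε c 0 + (if l = 0 then 0 else qhat s) •
        (Cl.ofAlg s ε c (u s k 0) * psiPlus s ε c 1) := by
  have hs : (s : ℂ) ≠ 0 := s.ne_zero
  have hc : (c : ℂ) ≠ 0 := c.ne_zero
  have h1 : 1 + (s : ℂ) ^ 4 ≠ 0 := by
    simpa only [q, ← pow_mul] using one_add_q_sq_ne_zero hq
  have h2 := psiPlus_one_mul_u s ε c k l
  rw [psiPlus_one] at h2
  rw [psiPlus_zero, psiPlus_one, smul_mul_assoc, mul_assoc, mul_assoc, h2]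
  fin_cases l <;>
    simp [Fintype.sum_prod_type, fEntry, theta_mul_u_mul, smul_smul, theta_00_00_vac, theta_10_vac, theta_11_vac, theta_10_01_vac,
      theta_10_00_vac, mul_add] <;>
    match_scalars <;> simp only [q, qhat, ← pow_mul, Nat.reduceMul] <;> field_simp <;>
    simp only [sign_sq, one_mul] <;> ring

theorem S0.coe_psiPlus (s : ℂˣ) (j : Fin 2) :
    ((S0.psiPlus s ε c j : S0 s ε c) : Cl s ε c) = QSpin.psiPlus s ε c j := rfl

theorem S0.coe_rightAct (s : ℂˣ) (x : S0 s ε c) (a : OSL s) :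
    (S0.rightAct s ε c x a : Cl s ε c) = x * Cl.ofAlg s ε c a := rfl

theorem rightAct_psiPlus (hq : q s ^ 2 ≠ -1) (j k l : Fin 2) :
    S0.rightAct s ε c (S0.psiPlus s ε c j : S0 s ε c) (u s k l) =
      (if j = 0 then 1 else if l = 0 then (q s)⁻¹ else q s) •
        Cl.ofAlg s ε c (u s k l) • (S0.psiPlus s ε c j : S0 s ε c) +
      (if j = 0 then if l = 0 then 0 else qhat s else 0) •
        Cl.ofAlg s ε c (u s k 0) • (S0.psiPlus s ε c 1 : S0 s ε c) := by
  apply Subtype.ext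
  fin_cases j
  · have h := psiPlus_zero_mul_u ε c hq k l
    fin_cases l <;> simpa [S0.coe_rightAct, S0.coe_psiPlus] using h
  · have h := psiPlus_one_mul_u s ε c k l
    fin_cases l <;> simpa [S0.coe_rightAct, S0.coe_psiPlus] using h

theorem chi_mul_incl_u (k l : Fin 2) : Atilde.chi s * Atilde.incl s (u s k l) =
    q s ^ ((l : ℤ) - (k : ℤ)) • (Atilde.incl s (u s k l) * Atilde.chi s) := by
  rw [Atilde.chi, Atilde.chiPow_mul_incl, smul_eq_chiAut_zpow, toAdd_ofAdd, zpow_one, chiAut_u,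
    map_smul, smul_mul_assoc]

theorem spinorCoaction_vac_mul_u (hq : q s ^ 2 ≠ -1) (k l : Fin 2) :
    spinorCoaction s ε c (S0.rightAct s ε c (S0.psiPlus s ε c 1 : S0 s ε c) (u s k l)) =
      TensorProduct.map₂ (S0.rightAct s ε c) (Atilde.rightAct s)
        (spinorCoaction s ε c (S0.psiPlus s ε c 1 : S0 s ε c))
        (Coalgebra.comul (R := ℂ) (u s k l)) := by
  have hs : (s : ℂ) ≠ 0 := s.ne_zero
  have h := (u_isQuantumMatrix s).map (Atilde.incl s)
  have hab := h.ab
  have hbd := h.bd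
  have hcd := h.cd
  have hbc := h.bc
  have had := h.ad
  have hda := h.da
  simp only [Matrix.map_apply] at hab hbd hcd hbc had hda
  have h1 := spinorCoaction_spinor ε c hq true 1
  simp only [spinor, cond_true, spinorTensor] at h1
  have hr : ∀ (w : Atilde s) (k l : Fin 2),
      Atilde.rightAct s (w * Atilde.chi s) (u s k l) =
        q s ^ ((l : ℤ) - (k : ℤ)) • (w * Atilde.incl s (u s k l) * Atilde.chi s) := by
    intro w k l
    change w * Atilde.chi s * Atilde.incl s (u s k l) = _
    rw [mul_assoc, chi_mul_incl_u, mul_smul_comm, mul_assoc]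
  have hl : ∀ (a : OSL s) (x y : Atilde s), Atilde.leftAct s a (x * y) =
      Atilde.incl s a * x * y := fun a x y => (mul_assoc _ _ _).symm
  have hL : ∀ (v : Cl s ε c) (x : S0 s ε c), S0.leftAct s ε c v x = v • x := fun _ _ => rfl
  rw [rightAct_psiPlus ε c hq, if_neg one_ne_zero, if_neg one_ne_zero, zero_smul, add_zero,
    map_smul, spinorCoaction_smul, h1]
  simp only [Cl.rightCoaction_ofAlg, OSL.comul_u, map_sum, LinearMap.sum_apply,
      Algebra.TensorProduct.map_tmul, AlgHom.id_apply, TensorProduct.map_tmul,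
      TensorProduct.map₂_apply_tmul, rightAct_psiPlus ε c hq, hr, hl, hL]
  simp only [Fin.sum_univ_two]
  generalize Cl.ofAlg s ε c (u s k 0) • (S0.psiPlus s ε c 0 : S0 s ε c) = y₀₀
  generalize Cl.ofAlg s ε c (u s k 0) • (S0.psiPlus s ε c 1 : S0 s ε c) = y₀₁
  generalize Cl.ofAlg s ε c (u s k 1) • (S0.psiPlus s ε c 0 : S0 s ε c) = y₁₀
  generalize Cl.ofAlg s ε c (u s k 1) • (S0.psiPlus s ε c 1 : S0 s ε c) = y₁₁
  fin_cases l <;>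
    simp [hab, hbd, hcd, hbc, had, hda, TensorProduct.tmul_add, TensorProduct.add_tmul,
      add_mul, ← TensorProduct.smul_tmul', smul_smul] <;>
    match_scalars <;> simp only [q, qhat, ← pow_mul, Nat.reduceMul] <;> field_simp <;> try ring

end RightAction

section DoiHopfModule

theorem isDoiHopfDatum (s : ℂˣ) :
    IsDoiHopfDatum (Bialgebra.comulAlgHom ℂ (OSL s)) (Atilde.rightAct s) where
  coaction := ⟨fun a => Coalgebra.coassoc_apply a, fun a => by
    have h := Coalgebra.lTensor_counit_comul (R := ℂ) a
    change TensorProduct.rid ℂ _ ((Coalgebra.counit (R := ℂ)).lTensor _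
      (Coalgebra.comul (R := ℂ) a)) = a
    rw [h]
    simp⟩
  action := ⟨fun w => by simp [Atilde.rightAct], fun w a b => by
    simp [Atilde.rightAct, mul_assoc]⟩
  comul_act w a := by
    change Coalgebra.comul (R := ℂ) (w * Atilde.incl s a) = _
    rw [Bialgebra.comul_mul, Atilde.comul_incl]
    generalize Coalgebra.comul (R := ℂ) w = y
    generalize Coalgebra.comul (R := ℂ) a = z
    induction z using TensorProduct.induction_on with
    | zero => simp
    | add z z' h h' => simp only [map_add, mul_add, h, h']
    | tmul a a' =>
      induction y using TensorProduct.induction_on with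
      | zero => simp
      | add y y' h h' => simp only [map_add, add_mul, LinearMap.add_apply, h, h']
      | tmul w w' =>
        rw [Algebra.TensorProduct.map_tmul, Algebra.TensorProduct.tmul_mul_tmul]
        rfl
  counit_act w a := by
    change Coalgebra.counit (R := ℂ) (w * Atilde.incl s a) = _
    rw [Bialgebra.counit_mul, Atilde.counit_incl]

theorem map₂_map₂_of_isRightAction {M N A B : Type*} [AddCommGroup M] [Module ℂ M]
    [AddCommGroup N] [Module ℂ N] [Ring A] [Algebra ℂ A] [Ring B] [Algebra ℂ B]
    {f : M →ₗ[ℂ] A →ₗ[ℂ] M} {g : N →ₗ[ℂ] B →ₗ[ℂ] N} (hf : IsRightAction f)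
    (hg : IsRightAction g) (m : M ⊗[ℂ] N) (y z : A ⊗[ℂ] B) :
    TensorProduct.map₂ f g (TensorProduct.map₂ f g m y) z =
      TensorProduct.map₂ f g m (y * z) := by
  induction z using TensorProduct.induction_on with
  | zero => simp
  | add z z' h h' => simp only [map_add, mul_add, h, h']
  | tmul a b =>
    induction y using TensorProduct.induction_on with
    | zero => simp
    | add y y' h h' => simp only [map_add, add_mul, LinearMap.add_apply, h, h']
    | tmul a' b' =>
      induction m using TensorProduct.induction_on with
      | zero => simp
      | add m m' h h' => simp only [map_add, LinearMap.add_apply, h, h']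
      | tmul m n =>
        simp [TensorProduct.map₂_apply_tmul, hf.act_mul, hg.act_mul]

theorem map₂_one_of_isRightAction {M N A B : Type*} [AddCommGroup M] [Module ℂ M]
    [AddCommGroup N] [Module ℂ N] [Ring A] [Algebra ℂ A] [Ring B] [Algebra ℂ B]
    {f : M →ₗ[ℂ] A →ₗ[ℂ] M} {g : N →ₗ[ℂ] B →ₗ[ℂ] N} (hf : IsRightAction f)
    (hg : IsRightAction g) (m : M ⊗[ℂ] N) : TensorProduct.map₂ f g m 1 = m := by
  induction m using TensorProduct.induction_on with
  | zero => simp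
  | add m m' h h' => simp only [map_add, LinearMap.add_apply, h, h']
  | tmul m n => simp [Algebra.TensorProduct.one_def, hf.act_one, hg.act_one]

variable {s : ℂˣ} (ε : ℤˣ) (c : ℂˣ)

theorem S0.rightAct_isRightAction (s : ℂˣ) : IsRightAction (S0.rightAct s ε c) where
  act_one x := Subtype.ext (by simp [S0.coe_rightAct])
  act_mul x a b := Subtype.ext (by simp [S0.coe_rightAct, mul_assoc])

theorem tensorAct_map₂_rightAct (y : Cl s ε c ⊗[ℂ] OSL s) (m : S0 s ε c ⊗[ℂ] Atilde s)
    (z : OSL s ⊗[ℂ] OSL s) :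
    TensorProduct.map₂ (S0.rightAct s ε c) (Atilde.rightAct s) (tensorAct s ε c y m) z =
      tensorAct s ε c y
        (TensorProduct.map₂ (S0.rightAct s ε c) (Atilde.rightAct s) m z) := by
  induction z using TensorProduct.induction_on with
  | zero => simp
  | add z z' h h' => rw [map_add, map_add, map_add, h, h']
  | tmul a b =>
    induction y using TensorProduct.induction_on with
    | zero => simp
    | add y y' h h' =>
      rw [map_add, LinearMap.add_apply, map_add, LinearMap.add_apply, LinearMap.add_apply, h, h']
    | tmul v a' =>
      induction m using TensorProduct.induction_on with
      | zero => simp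
      | add m m' h h' =>
        rw [map_add, map_add, LinearMap.add_apply, map_add, LinearMap.add_apply, map_add, h, h']
      | tmul x w =>
        have h1 : S0.rightAct s ε c (v • x) a = v • S0.rightAct s ε c x a :=
          Subtype.ext (mul_assoc v x _)
        have h2 : Atilde.rightAct s (Atilde.incl s a' * w) b =
            Atilde.incl s a' * Atilde.rightAct s w b := mul_assoc _ _ _
        have h3 : ∀ (x : S0 s ε c) (w : Atilde s),
            TensorProduct.map₂ (S0.rightAct s ε c) (Atilde.rightAct s) (x ⊗ₜ w) (a ⊗ₜ b) =
              S0.rightAct s ε c x a ⊗ₜ Atilde.rightAct s w b := fun _ _ => rfl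
        rw [tensorAct_tmul, h3, h3, tensorAct_tmul, h1, h2]

theorem spinorCoaction_rightAct (hq : q s ^ 2 ≠ -1) (x : S0 s ε c) (a : OSL s) :
    spinorCoaction s ε c (S0.rightAct s ε c x a) =
      TensorProduct.map₂ (S0.rightAct s ε c) (Atilde.rightAct s) (spinorCoaction s ε c x)
        (Bialgebra.comulAlgHom ℂ (OSL s) a) := by
  have hS := S0.rightAct_isRightAction ε c s
  have hA := (isDoiHopfDatum s).action
  have ha : a ∈ Algebra.adjoin ℂ {x | ∃ i j, x = u s i j} := OSL.adjoin_u s ▸ Algebra.mem_top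
  induction ha using Algebra.adjoin_induction generalizing x with
  | mem a ha =>
    obtain ⟨k, l, rfl⟩ := ha
    obtain ⟨v, hv⟩ := Submodule.mem_span_singleton.mp ((S0_eq_span s ε c).le x.2)
    obtain rfl : v • (S0.psiPlus s ε c 1 : S0 s ε c) = x := Subtype.ext hv
    have h1 : S0.rightAct s ε c (v • (S0.psiPlus s ε c 1 : S0 s ε c)) (u s k l) =
        v • S0.rightAct s ε c (S0.psiPlus s ε c 1 : S0 s ε c) (u s k l) :=
      Subtype.ext (mul_assoc v _ _)
    rw [h1, spinorCoaction_smul, spinorCoaction_vac_mul_u ε c hq, spinorCoaction_smul,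
      tensorAct_map₂_rightAct, Bialgebra.comulAlgHom_apply]
  | algebraMap z =>
    rw [AlgHom.commutes, Algebra.algebraMap_eq_smul_one, Algebra.algebraMap_eq_smul_one, map_smul,
      map_smul, map_smul, hS.act_one, map₂_one_of_isRightAction hS hA]
  | add a b _ _ h h' =>
    rw [map_add, map_add, map_add, map_add, h, h']
  | mul a b _ _ h h' =>
    rw [hS.act_mul, h', h, map_mul, map₂_map₂_of_isRightAction hS hA]

theorem spinorCoaction_isDoiHopfModule (hq : q s ^ 2 ≠ -1) :
    IsDoiHopfModule (Bialgebra.comulAlgHom ℂ (OSL s)) (Atilde.rightAct s)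
      (S0.rightAct s ε c) (spinorCoaction s ε c) where
  datum := isDoiHopfDatum s
  action := S0.rightAct_isRightAction ε c s
  coaction := spinorCoaction_isRightCoaction ε c hq
  compat := spinorCoaction_rightAct ε c hq

end DoiHopfModule

section Invariants

variable {s : ℂˣ} (ε : ℤˣ) (c : ℂˣ)

theorem isSpinorCoaction_iff (D : S0.inv s ε c →ₗ[ℂ] S0.inv s ε c ⊗[ℂ] Atilde s) :
    IsSpinorCoaction D ↔ ∀ r i, D (spinor s ε c r i) = spinorTensor s (spinor s ε c r) i :=
  ⟨fun h r i => by
    cases r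
    · exact h.minus i
    · exact h.plus i, fun h => ⟨h true, h false⟩⟩

/-- The coaction of `Ã` on `S_0` restricts to the left-invariant elements. -/
theorem exists_invariant_coaction (hq : q s ^ 2 ≠ -1) :
    ∃ D : S0.inv s ε c →ₗ[ℂ] S0.inv s ε c ⊗[ℂ] Atilde s,
      ∀ x, (S0.inv s ε c).subtype.rTensor (Atilde s) (D x) = spinorCoaction s ε c x := by
  set J := (S0.inv s ε c).subtype.rTensor (Atilde s) with hJ
  have hinj : Function.Injective J :=
    Module.Flat.rTensor_preserves_injective_linearMap _ Subtype.val_injective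
  have hrange : ∀ x : S0.inv s ε c, spinorCoaction s ε c x ∈ LinearMap.range J := by
    have h : (⊤ : Submodule ℂ (S0.inv s ε c)) ≤
        (LinearMap.range J).comap (spinorCoaction s ε c ∘ₗ (S0.inv s ε c).subtype) := by
      rw [← span_spinor ε c hq]
      refine Submodule.span_le.mpr ?_
      rintro _ ⟨⟨r, i⟩, rfl⟩
      refine ⟨spinorTensor s (spinor s ε c r) i, ?_⟩
      rw [LinearMap.comp_apply, Submodule.subtype_apply, spinorCoaction_spinor ε c hq]
      simp [hJ, spinorTensor]
    exact fun x => h (x := x) trivial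
  refine ⟨(LinearEquiv.ofInjective J hinj).symm.toLinearMap ∘ₗ
    (spinorCoaction s ε c ∘ₗ (S0.inv s ε c).subtype).codRestrict (LinearMap.range J) hrange,
    fun x => ?_⟩
  exact congrArg Subtype.val ((LinearEquiv.ofInjective J hinj).apply_symm_apply _)

end Invariants

end QSpin

end

theorem mainTheorem6 (s : ℂˣ) (hq : QSpin.q s ^ 2 ≠ -1) (ε : ℤˣ) (c : ℂˣ) :
    ∃ ΔR' : QSpin.S0.inv s ε c →ₗ[ℂ] QSpin.S0.inv s ε c ⊗[ℂ] QSpin.Atilde s,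
      (QSpin.IsSpinorCoaction ΔR' ∧ ∀ D, QSpin.IsSpinorCoaction D → D = ΔR') ∧
      QSpin.IsRightCoaction ΔR' ∧
      ∃ ΔR : QSpin.S0 s ε c →ₗ[ℂ] QSpin.S0 s ε c ⊗[ℂ] QSpin.Atilde s,
        (∀ x : QSpin.S0.inv s ε c,
          ΔR x = (QSpin.S0.inv s ε c).subtype.rTensor (QSpin.Atilde s) (ΔR' x)) ∧
        QSpin.IsDoiHopfModule (Bialgebra.comulAlgHom ℂ (QSpin.OSL s)) (QSpin.Atilde.rightAct s)
          (QSpin.S0.rightAct s ε c) ΔR ∧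
        ∀ (v : QSpin.Cl s ε c) (x : QSpin.S0 s ε c),
          ΔR (v • x) =
            TensorProduct.map₂ (QSpin.S0.leftAct s ε c) (QSpin.Atilde.leftAct s)
              (QSpin.Cl.rightCoaction s ε c v) (ΔR x) := by
  obtain ⟨D, hD⟩ := QSpin.exists_invariant_coaction ε c hq
  have hinj : Function.Injective ((QSpin.S0.inv s ε c).subtype.rTensor (QSpin.Atilde s)) :=
    Module.Flat.rTensor_preserves_injective_linearMap _ Subtype.val_injective
  have hDs : ∀ r i, D (QSpin.spinor s ε c r i) =
      QSpin.spinorTensor s (QSpin.spinor s ε c r) i := by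
    intro r i
    apply hinj
    rw [hD, QSpin.spinorCoaction_spinor ε c hq]
    simp [QSpin.spinorTensor]
  have hspan := QSpin.span_spinor ε c hq
  refine ⟨D, ⟨(QSpin.isSpinorCoaction_iff ε c D).mpr hDs, fun D' hD' => ?_⟩, ⟨?_, ?_⟩,
    QSpin.spinorCoaction s ε c, fun x => (hD x).symm, QSpin.spinorCoaction_isDoiHopfModule ε c hq,
    QSpin.spinorCoaction_smul s ε c⟩
  · refine LinearMap.ext_on_range hspan fun p => ?_
    rw [hDs, (QSpin.isSpinorCoaction_iff ε c D').mp hD']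
  · refine LinearMap.congr_fun (f := (TensorProduct.assoc ℂ _ _ _).toLinearMap ∘ₗ
      D.rTensor (QSpin.Atilde s) ∘ₗ D) (g := (Coalgebra.comul (R := ℂ)).lTensor _ ∘ₗ D)
      (LinearMap.ext_on_range hspan fun p => ?_)
    exact QSpin.spinorTensor_coassoc _ D (hDs p.1) p.2
  · refine LinearMap.congr_fun (f := (TensorProduct.rid ℂ _).toLinearMap ∘ₗ
      (Coalgebra.counit (R := ℂ)).lTensor _ ∘ₗ D) (g := LinearMap.id)
      (LinearMap.ext_on_range hspan fun p => ?_)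
    simp only [LinearMap.comp_apply, hDs]
    exact QSpin.spinorTensor_counit _ p.2
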